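/- Let $2\le n\le 4$ and $\mathfrak{gl}_n=\mathfrak{gl}_n(\mathbb C)$ with matrix units $E_{ij}$. **Tableaux.** A (Gelfand–Tsetlin) tableau $T(L)$ is an array $L=(l_{ij})_{1\le j\le i\le n}$ of complex numbers; $(l_{n1},\dots,l_{nn})$ is its top row. It is *noncritical* if $l_{ki}\ne l_{kj}$ for all $1\le i<j\le k\le n-1$. Let $\delta^{ki}$ be the array with entry $1$ at $(k,i)$ and $0$ elsewhere. For a vector space with a basis $\mathcal B$ that is a set of noncritical tableaux, the *Gelfand–Tsetlin formulas* are $$E_{k,k+1}T(L)=-\sum_{i=1}^{k}\frac{\prod_{j=1}^{k+1}(l_{ki}-l_{k+1,j})}{\prod_{j\ne i}(l_{ki}-l_{kj})}T(L+\delta^{ki}),\qquad E_{k+1,k}T(L)=\sum_{i=1}^{k}\frac{\prod_{j=1}^{k-1}(l_{ki}-l_{k-1,j})}{\prod_{j\ne i}(l_{ki}-l_{kj})}T(L-\delta^{ki})$$ for $1\le k\le n-1$, and $$E_{kk}T(L)=\Big(k-1+\sum_{i=1}^{k}l_{ki}-\sum_{i=1}^{k-1}l_{k-1,i}\Big)T(L)$$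 for $1\le k\le n$, where tableaux that are not in $\mathcal B$ are read as $0$. **Tableaux modules.** Let $U_m=U(\mathfrak{gl}_m)\subseteq U(\mathfrak{gl}_n)$, where $\mathfrak{gl}_m$ is spanned by the $E_{ij}$ with $i,j\le m$, and let $\Gamma\subseteq U(\mathfrak{gl}_n)$ be the (commutative) subalgebra generated by the centers of $U_1,\dots,U_n$. A *Gelfand–Tsetlin module* is a finitely generated $\mathfrak{gl}_n$-module $V$ with $V=\bigoplus_{\mathfrak m}V(\mathfrak m)$, where $\mathfrak m$ runs over the maximal ideals of $\Gamma$ and $V(\mathfrak m)=\{v:\mathfrak m^kv=0\text{ for some }k\}$. It is a *tableaux module* if (i) it has a basis consisting of noncritical tableaux, (ii) $\mathfrak{gl}_n$ acts on this basis by the Gelfand–Tsetlin formulas, (iii) $\dim V(\mathfrak m)=1$ whenever $V(\mathfrak m)\neq0$, and (iv) for $1\le k\le m\le n$ the element $c_{mk}=\sum_{i_1,\dots,i_k=1}^{m}E_{i_1i_2}E_{i_2i_3}\cdots E_{i_ki_1}$ acts on each basis tableau by $c_{mk}T(L)=\gamma_{mk}(L)T(L)$, where $\gamma_{mk}$ is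 the polynomial $$\gamma_{mk}(L)=\sum_{i=1}^m(l_{mi}+m-1)^k\prod_{j\ne i}\Big(1-\frac1{l_{mi}-l_{mj}}\Big).$$ **Relations.** Let $\mathcal R$ consist of the relations $(i,j)\ge(i-1,j')$ and $(i-1,j')>(i,j)$ for $1\le j\le i\le n$, $1\le j'\le i-1$, and let $\mathcal R^0$ consist of the relations $(n,i)\ge(n,j)$, $1\le i\ne j\le n$. A tableau satisfies $(i,j)\ge(s,t)$ (resp. $(i,j)>(s,t)$) if $l_{ij}-l_{st}$ belongs to $\mathbb Z_{\ge0}$ (resp. $\mathbb Z_{>0}$). For $\mathcal C\subseteq\mathcal R\cup\mathcal R^0$ and $T(L)$ satisfying (all relations of) $\mathcal C$, let $\mathcal B_{\mathcal C}(T(L))$ be the set of all tableaux $T(L+z)$ that satisfy $\mathcal C$, where $z$ is an integral array with zero top row, and let $V_{\mathcal C}(T(L))$ be the complex vector space with basis $\mathcal B_{\mathcal C}(T(L))$. Call $T(L)$ a *$\mathcal C$-realization* if it satisfies $\mathcal C$ and all elements of $\mathcal B_{\mathcal C}(T(L))$ are noncritical. Call $\mathcal C$ *admissible* if for every $\mathcal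 C$-realization $T(L)$ the Gelfand–Tsetlin formulas define a $\mathfrak{gl}_n$-module structure on $V_{\mathcal C}(T(L))$. **Statement.** Let $V$ be an irreducible tableaux Gelfand–Tsetlin $\mathfrak{gl}_n$-module, $2\le n\le4$. Then there are an admissible set of relations $\mathcal C\subseteq\mathcal R\cup\mathcal R^0$ and a $\mathcal C$-realization $T(L)$ (in particular, a tableau satisfying $\mathcal C$) such that $V$ is isomorphic, as a $\mathfrak{gl}_n$-module, to $V_{\mathcal C}(T(L))$ with the action given by the Gelfand–Tsetlin formulas. -/

import Mathlib

/- The commutator bracket of an associative algebra, in particular of matrices and of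
endomorphisms of a vector space. -/
attribute [local instance] LieRing.ofAssociativeRing

noncomputable section

namespace GelfandTsetlin

/-- The Lie algebra `gl_n` of complex `n × n` matrices (with the commutator bracket). -/
abbrev Gl (n : ℕ) : Type := Matrix (Fin n) (Fin n) ℂ

/-- The elementary matrix `E_{ij}` (indices start from `0`). -/
def E {n : ℕ} (i j : Fin n) : Gl n := Matrix.single i j 1

/-! ### Tableaux -/

/-- The set of positions `(i, j)`, `1 ≤ j ≤ i ≤ n`, of a triangular array of height `n`. The row
number is `Pos.row`, which takes the values `1, …, n`; the row `n` is the top row. -/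
abbrev Pos (n : ℕ) : Type := Σ i : Fin n, Fin (i.val + 1)

/-- The (one-based) number of the row of a position. -/
def Pos.row {n : ℕ} (p : Pos n) : ℕ := p.1.val + 1

/-- The finite set of the positions in row `m`. -/
def rowSet (n m : ℕ) : Finset (Pos n) := Finset.univ.filter fun p => p.row = m

/-- A Gelfand-Tsetlin tableau `T(L)` of height `n`, given by its entries `L`. -/
abbrev Tableau (n : ℕ) : Type := Pos n → ℂ

/-- `L + δ^p`. -/
def Tableau.raise {n : ℕ} (L : Tableau n) (p : Pos n) : Tableau n := L + Pi.single p 1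

/-- `L - δ^p`. -/
def Tableau.lower {n : ℕ} (L : Tableau n) (p : Pos n) : Tableau n := L - Pi.single p 1

/-- A tableau is noncritical if the entries of every row below the top row are distinct. -/
def Tableau.Noncritical {n : ℕ} (L : Tableau n) : Prop :=
  ∀ p q : Pos n, p.row = q.row → p.row < n → p ≠ q → L p ≠ L q

/-! ### Relations -/

/-- The formal relations `p ≥ q` and `p > q` between positions. -/
inductive Relation (n : ℕ) : Type
  | ge (p q : Pos n) : Relation n
  | gt (p q : Pos n) : Relation n

/-- `T(L)` satisfies `p ≥ q` if `L p - L q ∈ ℤ_{≥ 0}`, and `p > q` if `L p - L q ∈ ℤ_{> 0}`. -/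
def Tableau.SatisfiesRel {n : ℕ} (L : Tableau n) : Relation n → Prop
  | .ge p q => ∃ m : ℤ, 0 ≤ m ∧ L p - L q = (m : ℂ)
  | .gt p q => ∃ m : ℤ, 0 < m ∧ L p - L q = (m : ℂ)

/-- The set `𝓡` of the relations `(i, j) ≥ (i - 1, j')` and `(i - 1, j') > (i, j)`. -/
def relR (n : ℕ) : Set (Relation n) :=
  {r | ∃ p q : Pos n, p.row = q.row + 1 ∧ (r = .ge p q ∨ r = .gt q p)}

/-- The set `𝓡⁰` of the relations `(n, i) ≥ (n, j)`, `i ≠ j`. -/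
def relR0 (n : ℕ) : Set (Relation n) :=
  {r | ∃ p q : Pos n, p.row = n ∧ q.row = n ∧ p ≠ q ∧ r = .ge p q}

/-- `T(L)` satisfies all the relations of `C`. -/
def Tableau.Satisfies {n : ℕ} (L : Tableau n) (C : Set (Relation n)) : Prop :=
  ∀ r ∈ C, L.SatisfiesRel r

/-- The set `𝓑_C(T(L))` of all tableaux `T(L + z)` that satisfy `C`, where `z` is an integral
array whose top row is zero. -/
def basisSet {n : ℕ} (C : Set (Relation n)) (L : Tableau n) : Set (Tableau n) :=
  {R | (∃ z : Pos n → ℤ, (∀ p, p.row = n → z p = 0) ∧ ∀ p, R p = L p + (z p : ℂ)) ∧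
    R.Satisfies C}

/-- `T(L)` is a `C`-realization: it satisfies `C`, and all tableaux of `𝓑_C(T(L))` are
noncritical. -/
def IsRealization {n : ℕ} (C : Set (Relation n)) (L : Tableau n) : Prop :=
  L.Satisfies C ∧ ∀ R ∈ basisSet C L, R.Noncritical

/-! ### Gelfand-Tsetlin formulas -/

/-- The coefficient of `T(L + δ^p)`, `p` in row `k`, in `E_{k,k+1} T(L)`. -/
def raiseCoeff {n : ℕ} (L : Tableau n) (p : Pos n) : ℂ :=
  -((∏ q ∈ rowSet n (p.row + 1), (L p - L q)) / ∏ q ∈ (rowSet n p.row).erase p, (L p - L q))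

/-- The coefficient of `T(L - δ^p)`, `p` in row `k`, in `E_{k+1,k} T(L)`. -/
def lowerCoeff {n : ℕ} (L : Tableau n) (p : Pos n) : ℂ :=
  (∏ q ∈ rowSet n (p.row - 1), (L p - L q)) / ∏ q ∈ (rowSet n p.row).erase p, (L p - L q)

open Classical in
/-- The vector `T(R)` in a space with a basis indexed by the set `B` of tableaux; it is zero if
`T(R)` is not in `B`. -/
def tableauVector {n : ℕ} {B : Set (Tableau n)} {W : Type*} [AddCommGroup W] [Module ℂ W]
    (b : Module.Basis B ℂ W) (R : Tableau n) : W :=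
  if h : R ∈ B then b ⟨R, h⟩ else 0

/-- The action `ρ` of `gl_n` on a space with a basis `b` of tableaux is given by the
Gelfand-Tsetlin formulas for the generators `E_{k,k+1}`, `E_{k+1,k}` (`1 ≤ k ≤ n - 1`) and `E_{kk}`
(`1 ≤ k ≤ n`); tableaux outside of the basis are read as zero. In `raise` and `lower` the matrix
index `k`, which starts from `0`, belongs to row `k + 1`, and likewise `i` in `diag`. -/
structure FollowsGTFormulas {n : ℕ} {B : Set (Tableau n)} {W : Type*} [AddCommGroup W]
    [Module ℂ W] (ρ : Gl n →ₗ⁅ℂ⁆ Module.End ℂ W) (b : Module.Basis B ℂ W) : Prop where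
  raise : ∀ (k : ℕ) (hk : k + 1 < n) (T : B),
    ρ (E ⟨k, Nat.lt_of_succ_lt hk⟩ ⟨k + 1, hk⟩) (b T) =
      ∑ p ∈ rowSet n (k + 1), raiseCoeff T.1 p • tableauVector b (T.1.raise p)
  lower : ∀ (k : ℕ) (hk : k + 1 < n) (T : B),
    ρ (E ⟨k + 1, hk⟩ ⟨k, Nat.lt_of_succ_lt hk⟩) (b T) =
      ∑ p ∈ rowSet n (k + 1), lowerCoeff T.1 p • tableauVector b (T.1.lower p)
  diag : ∀ (i : Fin n) (T : B),
    ρ (E i i) (b T) =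
      ((i.val : ℂ) + ∑ p ∈ rowSet n (i.val + 1), T.1 p - ∑ p ∈ rowSet n i.val, T.1 p) • b T

/-- The vector space `V_C(T(L))` with basis `𝓑_C(T(L))`. -/
abbrev VC {n : ℕ} (C : Set (Relation n)) (L : Tableau n) : Type := basisSet C L →₀ ℂ

/-- The tautological basis of `V_C(T(L))`. -/
def VC.basis {n : ℕ} (C : Set (Relation n)) (L : Tableau n) :
    Module.Basis (basisSet C L) ℂ (VC C L) :=
  Finsupp.basisSingleOne

/-- A set of relations `C ⊆ 𝓡 ∪ 𝓡⁰` is admissible if for every `C`-realization `T(L)` the space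
`V_C(T(L))` is a `gl_n`-module by the Gelfand-Tsetlin formulas. -/
def IsAdmissible {n : ℕ} (C : Set (Relation n)) : Prop :=
  C ⊆ relR n ∪ relR0 n ∧
    ∀ L : Tableau n, IsRealization C L →
      ∃ ρ : Gl n →ₗ⁅ℂ⁆ Module.End ℂ (VC C L), FollowsGTFormulas ρ (VC.basis C L)

/-! ### The Gelfand-Tsetlin subalgebra -/

/-- The universal enveloping algebra of `gl_n`. -/
abbrev U (n : ℕ) : Type := UniversalEnvelopingAlgebra ℂ (Gl n)

/-- The subalgebra `U_m = U(gl_m)` of `U(gl_n)`, where `gl_m` is spanned by the `E_{ij}` with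
`1 ≤ i, j ≤ m`. -/
def subU (n m : ℕ) : Subalgebra ℂ (U n) :=
  Algebra.adjoin ℂ {x | ∃ i j : Fin n, i.val < m ∧ j.val < m ∧
    x = UniversalEnvelopingAlgebra.ι ℂ (E i j)}

/-- The center `Z_m` of `U_m`. -/
def centerU (n m : ℕ) : Subalgebra ℂ (U n) :=
  subU n m ⊓ Subalgebra.centralizer ℂ (subU n m : Set (U n))

/-- The Gelfand-Tsetlin subalgebra `Γ`, generated by `Z_1, …, Z_n`. -/
def Gam (n : ℕ) : Subalgebra ℂ (U n) :=
  Algebra.adjoin ℂ {x | ∃ m, 1 ≤ m ∧ m ≤ n ∧ x ∈ centerU n m}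

theorem subU_mono (n : ℕ) {m m' : ℕ} (h : m ≤ m') : subU n m ≤ subU n m' := by
  apply Algebra.adjoin_mono
  rintro x ⟨i, j, hi, hj, rfl⟩
  exact ⟨i, j, by omega, by omega, rfl⟩

theorem centerU_comm {n m m' : ℕ} {x y : U n} (hx : x ∈ centerU n m) (hy : y ∈ centerU n m') :
    x * y = y * x := by
  rcases le_total m m' with h | h
  · exact (Subalgebra.mem_centralizer_iff ℂ).1 hy.2 x (subU_mono n h hx.1)
  · exact ((Subalgebra.mem_centralizer_iff ℂ).1 hx.2 y (subU_mono n h hy.1)).symm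

instance instCommRingGam (n : ℕ) : CommRing (Gam n) :=
  { (Gam n).toRing with
    mul_comm := (Algebra.isMulCommutative_adjoin ℂ (by
      rintro x ⟨m, -, -, hx⟩ y ⟨m', -, -, hy⟩
      exact centerU_comm hx hy) : IsMulCommutative (Gam n)).is_comm.comm }

/-- The generator `c_{mk} = ∑ E_{i₁ i₂} E_{i₂ i₃} ⋯ E_{i_k i₁}` (sum over `i₁, …, i_k` in
`{1, …, m}`), as the trace of the `k`-th power of the matrix `(E_{ij})`, `1 ≤ i, j ≤ m`, with
entries in `U(gl_n)`. -/
def casimir (n m k : ℕ) : U n :=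
  Matrix.trace ((Matrix.of fun i j : {i : Fin n // i.val < m} =>
    (UniversalEnvelopingAlgebra.ι ℂ (E i.1 j.1) : U n)) ^ k)

/-- The polynomial `γ_{mk}`, the polynomial form of the expression in `gammaPoly_eval` below (which
determines it, and in which the denominators cancel): it is minus the coefficient of `u^{m-1}` in
the remainder of `(u + m - 1)^k ∏ (u - λ_{mj} - 1)` modulo `∏ (u - λ_{mj})`. -/
def gammaPoly (n m k : ℕ) : MvPolynomial (Pos n) ℂ :=
  -((((Polynomial.X + Polynomial.C (MvPolynomial.C ((m : ℂ) - 1))) ^ k *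
      ∏ q ∈ rowSet n m, (Polynomial.X - Polynomial.C (MvPolynomial.X q) - 1)) %ₘ
      ∏ q ∈ rowSet n m, (Polynomial.X - Polynomial.C (MvPolynomial.X q))).coeff
    ((rowSet n m).card - 1))

/-- `γ_{mk}(L) = ∑_i (l_{mi} + m - 1)^k ∏_{j ≠ i} (1 - 1 / (l_{mi} - l_{mj}))` wherever the
entries of row `m` are distinct. -/
theorem gammaPoly_eval (n m k : ℕ) (L : Tableau n) (hL : Set.InjOn L (rowSet n m)) :
    MvPolynomial.eval L (gammaPoly n m k) =
      ∑ p ∈ rowSet n m, (L p + m - 1) ^ k *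
        ∏ q ∈ (rowSet n m).erase p, (1 - 1 / (L p - L q)) := by
  set s := rowSet n m
  set F : Polynomial ℂ := (Polynomial.X + Polynomial.C ((m : ℂ) - 1)) ^ k *
    ∏ q ∈ s, (Polynomial.X - Polynomial.C (L q) - 1) with hF
  set D : Polynomial ℂ := ∏ q ∈ s, (Polynomial.X - Polynomial.C (L q)) with hD
  have hDm : D.Monic := Polynomial.monic_prod_of_monic _ _ fun q _ => Polynomial.monic_X_sub_C _
  have h1 : MvPolynomial.eval L (gammaPoly n m k) = -((F %ₘ D).coeff (s.card - 1)) := by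
    rw [gammaPoly, map_neg, ← Polynomial.coeff_map, Polynomial.map_modByMonic]
    · congr 3
      · simp [hF, Polynomial.map_prod, s]
      · simp [hD, Polynomial.map_prod, s]
    · exact Polynomial.monic_prod_of_monic _ _ fun q _ => Polynomial.monic_X_sub_C _
  have hdeg : (F %ₘ D).degree < s.card := by
    have h := Polynomial.degree_modByMonic_lt F hDm
    have h2 : D.degree = s.card := by
      rw [hD, Polynomial.degree_prod]; simp
    rwa [h2] at h
  rw [h1, Lagrange.coeff_eq_sum hL hdeg, ← Finset.sum_neg_distrib]
  refine Finset.sum_congr rfl fun p hp => ?_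
  have hev : (F %ₘ D).eval (L p) = F.eval (L p) := by
    have h := congrArg (Polynomial.eval (L p)) (Polynomial.modByMonic_add_div F D)
    have h0 : D.eval (L p) = 0 := by
      rw [hD, Polynomial.eval_prod]
      exact Finset.prod_eq_zero hp (by simp)
    simpa [h0] using h
  have hFe : F.eval (L p) = -((L p + m - 1) ^ k * ∏ q ∈ s.erase p, (L p - L q - 1)) := by
    rw [hF, Polynomial.eval_mul, Polynomial.eval_prod, ← Finset.mul_prod_erase s _ hp]
    simp [add_sub_assoc]
  rw [hev, hFe, neg_div, neg_neg, mul_div_assoc, ← Finset.prod_div_distrib]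
  congr 1
  refine Finset.prod_congr rfl fun q hq => ?_
  have hne : L p - L q ≠ 0 := by
    intro h
    exact (Finset.ne_of_mem_erase hq)
      (hL (Finset.mem_coe.2 (Finset.mem_of_mem_erase hq)) (Finset.mem_coe.2 hp)
        (sub_eq_zero.1 h).symm)
  field_simp

/-! ### Gelfand-Tsetlin modules and tableaux modules -/

section Modules

variable (n : ℕ) (V : Type*) [AddCommGroup V] [Module ℂ V] [LieRingModule (Gl n) V]
  [LieModule ℂ (Gl n) V]

/-- The action of `U(gl_n)` on a `gl_n`-module. -/
def actU : U n →ₐ[ℂ] Module.End ℂ V :=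
  UniversalEnvelopingAlgebra.lift ℂ (LieModule.toEnd ℂ (Gl n) V)

/-- `V(𝔪) = {v | 𝔪^k v = 0 for some k}`, for a maximal ideal `𝔪` of `Γ`. -/
def gtWeightSpace (I : MaximalSpectrum (Gam n)) : Submodule ℂ V where
  carrier := {v | ∃ k : ℕ, ∀ g ∈ I.asIdeal ^ k, actU n V g.1 v = 0}
  add_mem' := by
    rintro v w ⟨k, hk⟩ ⟨l, hl⟩
    refine ⟨k + l, fun g hg => ?_⟩
    rw [map_add, hk g (Ideal.pow_le_pow_right (Nat.le_add_right k l) hg),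
      hl g (Ideal.pow_le_pow_right (Nat.le_add_left l k) hg), add_zero]
  zero_mem' := ⟨0, fun g _ => map_zero _⟩
  smul_mem' := by
    rintro c v ⟨k, hk⟩
    refine ⟨k, fun g hg => ?_⟩
    rw [map_smul, hk g hg, smul_zero]

open Classical in
/-- A Gelfand-Tsetlin module: a finitely generated `gl_n`-module that is the direct sum of the
`V(𝔪)`, where `𝔪` runs over the maximal ideals of `Γ`. -/
def IsGelfandTsetlinModule : Prop :=
  (∃ s : Finset V, LieSubmodule.lieSpan ℂ (Gl n) (s : Set V) = ⊤) ∧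
    DirectSum.IsInternal (gtWeightSpace n V)

/-- A tableaux module: a Gelfand-Tsetlin module with a basis of noncritical tableaux on which
`gl_n` acts by the Gelfand-Tsetlin formulas, all of whose Gelfand-Tsetlin multiplicities are `1`,
and on which the generators `c_{mk}`, `1 ≤ k ≤ m ≤ n`, of `Γ` act by
`c_{mk} T(L) = γ_{mk}(L) T(L)`. -/
def IsTableauxModule : Prop :=
  IsGelfandTsetlinModule n V ∧
  (∀ I : MaximalSpectrum (Gam n), gtWeightSpace n V I ≠ ⊥ →
    Module.finrank ℂ (gtWeightSpace n V I) = 1) ∧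
  ∃ (B : Set (Tableau n)) (b : Module.Basis B ℂ V),
    (∀ T ∈ B, T.Noncritical) ∧
    FollowsGTFormulas (LieModule.toEnd ℂ (Gl n) V) b ∧
    ∀ (T : B) (m k : ℕ), 1 ≤ k → k ≤ m → m ≤ n →
      actU n V (casimir n m k) (b T) = MvPolynomial.eval T.1 (gammaPoly n m k) • b T

end Modules

end GelfandTsetlin

end

/-! Let $B$ be the tableau basis of $V$, and let $C$ be the set of all relations of $\mathcal
R\cup\mathcal R^0$ that hold on all of $B$ (`commonRelations`). The proof shows that $B$ is the
whole set $\mathcal B_C(T(L))$ for any $T(L)\in B$, and that $C$ is admissible.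

The obstacle is that tableaux outside $B$ are read as $0$, so a nonzero coefficient in the
Gelfand–Tsetlin formulas does not by itself put the moved tableau in $B$. The commutator
$[E_{k,k+1},E_{k+1,k}]$ only gives one equation for the sum of the contributions of all
$T\pm\delta^{ki}$. To separate them, $E_{k,k+1}$ is replaced by the operators $\sum_j
(E^r)_{kj}E_{j,k+1}$ with $r\ge0$, where $E$ is the matrix of generators of $\mathfrak{gl}_k$. By
the quadratic Casimir element this multiplies the component that raises $l_{ki}$ by $(l_{ki}+k)^r$.
The diagonal parts of these commutators form a moment identity, tested against arbitrary polynomials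
(`rowRelation_of_tableaux`). Interpolation gives each contribution in closed form: if no obvious
factor vanishes, the contribution is nonzero, so the neighbour lies in $B$
(`TableauxBasis.raise_mem`, `lower_mem`). If $l_{kp}=l_{kq}+1$, two nodes collide and the identity
instead forces equal entries in the adjacent rows (`TableauxBasis.tangent`).

The right side of the moment identity needs the eigenvalues of $\sum E_{k+1,i}(E^r)_{ij}E_{j,k+1}$.
They are recovered from those of the Casimir elements by a recursion for the traces of powers of a
bordered matrix (`casimir_step`). The recursion is made explicit up to the fourth power, which is
where $n\le4$ enters.

Irreducibility says that a nonempty subset of $B$ closed under moves with nonzero coefficient is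
$B$. Crossing a wall $l_{k+1,j}=l_{ki}$ has coefficient $0$, so each inequality between adjacent
rows holds on all of $B$ or nowhere (`TableauxBasis.ge_all`). Any integral translate of $T$ with the
same top row that satisfies $C$ is then reached from $T$ by single steps inside $B$
(`TableauxSet.eq_basisSet`).

For admissibility an arbitrary realization of $C$ is considered, possibly unrelated to $B$. The
relations of $C$ control how two entries of a row can be adjacent (`TableauxSet.separated`,
`tangent_realization`). Hence a truncated move never matters: the coefficient of the move, or of a
following one, vanishes, so compositions of moves follow the untruncated formulas. The Serre
relations reduce to rational function identities, and $[E_{k,k+1},E_{k+1,k}]=E_{kk}-E_{k+1,k+1}$ to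
a sum of residues whose double poles are cancelled by double zeros (`sum_truncated_residues`). The
presentation of $\mathfrak{gl}_n$ by these relations (`SerreRelations.exists_lieHom`) gives the
module. -/

noncomputable section
namespace GelfandTsetlin

/-! ### A presentation of `gl_n` -/

section Presentation

set_option linter.unusedSectionVars false

variable {𝔏 : Type*} [LieRing 𝔏] [LieAlgebra ℂ 𝔏]

/-- The Chevalley–Serre relations of `gl_n` for elements `e k ↦ E_{k,k+1}`, `f k ↦ E_{k+1,k}`,
`h k ↦ E_{kk}` (indices start from `0`); the elements out of range are zero. -/
structure SerreRelations (n : ℕ) (e f h : ℕ → 𝔏) : Prop where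
  e_zero : ∀ k, n ≤ k + 1 → e k = 0
  f_zero : ∀ k, n ≤ k + 1 → f k = 0
  hh : ∀ i j, ⁅h i, h j⁆ = 0
  he : ∀ i k, ⁅h i, e k⁆ = ((if i = k then 1 else 0) - (if i = k + 1 then 1 else 0) : ℂ) • e k
  hf : ∀ i k, ⁅h i, f k⁆ = -((if i = k then 1 else 0) - (if i = k + 1 then 1 else 0) : ℂ) • f k
  ef : ∀ k, k + 1 < n → ⁅e k, f k⁆ = h k - h (k + 1)
  ef_ne : ∀ k l, k ≠ l → ⁅e k, f l⁆ = 0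
  ee : ∀ k l, k + 1 < l → ⁅e k, e l⁆ = 0
  ff : ∀ k l, k + 1 < l → ⁅f k, f l⁆ = 0
  eee : ∀ k, ⁅e k, ⁅e k, e (k + 1)⁆⁆ = 0
  eee' : ∀ k, ⁅e (k + 1), ⁅e (k + 1), e k⁆⁆ = 0
  fff : ∀ k, ⁅f k, ⁅f k, f (k + 1)⁆⁆ = 0
  fff' : ∀ k, ⁅f (k + 1), ⁅f (k + 1), f k⁆⁆ = 0

/-- The iterated bracket that represents `E_{i,i+d+1}`. -/
def rootVec (e : ℕ → 𝔏) (i : ℕ) : ℕ → 𝔏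
  | 0 => e i
  | d + 1 => ⁅rootVec e i d, e (i + d + 1)⁆

variable {n : ℕ} {e f h : ℕ → 𝔏}

/-- The Chevalley involution. It halves the work: facts about lower triangular elements follow from
those about upper triangular ones. -/
theorem SerreRelations.cartan (H : SerreRelations n e f h) :
    SerreRelations n (fun k => -f k) (fun k => -e k) (fun k => -h k) where
  e_zero k hk := by simp [H.f_zero k hk]
  f_zero k hk := by simp [H.e_zero k hk]
  hh i j := by simp [H.hh]
  he i k := by simp only [neg_lie, lie_neg, neg_neg, H.hf, neg_smul, smul_neg]
  hf i k := by simp only [neg_lie, lie_neg, neg_neg, H.he, neg_smul, smul_neg]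
  ef k hk := by
    rw [neg_lie, lie_neg, neg_neg, ← lie_skew, H.ef k hk]; abel
  ef_ne k l hkl := by
    rw [neg_lie, lie_neg, neg_neg, ← lie_skew, H.ef_ne l k hkl.symm, neg_zero]
  ee k l hkl := by simp [H.ff k l hkl]
  ff k l hkl := by simp [H.ee k l hkl]
  eee k := by simp [H.fff]
  eee' k := by simp [H.fff']
  fff k := by simp [H.eee]
  fff' k := by simp [H.eee']

theorem SerreRelations.ee_far (H : SerreRelations n e f h) {k l : ℕ} (h1 : k ≠ l)
    (h2 : k + 1 ≠ l) (h3 : l + 1 ≠ k) : ⁅e k, e l⁆ = 0 := by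
  rcases lt_or_gt_of_ne h1 with hlt | hlt
  · exact H.ee k l (by omega)
  · rw [← lie_skew, H.ee l k (by omega), neg_zero]

/-- Only a root adjacent to one of the two ends can be added to the root of `rootVec e i d`. The
vanishing at the last and the next to last index of the string comes from the Serre relations;
elsewhere the elements commute or induction applies. -/
theorem SerreRelations.e_rootVec (H : SerreRelations n e f h) (i d : ℕ) : ∀ k,
    ⁅e k, rootVec e i d⁆ = if k + 1 = i then rootVec e k (d + 1)
      else if k = i + d + 1 then -rootVec e i (d + 1) else 0 := by
  induction d using Nat.strong_induction_on with
  | _ d ih =>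
  intro k
  rcases d with _ | d
  · simp only [rootVec]
    split_ifs with h1 h2
    · subst h1; rfl
    · subst h2; exact (lie_skew _ _).symm
    · by_cases h3 : k = i
      · subst h3; exact lie_self _
      · exact H.ee_far h3 h1 (by omega)
  have ihd := ih d (by omega)
  set j := i + d + 1 with hj
  have hP : rootVec e i (d + 1) = ⁅rootVec e i d, e j⁆ := rfl
  rw [hP, leibniz_lie]
  by_cases h1 : k + 1 = i
  · rw [if_pos h1, ihd k, if_pos h1, H.ee_far (k := k) (l := j) (by omega) (by omega) (by omega),
      lie_zero, add_zero, hj, ← h1, show k + 1 + d + 1 = k + (d + 1) + 1 by omega]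
    rfl
  rw [if_neg h1]
  by_cases h2 : k = j + 1
  · rw [if_pos (by omega), ihd k, if_neg h1, if_neg (by omega), zero_lie, zero_add, h2]
    have h3 : ⁅e (j + 1), rootVec e i d⁆ = 0 := by
      rw [ihd, if_neg (by omega), if_neg (by omega)]
    have h4 : ⁅rootVec e i d, e (j + 1)⁆ = 0 := by rw [← lie_skew, h3, neg_zero]
    change _ = -⁅⁅rootVec e i d, e j⁆, e (j + 1)⁆
    rw [lie_lie, h4, lie_zero, sub_zero, ← lie_skew (e j), lie_neg, neg_neg]
  rw [if_neg (by omega)]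
  by_cases h3 : k = j
  · rw [h3, ihd j, if_neg (by omega), if_pos rfl, lie_self, lie_zero, add_zero, neg_lie, neg_eq_zero,
      hP]
    rcases d with _ | d
    · change ⁅⁅e i, e (i + 1)⁆, e (i + 1)⁆ = 0
      rw [← lie_skew (e i), neg_lie, lie_skew, H.eee']
    · have h4 : ⁅rootVec e i d, e j⁆ = 0 := by
        rw [← lie_skew, ih d (by omega), if_neg (by omega), if_neg (by omega), neg_zero]
      have h5 : ⁅rootVec e i (d + 1), e j⁆ = ⁅rootVec e i d, ⁅e (i + d + 1), e j⁆⁆ := by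
        change ⁅⁅rootVec e i d, e (i + d + 1)⁆, e j⁆ = _
        rw [lie_lie, h4, lie_zero, sub_zero]
      have h6 : ⁅⁅e (i + d + 1), e j⁆, e j⁆ = 0 := by
        have := H.eee' (i + d + 1)
        rw [show i + d + 1 + 1 = j by omega] at this
        rw [← lie_skew (e (i + d + 1)), neg_lie, lie_skew, this]
      rw [h5, lie_lie, h6, lie_zero, h4, lie_zero, sub_zero]
  by_cases h4 : k + 1 = j
  · rcases d with _ | d
    · obtain rfl : k = i := by omega
      change ⁅⁅e k, e k⁆, e j⁆ + ⁅e k, ⁅e k, e j⁆⁆ = 0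
      rw [lie_self, zero_lie, zero_add, ← h4, H.eee]
    · have hk : k = i + d + 1 := by omega
      have h5 : ⁅e k, rootVec e i (d + 1)⁆ = 0 := by
        rw [ihd, if_neg (by omega), if_neg (by omega)]
      have h6 : ⁅rootVec e i d, e j⁆ = 0 := by
        rw [← lie_skew, ih d (by omega), if_neg (by omega), if_neg (by omega), neg_zero]
      have h7 : rootVec e i (d + 1) = ⁅rootVec e i d, e k⁆ := by rw [hk]; rfl
      have h8 : ⁅e k, ⁅e k, e j⁆⁆ = 0 := by rw [← h4]; exact H.eee k
      rw [h5, zero_lie, zero_add]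
      set X := rootVec e i d
      set Y := ⁅e k, e j⁆ with hY
      have h9 : ⁅⁅X, e k⁆, Y⁆ = -⁅e k, ⁅X, Y⁆⁆ := by rw [lie_lie, h8, lie_zero, zero_sub]
      have h10 : ⁅X, Y⁆ = ⁅⁅X, e k⁆, e j⁆ := by rw [lie_lie, h6, lie_zero, sub_zero]
      have h11 : ⁅e k, ⁅⁅X, e k⁆, e j⁆⁆ = ⁅⁅X, e k⁆, Y⁆ := by
        rw [leibniz_lie, ← h7, h5, zero_lie, zero_add]
      -- Two applications of the Jacobi identity show the bracket to be its own negative, so it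
      -- vanishes in characteristic zero.
      have h12 : ⁅⁅X, e k⁆, Y⁆ = -⁅⁅X, e k⁆, Y⁆ := by
        conv_lhs => rw [h9, h10, h11]
      rw [h7]
      have h13 : (2 : ℂ) • ⁅⁅X, e k⁆, Y⁆ = 0 := by
        rw [two_smul]; exact add_eq_zero_iff_eq_neg.2 h12
      exact (smul_eq_zero.1 h13).resolve_left two_ne_zero
  · rw [ihd, if_neg h1, if_neg h3, H.ee_far h3 h4 (by omega), zero_lie, lie_zero, zero_add]

theorem SerreRelations.h_rootVec (H : SerreRelations n e f h) (i d k : ℕ) :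
    ⁅h k, rootVec e i d⁆ =
      ((if k = i then 1 else 0) - (if k = i + d + 1 then 1 else 0) : ℂ) • rootVec e i d := by
  induction d with
  | zero => exact H.he k i
  | succ d ih =>
    change ⁅h k, ⁅rootVec e i d, e (i + d + 1)⁆⁆ = _ • ⁅rootVec e i d, e (i + d + 1)⁆
    rw [leibniz_lie, ih, H.he, smul_lie, lie_smul, ← add_smul]
    congr 1
    rw [← add_assoc i d 1]
    ring

theorem SerreRelations.f_rootVec (H : SerreRelations n e f h) (i d k : ℕ) (hn : i + d + 1 < n) :
    ⁅f k, rootVec e i d⁆ = match d with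
      | 0 => if k = i then h (i + 1) - h i else 0
      | d + 1 => if k = i then rootVec e (i + 1) d
          else if k = i + d + 1 then -rootVec e i d else 0 := by
  induction d with
  | zero =>
    change ⁅f k, e i⁆ = if k = i then _ else _
    split_ifs with h1
    · rw [h1, ← lie_skew, H.ef i hn]; abel
    · rw [← lie_skew, H.ef_ne i k (Ne.symm h1), neg_zero]
  | succ d ih =>
    have ih := ih (by omega)
    change ⁅f k, ⁅rootVec e i d, e (i + d + 1)⁆⁆ = if k = i then rootVec e (i + 1) d
          else if k = i + d + 1 then -rootVec e i d else 0
    rw [leibniz_lie, ih]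
    by_cases h2 : k = i + d + 1
    · have h3 : k ≠ i := by omega
      have h4 : ⁅f k, e (i + d + 1)⁆ = h (k + 1) - h k := by
        rw [← h2, ← lie_skew, H.ef k (by omega)]; abel
      have h5 : ⁅rootVec e i d, h (k + 1) - h k⁆ = -rootVec e i d := by
        rw [← lie_skew, sub_lie, H.h_rootVec, H.h_rootVec, if_neg (by omega), if_neg (by omega),
          if_neg h3, if_pos h2]
        simp
      rw [if_neg h3, if_pos h2, h4, h5]
      rcases d with _ | d
      · simp [h3]
      · simp [h3, show k ≠ i + d + 1 by omega]
    · have h4 : ⁅f k, e (i + d + 1)⁆ = 0 := by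
        rw [← lie_skew, H.ef_ne _ k (Ne.symm h2), neg_zero]
      rw [h4, lie_zero, add_zero, if_neg h2]
      rcases d with _ | d
      · by_cases h3 : k = i
        · simp only [h3, if_true]
          rw [sub_lie, H.he, H.he]
          simp only [rootVec, if_true, show i + 1 ≠ i + 1 + 1 by omega, show i ≠ i + 1 by omega,
            show i ≠ i + 1 + 1 by omega, if_false, add_zero]
          simp
        · simp [h3]
      · by_cases h3 : k = i
        · simp only [h3, if_true]
          rw [show i + (d + 1) + 1 = i + 1 + d + 1 by omega]
          rfl
        · simp only [h3, if_false]
          split_ifs with h5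
          · rw [neg_lie, ← lie_skew, neg_neg, H.e_rootVec, if_neg (by omega), if_neg (by omega)]
          · exact zero_lie _

/-- The element that represents the matrix unit `E_{ij}`. -/
def matUnit (e f h : ℕ → 𝔏) (i j : ℕ) : 𝔏 :=
  if i < j then rootVec e i (j - i - 1)
  else if j < i then -rootVec (fun k => -f k) j (i - j - 1) else h i

theorem matUnit_lt (i d : ℕ) : matUnit e f h i (i + d + 1) = rootVec e i d := by
  rw [matUnit, if_pos (by omega), show i + d + 1 - i - 1 = d by omega]

theorem matUnit_gt (i d : ℕ) :
    matUnit e f h (i + d + 1) i = -rootVec (fun k => -f k) i d := by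
  rw [matUnit, if_neg (by omega), if_pos (by omega), show i + d + 1 - i - 1 = d by omega]

theorem matUnit_self (i : ℕ) : matUnit e f h i i = h i := by
  simp [matUnit]

theorem matUnit_cartan (i j : ℕ) :
    matUnit (fun k => -f k) (fun k => -e k) (fun k => -h k) i j = -matUnit e f h j i := by
  rcases lt_trichotomy i j with hij | rfl | hij
  · obtain ⟨d, rfl⟩ := Nat.exists_eq_add_of_lt hij
    rw [matUnit_lt, matUnit_gt, neg_neg]
  · rw [matUnit_self, matUnit_self]
  · obtain ⟨d, rfl⟩ := Nat.exists_eq_add_of_lt hij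
    rw [matUnit_lt, matUnit_gt]
    simp

theorem SerreRelations.e_matUnit (H : SerreRelations n e f h) {i j k : ℕ} (hi : i < n) (hj : j < n)
    (hk : k + 1 < n) :
    ⁅e k, matUnit e f h i j⁆ = (if k + 1 = i then matUnit e f h k j else 0) -
      (if j = k then matUnit e f h i (k + 1) else 0) := by
  rcases lt_trichotomy i j with hij | rfl | hij
  · obtain ⟨d, rfl⟩ := Nat.exists_eq_add_of_lt hij
    rw [matUnit_lt, H.e_rootVec]
    by_cases h1 : k + 1 = i
    · rw [if_pos h1, if_pos h1, if_neg (by omega), sub_zero, ← matUnit_lt (f := f) (h := h) k (d + 1),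
        ← h1]
      congr 1; omega
    · rw [if_neg h1, if_neg h1]
      by_cases h2 : k = i + d + 1
      · rw [if_pos h2, if_pos h2.symm, zero_sub, h2, show i + d + 1 + 1 = i + (d + 1) + 1 by omega,
          matUnit_lt]
      · rw [if_neg h2, if_neg (Ne.symm h2), sub_zero]
  · rw [matUnit_self, ← lie_skew, H.he]
    by_cases h1 : i = k
    · subst h1
      have := matUnit_lt (e := e) (f := f) (h := h) i 0
      simp only [add_zero, rootVec] at this
      simp [this]
    · by_cases h2 : i = k + 1
      · subst h2
        have := matUnit_lt (e := e) (f := f) (h := h) k 0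
        simp only [add_zero, rootVec] at this
        simp [this]
      · simp [h1, h2, Ne.symm h2]
  · obtain ⟨d, rfl⟩ := Nat.exists_eq_add_of_lt hij
    -- The lower triangular case is the action of the opposite generator on a root vector, seen
    -- through the Chevalley involution.
    have key := H.cartan.f_rootVec j d k (by omega)
    rw [matUnit_gt, lie_neg, ← neg_lie, key]
    rcases d with _ | d
    · simp only [add_zero]
      by_cases h1 : k = j
      · subst h1
        simp [matUnit_self]; abel
      · simp [h1, Ne.symm h1]
    · simp only
      by_cases h1 : k = j
      · subst h1
        rw [if_pos rfl, if_neg (by omega), if_pos rfl, zero_sub,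
          show k + (d + 1) + 1 = k + 1 + d + 1 by omega, matUnit_gt, neg_neg]
      · rw [if_neg h1, if_neg (Ne.symm h1), sub_zero]
        by_cases h2 : k = j + d + 1
        · rw [if_pos h2, if_pos (by omega), h2, matUnit_gt]
        · rw [if_neg h2, if_neg (by omega)]

theorem SerreRelations.f_matUnit (H : SerreRelations n e f h) {i j k : ℕ} (hi : i < n) (hj : j < n)
    (hk : k + 1 < n) :
    ⁅f k, matUnit e f h i j⁆ = (if k = i then matUnit e f h (k + 1) j else 0) -
      (if j = k + 1 then matUnit e f h i k else 0) := by
  have key := H.cartan.e_matUnit hj hi hk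
  rw [matUnit_cartan, neg_lie, lie_neg, neg_neg, matUnit_cartan, matUnit_cartan] at key
  rw [key]
  simp only [eq_comm (a := k) (b := i), eq_comm (a := j) (b := k + 1)]
  split_ifs <;> abel

theorem SerreRelations.h_matUnit (H : SerreRelations n e f h) (i j k : ℕ) :
    ⁅h k, matUnit e f h i j⁆ = (if k = i then matUnit e f h k j else 0) -
      (if j = k then matUnit e f h i k else 0) := by
  have aux : ∀ x : 𝔏, ((if k = i then 1 else 0) - (if k = j then 1 else 0) : ℂ) • x =
      (if k = i then x else 0) - (if j = k then x else 0) := by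
    intro x
    simp only [eq_comm (a := j) (b := k)]
    split_ifs <;> simp
  have key : ⁅h k, matUnit e f h i j⁆ =
      ((if k = i then 1 else 0) - (if k = j then 1 else 0) : ℂ) • matUnit e f h i j := by
    rcases lt_trichotomy i j with hij | rfl | hij
    · obtain ⟨d, rfl⟩ := Nat.exists_eq_add_of_lt hij
      rw [matUnit_lt, H.h_rootVec]
    · rw [matUnit_self, H.hh, sub_self, zero_smul]
    · obtain ⟨d, rfl⟩ := Nat.exists_eq_add_of_lt hij
      have := H.cartan.h_rootVec j d k
      rw [matUnit_gt, lie_neg, ← neg_lie, this, ← neg_sub, neg_smul, smul_neg]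
  rw [key, aux]
  split_ifs with h1 h2 h2
  · rw [h2, h1]
  · rw [h1]
  · rw [h2]
  · rfl

theorem E_lie_E {n : ℕ} (i j k l : Fin n) :
    ⁅(E i j : Gl n), E k l⁆ = (if j = k then E i l else 0) - (if l = i then E k j else 0) := by
  rw [LieRing.of_associative_ring_bracket]
  simp only [E]
  by_cases h1 : j = k
  · by_cases h2 : l = i
    · subst h1 h2; simp
    · subst h1; simp [h2]
  · by_cases h2 : l = i
    · subst h2; simp [h1]
    · simp [h1, h2]

/-- The generators `E_{k,k+1}`, `E_{k+1,k}` and `E_{kk}` generate the Lie algebra `gl_n`. -/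
theorem generators_induction {n : ℕ} (S : LieSubalgebra ℂ (Gl n))
    (he : ∀ (k : ℕ) (hk : k + 1 < n), E ⟨k, Nat.lt_of_succ_lt hk⟩ ⟨k + 1, hk⟩ ∈ S)
    (hf : ∀ (k : ℕ) (hk : k + 1 < n), E ⟨k + 1, hk⟩ ⟨k, Nat.lt_of_succ_lt hk⟩ ∈ S)
    (hh : ∀ i : Fin n, E i i ∈ S) : S = ⊤ := by
  have hup : ∀ (d i : ℕ) (hi : i + d + 1 < n),
      E ⟨i, by omega⟩ ⟨i + d + 1, hi⟩ ∈ S ∧ E ⟨i + d + 1, hi⟩ ⟨i, by omega⟩ ∈ S := by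
    intro d
    induction d with
    | zero => exact fun i hi => ⟨he i hi, hf i hi⟩
    | succ d ih =>
      intro i hi
      obtain ⟨h1, h2⟩ := ih i (by omega)
      have h3 := S.lie_mem h1 (he (i + d + 1) hi)
      have h4 := S.lie_mem (hf (i + d + 1) hi) h2
      rw [E_lie_E, if_pos rfl, if_neg (by simp; omega), sub_zero] at h3
      rw [E_lie_E, if_pos rfl, if_neg (by simp; omega), sub_zero] at h4
      exact ⟨h3, h4⟩
  have hall : ∀ i j : Fin n, E i j ∈ S := by
    rintro ⟨i, hi⟩ ⟨j, hj⟩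
    rcases lt_trichotomy i j with hij | rfl | hij
    · obtain ⟨d, rfl⟩ := Nat.exists_eq_add_of_lt hij
      exact (hup d i hj).1
    · exact hh _
    · obtain ⟨d, rfl⟩ := Nat.exists_eq_add_of_lt hij
      exact (hup d j hi).2
  refine eq_top_iff.2 fun x _ => ?_
  rw [Matrix.matrix_eq_sum_single x]
  refine S.toSubmodule.sum_mem fun i _ => S.toSubmodule.sum_mem fun j _ => ?_
  have : Matrix.single i j (x i j) = x i j • (E i j : Gl n) := by simp [E]
  rw [this]
  exact S.smul_mem _ (hall i j)

/-- Send the matrix units linearly to `matUnit`. By the Jacobi identity, the elements whose bracket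
with everything is respected form a Lie subalgebra, so only brackets of a generator with a matrix
unit have to be compared. -/
theorem SerreRelations.exists_lieHom (H : SerreRelations n e f h) :
    ∃ ρ : Gl n →ₗ⁅ℂ⁆ 𝔏,
      (∀ (k : ℕ) (hk : k + 1 < n), ρ (E ⟨k, Nat.lt_of_succ_lt hk⟩ ⟨k + 1, hk⟩) = e k) ∧
      (∀ (k : ℕ) (hk : k + 1 < n), ρ (E ⟨k + 1, hk⟩ ⟨k, Nat.lt_of_succ_lt hk⟩) = f k) ∧
      ∀ i : Fin n, ρ (E i i) = h i := by
  let ρ₀ : Gl n →ₗ[ℂ] 𝔏 :=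
    { toFun := fun x => ∑ i, ∑ j, x i j • matUnit e f h i j
      map_add' := fun x y => by simp [add_smul, Finset.sum_add_distrib]
      map_smul' := fun c x => by simp [mul_smul, Finset.smul_sum] }
  have hρ : ∀ i j : Fin n, ρ₀ (E i j) = matUnit e f h i j := by
    intro i j
    change ∑ i', ∑ j', (E i j : Gl n) i' j' • matUnit e f h i' j' = _
    rw [Finset.sum_eq_single i, Finset.sum_eq_single j]
    · simp [E]
    · intro b _ hb; simp [E, Ne.symm hb]
    · simp
    · intro b _ hb; simp [E, Ne.symm hb]
    · simp
  let S : LieSubalgebra ℂ (Gl n) :=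
    { carrier := {x | ∀ y, ρ₀ ⁅x, y⁆ = ⁅ρ₀ x, ρ₀ y⁆}
      add_mem' := fun {a b} ha hb y => by rw [add_lie, map_add, ha, hb, map_add, add_lie]
      zero_mem' := fun y => by simp
      smul_mem' := fun c x hx y => by rw [smul_lie, map_smul, hx, map_smul, smul_lie]
      lie_mem' := fun {a b} ha hb y => by
        rw [lie_lie, map_sub, ha, hb, hb, ha, ha b, lie_lie] }
  have hmem : ∀ x : Gl n, (∀ i j : Fin n, ρ₀ ⁅x, E i j⁆ = ⁅ρ₀ x, ρ₀ (E i j)⁆) → x ∈ S := by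
    intro x hx y
    rw [Matrix.matrix_eq_sum_single y]
    simp only [lie_sum, map_sum]
    refine Finset.sum_congr rfl fun i _ => Finset.sum_congr rfl fun j _ => ?_
    have : Matrix.single i j (y i j) = y i j • (E i j : Gl n) := by simp [E]
    rw [this, lie_smul, map_smul, hx, map_smul, lie_smul]
  have he : ∀ (k : ℕ) (hk : k + 1 < n),
      ρ₀ (E ⟨k, Nat.lt_of_succ_lt hk⟩ ⟨k + 1, hk⟩) = e k := by
    intro k hk
    rw [hρ]
    exact matUnit_lt k 0
  have hf : ∀ (k : ℕ) (hk : k + 1 < n),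
      ρ₀ (E ⟨k + 1, hk⟩ ⟨k, Nat.lt_of_succ_lt hk⟩) = f k := by
    intro k hk
    rw [hρ]
    exact (matUnit_gt k 0).trans (neg_neg _)
  have hh : ∀ i : Fin n, ρ₀ (E i i) = h i := by
    intro i
    rw [hρ]
    exact matUnit_self _
  have hS : S = ⊤ := by
    refine generators_induction S (fun k hk => hmem _ fun i j => ?_)
      (fun k hk => hmem _ fun i j => ?_) (fun k => hmem _ fun i j => ?_)
    · rw [he, hρ, H.e_matUnit i.2 j.2 hk, E_lie_E, map_sub]
      simp only [apply_ite ρ₀, hρ, map_zero, Fin.ext_iff]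
    · rw [hf, hρ, H.f_matUnit i.2 j.2 hk, E_lie_E, map_sub]
      simp only [apply_ite ρ₀, hρ, map_zero, Fin.ext_iff]
    · rw [hh, hρ, H.h_matUnit, E_lie_E, map_sub]
      simp only [apply_ite ρ₀, hρ, map_zero, Fin.ext_iff]
  refine ⟨{ ρ₀ with map_lie' := fun {x y} => ?_ }, he, hf, hh⟩
  have hx : x ∈ S := hS ▸ LieSubalgebra.mem_top x
  exact hx y

end Presentation

end GelfandTsetlin
end

noncomputable section
namespace GelfandTsetlin

/-! ### Partial fractions -/

section PartialFractions

open Polynomial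

set_option linter.unusedSectionVars false

variable {ι : Type*}

/-- Sum of the residues of `∏ (X - y) / ∏ (X - r)`. -/
theorem sum_residues_eq_coeff (S : Finset ℂ) (N : ℂ[X]) (hN : N.degree < S.card) :
    ∑ r ∈ S, N.eval r / ∏ r' ∈ S.erase r, (r - r') = N.coeff (S.card - 1) :=
  (Lagrange.coeff_eq_sum (s := S) (v := id) (Set.injOn_id _) hN).symm

theorem eval_prod_X_sub_C (t : Finset ι) (y : ι → ℂ) (u : ℂ) :
    (∏ j ∈ t, (X - C (y j))).eval u = ∏ j ∈ t, (u - y j) := by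
  simp [eval_prod]

theorem degree_prod_X_sub_C' (t : Finset ι) (y : ι → ℂ) :
    (∏ j ∈ t, (X - C (y j))).degree = ((t.card : ℕ) : WithBot ℕ) := by
  rw [degree_prod]; simp

theorem sum_residues_zero (S : Finset ℂ) (t : Finset ι) (y : ι → ℂ) (h : t.card + 1 < S.card) :
    ∑ r ∈ S, (∏ j ∈ t, (r - y j)) / ∏ r' ∈ S.erase r, (r - r') = 0 := by
  have hdeg := degree_prod_X_sub_C' t y
  have := sum_residues_eq_coeff S (∏ j ∈ t, (X - C (y j)))
    (by rw [hdeg]; exact_mod_cast (by omega : t.card < S.card))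
  simp only [eval_prod_X_sub_C] at this
  rw [this]
  exact coeff_eq_zero_of_degree_lt (by rw [hdeg]; exact_mod_cast (by omega))

theorem sum_residues_one (S : Finset ℂ) (t : Finset ι) (y : ι → ℂ) (h : t.card + 1 = S.card) :
    ∑ r ∈ S, (∏ j ∈ t, (r - y j)) / ∏ r' ∈ S.erase r, (r - r') = 1 := by
  have hdeg := degree_prod_X_sub_C' t y
  have hm : (∏ j ∈ t, (X - C (y j))).Monic := monic_prod_of_monic _ _ fun q _ => monic_X_sub_C _
  have := sum_residues_eq_coeff S (∏ j ∈ t, (X - C (y j)))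
    (by rw [hdeg]; exact_mod_cast (by omega : t.card < S.card))
  simp only [eval_prod_X_sub_C] at this
  rw [this, show S.card - 1 = (∏ j ∈ t, (X - C (y j))).natDegree by
    rw [natDegree_eq_of_degree_eq_some hdeg]; omega]
  exact hm

/-- Subtracting $\prod_{r\in S}(X-r)$ from the numerator does not change its values on `S` and
brings its degree below `S.card`; the new top coefficient is the difference of the two sums of
roots. -/
theorem sum_residues_sub (S : Finset ℂ) (t : Finset ι) (y : ι → ℂ) (h : t.card = S.card) :
    ∑ r ∈ S, (∏ j ∈ t, (r - y j)) / ∏ r' ∈ S.erase r, (r - r') = ∑ r ∈ S, r - ∑ j ∈ t, y j := by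
  rcases Nat.eq_zero_or_pos S.card with h0 | h0
  · obtain rfl := Finset.card_eq_zero.1 h0
    obtain rfl := Finset.card_eq_zero.1 (h.trans h0)
    simp
  have hdeg := degree_prod_X_sub_C' t y
  have hdegS := degree_prod_X_sub_C' S (fun r => r)
  have hm : (∏ j ∈ t, (X - C (y j))).Monic := monic_prod_of_monic _ _ fun q _ => monic_X_sub_C _
  have hmS : (∏ r ∈ S, (X - C r)).Monic := monic_prod_of_monic _ _ fun q _ => monic_X_sub_C _
  have hlt : (∏ j ∈ t, (X - C (y j)) - ∏ r ∈ S, (X - C r)).degree <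
      ((S.card : ℕ) : WithBot ℕ) := by
    rw [← h, ← hdeg]
    exact degree_sub_lt_left (by rw [hdeg, hdegS, h]) hm.ne_zero (by rw [hm, hmS])
  have := sum_residues_eq_coeff S _ hlt
  rw [coeff_sub] at this
  nth_rw 1 [← h] at this
  rw [prod_X_sub_C_coeff_card_pred t y (by omega), prod_X_sub_C_coeff_card_pred S (fun r => r) h0,
    neg_sub_neg] at this
  rw [← this]
  refine Finset.sum_congr rfl fun r hr => ?_
  rw [eval_sub, eval_prod_X_sub_C, eval_prod_X_sub_C S (fun r => r),
    Finset.prod_eq_zero hr (sub_self r), sub_zero]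

variable [DecidableEq ι]

theorem sum_image_residues (s : Finset ι) (l : ι → ℂ) (hl : Set.InjOn l s) (g : ℂ → ℂ) :
    ∑ r ∈ s.image l, g r / ∏ r' ∈ (s.image l).erase r, (r - r') =
      ∑ i ∈ s, g (l i) / ∏ j ∈ s.erase i, (l i - l j) := by
  rw [Finset.sum_image hl]
  refine Finset.sum_congr rfl fun i hi => ?_
  have : (s.image l).erase (l i) = (s.erase i).image l := by
    ext r
    simp only [Finset.mem_erase, Finset.mem_image]
    constructor
    · rintro ⟨h1, j, hj, rfl⟩
      exact ⟨j, ⟨fun h => h1 (by rw [h]), hj⟩, rfl⟩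
    · rintro ⟨j, ⟨h1, hj⟩, rfl⟩
      exact ⟨fun h => h1 (hl hj hi h), j, hj, rfl⟩
  rw [this, Finset.prod_image (hl.mono (by simp))]

/-- With an additional simple pole at `u`, a sum of residues becomes a partial fraction expansion
evaluated at `u`. -/
theorem sum_insert_residues (s : Finset ι) (l : ι → ℂ) (hl : Set.InjOn l s) (u : ℂ)
    (hu : ∀ i ∈ s, u ≠ l i) (g : ℂ → ℂ) :
    ∑ r ∈ insert u (s.image l), g r / ∏ r' ∈ (insert u (s.image l)).erase r, (r - r') =
      g u / ∏ i ∈ s, (u - l i) -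
        ∑ i ∈ s, g (l i) / (∏ j ∈ s.erase i, (l i - l j)) / (u - l i) := by
  have hu' : u ∉ s.image l := by
    rw [Finset.mem_image]; rintro ⟨i, hi, h⟩; exact hu i hi h.symm
  rw [Finset.sum_insert hu', Finset.erase_insert hu', Finset.prod_image hl, sub_eq_add_neg,
    ← Finset.sum_neg_distrib]
  congr 1
  have h2 := sum_image_residues s l hl (fun r => -(g r / (u - r)))
  rw [show (∑ i ∈ s, -(g (l i) / (∏ j ∈ s.erase i, (l i - l j)) / (u - l i))) =
    ∑ i ∈ s, -(g (l i) / (u - l i)) / ∏ j ∈ s.erase i, (l i - l j) from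
    Finset.sum_congr rfl fun i _ => by ring, ← h2]
  refine Finset.sum_congr rfl fun r hr => ?_
  have hur : u ≠ r := fun h => hu' (h ▸ hr)
  rw [Finset.erase_insert_of_ne hur, Finset.prod_insert (fun h => hu' (Finset.mem_of_mem_erase h)),
    mul_comm, ← div_div, div_right_comm, ← neg_sub u r, div_neg]

/-- Partial fractions of `∏_{t} (u - y) / ∏_{s} (u - l)` with fewer zeros than poles. -/
theorem partialFractions_lt (s t : Finset ι) (l y : ι → ℂ) (hl : Set.InjOn l s)
    (h : t.card < s.card) (u : ℂ) (hu : ∀ i ∈ s, u ≠ l i) :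
    ∑ i ∈ s, (∏ j ∈ t, (l i - y j)) / (∏ j ∈ s.erase i, (l i - l j)) / (u - l i) =
      (∏ j ∈ t, (u - y j)) / ∏ i ∈ s, (u - l i) := by
  have hu' : u ∉ s.image l := by
    rw [Finset.mem_image]; rintro ⟨i, hi, h⟩; exact hu i hi h.symm
  have h1 := sum_residues_zero (insert u (s.image l)) t y (by
    rw [Finset.card_insert_of_notMem hu', Finset.card_image_of_injOn hl]; omega)
  rw [sum_insert_residues s l hl u hu (fun r => ∏ j ∈ t, (r - y j))] at h1
  exact (sub_eq_zero.1 h1).symm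

/-- Partial fractions of `∏_{t} (u - y) / ∏_{s} (u - l)` with one more zero than poles. -/
theorem partialFractions_succ (s t : Finset ι) (l y : ι → ℂ) (hl : Set.InjOn l s)
    (h : t.card = s.card + 1) (u : ℂ) (hu : ∀ i ∈ s, u ≠ l i) :
    u + ∑ i ∈ s, l i - ∑ j ∈ t, y j +
      ∑ i ∈ s, (∏ j ∈ t, (l i - y j)) / (∏ j ∈ s.erase i, (l i - l j)) / (u - l i) =
      (∏ j ∈ t, (u - y j)) / ∏ i ∈ s, (u - l i) := by
  have hu' : u ∉ s.image l := by
    rw [Finset.mem_image]; rintro ⟨i, hi, h⟩; exact hu i hi h.symm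
  have h1 := sum_residues_sub (insert u (s.image l)) t y (by
    rw [Finset.card_insert_of_notMem hu', Finset.card_image_of_injOn hl]; omega)
  rw [sum_insert_residues s l hl u hu (fun r => ∏ j ∈ t, (r - y j)), Finset.sum_insert hu',
    Finset.sum_image hl] at h1
  rw [← h1]; ring

/-! ### Divided differences of polynomials and the extraction of coefficients -/

open Classical in
/-- The divided difference of a polynomial. -/
def divDiff (P : ℂ[X]) (a b : ℂ) : ℂ :=
  if a = b then P.derivative.eval a else (P.eval a - P.eval b) / (a - b)

theorem divDiff_add (P Q : ℂ[X]) (a b : ℂ) : divDiff (P + Q) a b = divDiff P a b + divDiff Q a b := by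
  unfold divDiff
  split_ifs
  · simp
  · simp only [eval_add]; ring

theorem divDiff_C_mul (c : ℂ) (P : ℂ[X]) (a b : ℂ) : divDiff (C c * P) a b = c * divDiff P a b := by
  unfold divDiff
  split_ifs
  · simp
  · simp only [eval_mul, eval_C]; ring

theorem divDiff_X_pow (r : ℕ) (a b : ℂ) :
    divDiff (X ^ r) a b = ∑ i ∈ Finset.range r, a ^ i * b ^ (r - 1 - i) := by
  unfold divDiff
  split_ifs with h
  · subst h
    rw [derivative_X_pow, Finset.sum_congr rfl (g := fun _ => a ^ (r - 1)) fun i hi => by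
      rw [← pow_add]; congr 1; have := Finset.mem_range.1 hi; omega]
    simp
  · have := (Commute.all a b).geom_sum₂_mul r
    rw [eval_pow, eval_pow, eval_X, eval_X, ← this, mul_div_cancel_right₀ _ (sub_ne_zero.2 h)]

theorem divDiff_eq_zero_of_ne {P : ℂ[X]} {a b : ℂ} (h : a ≠ b) (ha : P.eval a = 0)
    (hb : P.eval b = 0) : divDiff P a b = 0 := by
  simp [divDiff, h, ha, hb]

theorem divDiff_mul_eq_zero {P Q : ℂ[X]} {a b : ℂ} (ha : P.eval a = 0)
    (hb : Q.eval b = 0) : divDiff (P * Q) a b = 0 := by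
  unfold divDiff
  split_ifs with h
  · subst h; simp [ha, hb]
  · simp [ha, hb]

/-- The relation between the coefficients that comes from the commutator of `E_{k,k+1}` and
`E_{k+1,k}`, with `β` and `μ` the points where `E_{k+1,k}` and `E_{k,k+1}` have their poles. -/
def MomentRelation (s : Finset ι) (β μ t' t ρ x : ι → ℂ) (e : ℂ) (P : ℂ[X]) : Prop :=
  ∑ j ∈ s, t' j * P.eval (β j) - ∑ i ∈ s, t i * P.eval (μ i) =
    ∑ j ∈ s, ρ j * (P.eval (β j) * (β j - e)) -
      ∑ j ∈ s, ∑ i ∈ s, ρ j * x i * divDiff P (β j) (μ i)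

variable {s : Finset ι} {β μ t' t ρ x : ι → ℂ} {e : ℂ}

/-- Both sides are linear in `P`. The powers come from the powers of the matrix of generators;
general polynomials are needed as test functions. -/
theorem momentRelation_of_pow (h : ∀ r : ℕ, MomentRelation s β μ t' t ρ x e (X ^ r)) (P : ℂ[X]) :
    MomentRelation s β μ t' t ρ x e P := by
  unfold MomentRelation at h ⊢
  induction P using Polynomial.induction_on' with
  | add P Q hP hQ =>
    simp only [eval_add, divDiff_add, mul_add, add_mul, Finset.sum_add_distrib] at hP hQ ⊢
    linear_combination hP + hQ
  | monomial r c =>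
    have hr := congrArg (fun z => c * z) (h r)
    simp only [← C_mul_X_pow_eq_monomial, divDiff_C_mul, eval_mul, eval_C]
    simp only [mul_sub, Finset.mul_sum] at hr ⊢
    convert hr using 2 <;> refine Finset.sum_congr rfl fun i _ => ?_
    · ring
    · ring
    · ring
    · refine Finset.sum_congr rfl fun j _ => ?_
      ring

/-- Test with the polynomial whose roots are all nodes except `μ i`. This is possible since `μ i` is
not one of the `β j`. -/
theorem MomentRelation.raise_eq (hμ : Set.InjOn μ s)
    (H : ∀ P, MomentRelation s β μ t' t ρ x e P) {i : ι} (hi : i ∈ s) (hne : ∀ j ∈ s, μ i ≠ β j) :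
    t i = x i * ∑ j ∈ s, ρ j / (μ i - β j) := by
  set A : ℂ[X] := ∏ j ∈ s, (X - C (β j)) with hA
  set D : ℂ[X] := ∏ j ∈ s.erase i, (X - C (μ j)) with hD
  have hAβ : ∀ j ∈ s, A.eval (β j) = 0 := fun j hj => by
    rw [hA, eval_prod_X_sub_C]; exact Finset.prod_eq_zero hj (sub_self _)
  have hDμ : ∀ j ∈ s, j ≠ i → D.eval (μ j) = 0 := fun j hj hji => by
    rw [hD, eval_prod_X_sub_C]
    exact Finset.prod_eq_zero (Finset.mem_erase.2 ⟨hji, hj⟩) (sub_self _)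
  have hA0 : A.eval (μ i) ≠ 0 := by
    rw [hA, eval_prod_X_sub_C]
    exact Finset.prod_ne_zero_iff.2 fun j hj => sub_ne_zero.2 (hne j hj)
  have hD0 : D.eval (μ i) ≠ 0 := by
    rw [hD, eval_prod_X_sub_C]
    refine Finset.prod_ne_zero_iff.2 fun j hj => sub_ne_zero.2 fun h => ?_
    exact Finset.ne_of_mem_erase hj (hμ (Finset.mem_of_mem_erase hj) hi h.symm)
  have h := H (A * D)
  unfold MomentRelation at h
  rw [Finset.sum_eq_zero (fun j hj => by rw [eval_mul, hAβ j hj]; ring), Finset.sum_eq_single i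
    (fun j hj hji => by rw [eval_mul, hDμ j hj hji]; ring) (fun h => absurd hi h),
    Finset.sum_eq_zero (fun j hj => by rw [eval_mul, hAβ j hj]; ring)] at h
  have h2 : ∀ j ∈ s, ∑ i' ∈ s, ρ j * x i' * divDiff (A * D) (β j) (μ i') =
      (A * D).eval (μ i) * (x i * (ρ j / (μ i - β j))) := by
    intro j hj
    rw [Finset.sum_eq_single i (fun i' hi' hne' => by
      rw [divDiff_mul_eq_zero (hAβ j hj) (hDμ i' hi' hne'), mul_zero]) (fun h => absurd hi h)]
    rw [divDiff, if_neg (fun h => hne j hj h.symm), eval_mul, hAβ j hj, ← neg_sub (μ i) (β j),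
      div_neg]
    ring
  rw [Finset.sum_congr rfl h2, ← Finset.mul_sum, ← Finset.mul_sum, zero_sub, zero_sub, neg_inj,
    mul_comm] at h
  exact mul_left_cancel₀ (by rw [eval_mul]; exact mul_ne_zero hA0 hD0) h

theorem MomentRelation.lower_eq (hβ : Set.InjOn β s)
    (H : ∀ P, MomentRelation s β μ t' t ρ x e P) {j : ι} (hj : j ∈ s) (hne : ∀ i ∈ s, β j ≠ μ i) :
    t' j = ρ j * (β j - e - ∑ i ∈ s, x i / (β j - μ i)) := by
  set A : ℂ[X] := ∏ j' ∈ s.erase j, (X - C (β j')) with hA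
  set D : ℂ[X] := ∏ i ∈ s, (X - C (μ i)) with hD
  have hAβ : ∀ j' ∈ s, j' ≠ j → A.eval (β j') = 0 := fun j' hj' hjj => by
    rw [hA, eval_prod_X_sub_C]
    exact Finset.prod_eq_zero (Finset.mem_erase.2 ⟨hjj, hj'⟩) (sub_self _)
  have hDμ : ∀ i ∈ s, D.eval (μ i) = 0 := fun j hj => by
    rw [hD, eval_prod_X_sub_C]
    exact Finset.prod_eq_zero hj (sub_self _)
  have hD0 : D.eval (β j) ≠ 0 := by
    rw [hD, eval_prod_X_sub_C]
    exact Finset.prod_ne_zero_iff.2 fun i hi => sub_ne_zero.2 (hne i hi)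
  have hA0 : A.eval (β j) ≠ 0 := by
    rw [hA, eval_prod_X_sub_C]
    refine Finset.prod_ne_zero_iff.2 fun i hi => sub_ne_zero.2 fun h => ?_
    exact Finset.ne_of_mem_erase hi (hβ (Finset.mem_of_mem_erase hi) hj h.symm)
  have h := H (A * D)
  unfold MomentRelation at h
  rw [Finset.sum_eq_single j
    (fun i hi hij => by rw [eval_mul, hAβ i hi hij]; ring) (fun h => absurd hj h),
    Finset.sum_eq_zero (fun i hi => by rw [eval_mul, hDμ i hi]; ring),
    Finset.sum_eq_single j
    (fun i hi hij => by rw [eval_mul, hAβ i hi hij]; ring) (fun h => absurd hj h),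
    Finset.sum_eq_single j (fun j' hj' hne' => Finset.sum_eq_zero fun i hi => by
      rw [divDiff_mul_eq_zero (hAβ j' hj' hne') (hDμ i hi), mul_zero]) (fun h => absurd hj h)] at h
  have h2 : ∀ i ∈ s, ρ j * x i * divDiff (A * D) (β j) (μ i) =
      (A * D).eval (β j) * (ρ j * (x i / (β j - μ i))) := by
    intro i hi
    rw [divDiff, if_neg (hne i hi), eval_mul, eval_mul, hDμ i hi]
    ring
  rw [Finset.sum_congr rfl h2, ← Finset.mul_sum, ← Finset.mul_sum] at h
  refine mul_left_cancel₀ (a := (A * D).eval (β j)) (by rw [eval_mul]; exact mul_ne_zero hA0 hD0) ?_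
  linear_combination h

/-- At a collision `β p = μ q` two test polynomials are available: one with a simple zero and one
with no zero at the common node. In the first case only the derivative in the divided difference
survives, which gives the product relation; that relation removes the derivative from the second
case. -/
theorem MomentRelation.tangent (hμ : Set.InjOn μ s)
    (hβ : Set.InjOn β s) (H : ∀ P, MomentRelation s β μ t' t ρ x e P) {p q : ι} (hp : p ∈ s) (hq : q ∈ s) (hpq : β p = μ q)
    (htp : t' p = 0) (htq : t q = 0) :
    ρ p * x q = 0 ∧ ρ p * (β p - e - ∑ i ∈ s.erase q, x i / (β p - μ i)) =
      x q * ∑ j ∈ s.erase p, ρ j / (β p - β j) := by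
  set A : ℂ[X] := ∏ j ∈ s.erase p, (X - C (β j)) with hA
  set D : ℂ[X] := ∏ i ∈ s.erase q, (X - C (μ i)) with hD
  have hAβ : ∀ j ∈ s, j ≠ p → A.eval (β j) = 0 := fun j hj hjj => by
    rw [hA, eval_prod_X_sub_C]
    exact Finset.prod_eq_zero (Finset.mem_erase.2 ⟨hjj, hj⟩) (sub_self _)
  have hDμ : ∀ i ∈ s, i ≠ q → D.eval (μ i) = 0 := fun j hj hjj => by
    rw [hD, eval_prod_X_sub_C]
    exact Finset.prod_eq_zero (Finset.mem_erase.2 ⟨hjj, hj⟩) (sub_self _)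
  have hA0 : A.eval (β p) ≠ 0 := by
    rw [hA, eval_prod_X_sub_C]
    refine Finset.prod_ne_zero_iff.2 fun i hi => sub_ne_zero.2 fun h => ?_
    exact Finset.ne_of_mem_erase hi (hβ (Finset.mem_of_mem_erase hi) hp h.symm)
  have hD0 : D.eval (β p) ≠ 0 := by
    rw [hpq, hD, eval_prod_X_sub_C]
    refine Finset.prod_ne_zero_iff.2 fun i hi => sub_ne_zero.2 fun h => ?_
    exact Finset.ne_of_mem_erase hi (hμ (Finset.mem_of_mem_erase hi) hq h.symm)
  have hAD0 : (A * D).eval (β p) ≠ 0 := by rw [eval_mul]; exact mul_ne_zero hA0 hD0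
  have key1 : ρ p * x q = 0 := by
    -- The product `A * D'` vanishes at every node, and its derivative at the common node is the
    -- value of `A * D`.
    set D' : ℂ[X] := (X - C (μ q)) * D with hD'
    have hDμ' : ∀ i ∈ s, D'.eval (μ i) = 0 := fun i hi => by
      by_cases h : i = q
      · simp [hD', h]
      · simp [hD', hDμ i hi h]
    have hz : ∀ j ∈ s, (A * D').eval (β j) = 0 := fun j hj => by
      by_cases h : j = p
      · simp [hD', h, hpq]
      · simp [hAβ j hj h]
    have h := H (A * D')
    unfold MomentRelation at h
    rw [Finset.sum_eq_zero (fun j hj => by rw [hz j hj]; ring),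
      Finset.sum_eq_zero (fun i hi => by rw [eval_mul, hDμ' i hi]; ring),
      Finset.sum_eq_zero (fun j hj => by rw [hz j hj]; ring),
      Finset.sum_eq_single p (fun j hj hne => Finset.sum_eq_zero fun i hi => by
        rw [divDiff_mul_eq_zero (hAβ j hj hne) (hDμ' i hi), mul_zero]) (fun h => absurd hp h),
      Finset.sum_eq_single q (fun i hi hne => by
        rw [divDiff_eq_zero_of_ne (fun h => hne (hμ hi hq (h.symm.trans hpq))) (hz p hp)
          (by rw [eval_mul, hDμ' i hi, mul_zero]), mul_zero]) (fun h => absurd hq h)] at h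
    have h3 : divDiff (A * D') (β p) (μ q) = (A * D).eval (β p) := by
      rw [divDiff, if_pos hpq, hD']
      simp [hpq]
    rw [h3, sub_self, zero_sub, zero_eq_neg] at h
    exact (mul_eq_zero.1 h).resolve_right hAD0
  refine ⟨key1, ?_⟩
  have h := H (A * D)
  unfold MomentRelation at h
  rw [Finset.sum_eq_zero (fun j hj => by
      by_cases h : j = p
      · rw [h, htp, zero_mul]
      · rw [eval_mul, hAβ j hj h]; ring),
    Finset.sum_eq_zero (fun i hi => by
      by_cases h : i = q
      · rw [h, htq, zero_mul]
      · rw [eval_mul, hDμ i hi h]; ring),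
    Finset.sum_eq_single p (fun i hi hij => by rw [eval_mul, hAβ i hi hij]; ring)
      (fun h => absurd hp h),
    ← Finset.add_sum_erase s _ hp, ← Finset.add_sum_erase s _ hq, key1, zero_mul, zero_add] at h
  have h2 : ∀ i ∈ s.erase q, ρ p * x i * divDiff (A * D) (β p) (μ i) =
      (A * D).eval (β p) * (ρ p * (x i / (β p - μ i))) := by
    intro i hi
    obtain ⟨h1, h2⟩ := Finset.mem_erase.1 hi
    rw [divDiff, if_neg (fun h => h1 (hμ h2 hq (h.symm.trans hpq))), eval_mul, eval_mul, hDμ i h2 h1]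
    ring
  have h4 : ∀ j ∈ s.erase p, ∑ i ∈ s, ρ j * x i * divDiff (A * D) (β j) (μ i) =
      (A * D).eval (β p) * (x q * (ρ j / (β p - β j))) := by
    intro j hj
    obtain ⟨h1, h2⟩ := Finset.mem_erase.1 hj
    rw [Finset.sum_eq_single q (fun i hi hne => by
      rw [divDiff_mul_eq_zero (hAβ j h2 h1) (hDμ i hi hne), mul_zero]) (fun h => absurd hq h),
      divDiff, if_neg (fun h => h1 (hβ h2 hp (h.trans hpq.symm))), eval_mul, hAβ j h2 h1, ← hpq,
      ← neg_sub (β p) (β j), div_neg]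
    ring
  rw [Finset.sum_congr rfl h2, Finset.sum_congr rfl h4,
    ← Finset.mul_sum, ← Finset.mul_sum, ← Finset.mul_sum, ← Finset.mul_sum] at h
  refine mul_left_cancel₀ hAD0 ?_
  linear_combination -h

variable {t₁ t₂ : Finset ι} {L : ι → ℂ} {c : ℂ}

/-- The momentum relation at the points of a row `s` of a tableau, with `t₁` the row below and `t₂`
the row above. -/
def RowRelation (s t₁ t₂ : Finset ι) (L : ι → ℂ) (c : ℂ) (t' t : ι → ℂ) : Prop :=
  ∀ P, MomentRelation s (fun j => L j + c - 1) (fun i => L i + c) t' t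
    (fun j => (∏ x ∈ t₁, (L j - L x)) / ∏ j' ∈ s.erase j, (L j - L j'))
    (fun i => -((∏ y ∈ t₂, (L i - L y)) / ∏ j' ∈ s.erase i, (L i - L j')))
    (c + ∑ y ∈ t₂, L y - ∑ i ∈ s, L i) P

theorem prod_sub_ne_zero {s : Finset ι} {L : ι → ℂ} {u : ℂ} (h : ∀ i ∈ s, u ≠ L i) :
    ∏ i ∈ s, (u - L i) ≠ 0 :=
  Finset.prod_ne_zero_iff.2 fun i hi => sub_ne_zero.2 (h i hi)

theorem prod_erase_sub_ne_zero (hL : Set.InjOn L s) {i : ι} (hi : i ∈ s) :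
    ∏ j ∈ s.erase i, (L i - L j) ≠ 0 :=
  prod_sub_ne_zero fun _ hj h =>
    Finset.ne_of_mem_erase hj (hL (Finset.mem_of_mem_erase hj) hi h.symm)

theorem injOn_shift (hL : Set.InjOn L s) (c : ℂ) : Set.InjOn (fun i => L i + c) s :=
  fun _ hi _ hj h => hL hi hj (add_right_cancel h)

theorem injOn_shift' (hL : Set.InjOn L s) (c : ℂ) : Set.InjOn (fun i => L i + c - 1) s :=
  fun _ hi _ hj h => hL hi hj (add_right_cancel (sub_left_injective h))

/-- The sum over `j` in `MomentRelation.raise_eq` is a partial fraction expansion at `L i + 1`, so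
`t i` is a quotient of products of differences, and the hypotheses exclude the vanishing of every
factor. -/
theorem RowRelation.raise_ne_zero (H : RowRelation s t₁ t₂ L c t' t) (hL : Set.InjOn L s)
    (h1 : t₁.card < s.card) {i : ι} (hi : i ∈ s)
    (hne : ∀ j ∈ s, L i + 1 ≠ L j) (hy : ∀ y ∈ t₂, L i ≠ L y) (hx : ∀ x ∈ t₁, L i + 1 ≠ L x) :
    t i ≠ 0 := by
  have h := MomentRelation.raise_eq (injOn_shift hL c) H hi
    (fun j hj h => hne j hj (by linear_combination h))
  have h2 := partialFractions_lt s t₁ L L hL h1 (L i + 1) hne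
  have h3 : ∑ j ∈ s, (∏ x ∈ t₁, (L j - L x)) / (∏ j' ∈ s.erase j, (L j - L j')) /
      (L i + c - (L j + c - 1)) = (∏ j ∈ t₁, (L i + 1 - L j)) / ∏ j ∈ s, (L i + 1 - L j) := by
    rw [← h2]
    exact Finset.sum_congr rfl fun j _ => by congr 1; ring
  rw [h, h3]
  refine mul_ne_zero (neg_ne_zero.2 (div_ne_zero (prod_sub_ne_zero hy)
    (prod_erase_sub_ne_zero hL hi))) (div_ne_zero (prod_sub_ne_zero hx) (prod_sub_ne_zero hne))

/-- As for raising, at the point `L j - 1`. Here the row above has one more entry than `s`, and the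
linear part of the expansion is the term `β j - e`. -/
theorem RowRelation.lower_ne_zero (H : RowRelation s t₁ t₂ L c t' t) (hL : Set.InjOn L s)
    (h2 : t₂.card = s.card + 1) {j : ι} (hj : j ∈ s)
    (hne : ∀ i ∈ s, L j - 1 ≠ L i) (hy : ∀ y ∈ t₂, L j - 1 ≠ L y) (hx : ∀ x ∈ t₁, L j ≠ L x) :
    t' j ≠ 0 := by
  have h := MomentRelation.lower_eq (injOn_shift' hL c) H hj
    (fun i hi h => hne i hi (by linear_combination h))
  have h2 := partialFractions_succ s t₂ L L hL h2 (L j - 1) hne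
  have h3 : L j + c - 1 - (c + ∑ y ∈ t₂, L y - ∑ i ∈ s, L i) -
      ∑ i ∈ s, -((∏ y ∈ t₂, (L i - L y)) / ∏ j' ∈ s.erase i, (L i - L j')) /
        (L j + c - 1 - (L i + c)) = (∏ y ∈ t₂, (L j - 1 - L y)) / ∏ i ∈ s, (L j - 1 - L i) := by
    have h5 : ∀ i ∈ s, -((∏ y ∈ t₂, (L i - L y)) / ∏ j' ∈ s.erase i, (L i - L j')) /
        (L j + c - 1 - (L i + c)) = -((∏ j ∈ t₂, (L i - L j)) /
          (∏ j ∈ s.erase i, (L i - L j)) / (L j - 1 - L i)) := fun i _ => by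
      rw [neg_div]; congr 2; ring
    rw [← h2, Finset.sum_congr rfl h5, Finset.sum_neg_distrib]
    ring
  rw [h, h3]
  exact mul_ne_zero (div_ne_zero (prod_sub_ne_zero hx) (prod_erase_sub_ne_zero hL hj))
    (div_ne_zero (prod_sub_ne_zero hy) (prod_sub_ne_zero hne))

/-- One of `ρ p`, `x q` vanishes, which places an entry of an adjacent row at the collision. If only
one vanishes, that entry cancels one pole, and the second relation is a partial fraction identity
that forces a second such entry in the same adjacent row. For the row below this contradicts `hL₁`.
-/
theorem RowRelation.tangent (H : RowRelation s t₁ t₂ L c t' t) (hL : Set.InjOn L s)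
    (hL₁ : Set.InjOn L t₁) (h1 : t₁.card < s.card) (h2 : t₂.card = s.card + 1) {p q : ι}
    (hp : p ∈ s) (hq : q ∈ s) (hpq : L p = L q + 1) (htp : t' p = 0) (htq : t q = 0) :
    ((∃ y ∈ t₂, L y = L q) ∧ ∃ x ∈ t₁, L x = L p) ∨
      ∃ y ∈ t₂, ∃ y' ∈ t₂, y ≠ y' ∧ L y = L q ∧ L y' = L q := by
  obtain ⟨h, h'⟩ := MomentRelation.tangent (injOn_shift hL c) (injOn_shift' hL c) H hp hq
    (by rw [hpq]; ring) htp htq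
  have hzero : ∀ (u : Finset ι) (i : ι), ∏ y ∈ u, (L i - L y) = 0 → ∃ y ∈ u, L y = L i := by
    intro u i hu
    obtain ⟨y, hy, h⟩ := Finset.prod_eq_zero_iff.1 hu
    exact ⟨y, hy, (sub_eq_zero.1 h).symm⟩
  have hdenp := prod_erase_sub_ne_zero hL hp
  have hdenq := prod_erase_sub_ne_zero hL hq
  have hρ : ∏ x ∈ t₁, (L p - L x) = 0 ↔
      (∏ x ∈ t₁, (L p - L x)) / ∏ j' ∈ s.erase p, (L p - L j') = 0 := by
    simp [div_eq_zero_iff, hdenp]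
  have hx : ∏ y ∈ t₂, (L q - L y) = 0 ↔
      -((∏ y ∈ t₂, (L q - L y)) / ∏ j' ∈ s.erase q, (L q - L j')) = 0 := by
    simp only [neg_eq_zero, div_eq_zero_iff, hdenq, or_false]
  by_cases hxq : ∏ y ∈ t₂, (L q - L y) = 0
  · by_cases hρp : ∏ x ∈ t₁, (L p - L x) = 0
    · exact Or.inl ⟨hzero _ _ hxq, hzero _ _ hρp⟩
    right
    obtain ⟨y, hy, hyq⟩ := hzero _ _ hxq
    rw [hx.1 hxq, zero_mul] at h'
    have h3 := (mul_eq_zero.1 h').resolve_left (mt hρ.2 hρp)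
    have hne : ∀ i ∈ s.erase q, L q ≠ L i := fun i hi h =>
      Finset.ne_of_mem_erase hi (hL (Finset.mem_of_mem_erase hi) hq h.symm)
    have h4 := partialFractions_succ (s.erase q) (t₂.erase y) L L (hL.mono (by simp))
      (by rw [Finset.card_erase_of_mem hy, Finset.card_erase_of_mem hq]
          have := Finset.card_pos.2 ⟨q, hq⟩; omega) (L q) hne
    have h5 : ∀ i ∈ s.erase q, -((∏ y ∈ t₂, (L i - L y)) / ∏ j' ∈ s.erase i, (L i - L j')) /
        (L p + c - 1 - (L i + c)) = -((∏ j ∈ t₂.erase y, (L i - L j)) /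
          (∏ j ∈ (s.erase q).erase i, (L i - L j)) / (L q - L i)) := by
      intro i hi
      have hiq : q ∈ s.erase i := Finset.mem_erase.2 ⟨(Finset.ne_of_mem_erase hi).symm, hq⟩
      rw [← Finset.mul_prod_erase t₂ _ hy, ← Finset.mul_prod_erase (s.erase i) _ hiq, hyq,
        mul_div_mul_left _ _ (sub_ne_zero.2 (hne i hi).symm), neg_div, Finset.erase_right_comm]
      congr 2
      rw [hpq]; ring
    rw [Finset.sum_congr rfl h5, Finset.sum_neg_distrib] at h3
    have h6 : (∏ j ∈ t₂.erase y, (L q - L j)) / ∏ i ∈ s.erase q, (L q - L i) = 0 := by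
      rw [← h4, ← h3, ← Finset.add_sum_erase t₂ _ hy, ← Finset.add_sum_erase s _ hq, hpq, hyq]
      ring
    obtain ⟨y', hy', h7⟩ := hzero _ _ ((div_eq_zero_iff.1 h6).resolve_right hdenq)
    exact ⟨y, hy, y', Finset.mem_of_mem_erase hy', (Finset.ne_of_mem_erase hy').symm, hyq, h7⟩
  · exfalso
    have hρp := (mul_eq_zero.1 h).resolve_right (mt hx.2 hxq)
    obtain ⟨x, hx1, hxp⟩ := hzero _ _ (hρ.2 hρp)
    rw [hρp, zero_mul] at h'
    have h3 := (mul_eq_zero.1 h'.symm).resolve_left (mt hx.2 hxq)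
    have hne : ∀ i ∈ s.erase p, L p ≠ L i := fun i hi h =>
      Finset.ne_of_mem_erase hi (hL (Finset.mem_of_mem_erase hi) hp h.symm)
    have h4 := partialFractions_lt (s.erase p) (t₁.erase x) L L (hL.mono (by simp))
      (by rw [Finset.card_erase_of_mem hx1, Finset.card_erase_of_mem hp]
          have := Finset.card_pos.2 ⟨x, hx1⟩; omega) (L p) hne
    have h5 : ∀ i ∈ s.erase p, (∏ y ∈ t₁, (L i - L y)) / (∏ j' ∈ s.erase i, (L i - L j')) /
        (L p + c - 1 - (L i + c - 1)) = (∏ j ∈ t₁.erase x, (L i - L j)) /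
          (∏ j ∈ (s.erase p).erase i, (L i - L j)) / (L p - L i) := by
      intro i hi
      have hip : p ∈ s.erase i := Finset.mem_erase.2 ⟨(Finset.ne_of_mem_erase hi).symm, hp⟩
      rw [← Finset.mul_prod_erase t₁ _ hx1, ← Finset.mul_prod_erase (s.erase i) _ hip, hxp,
        mul_div_mul_left _ _ (sub_ne_zero.2 (hne i hi).symm), Finset.erase_right_comm]
      congr 1
      ring
    rw [Finset.sum_congr rfl h5, h4] at h3
    obtain ⟨x', hx', h7⟩ := hzero _ _ ((div_eq_zero_iff.1 h3).resolve_right hdenp)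
    exact Finset.ne_of_mem_erase hx' (hL₁ (Finset.mem_of_mem_erase hx') hx1 (h7.trans hxp.symm))

end PartialFractions

end GelfandTsetlin
end

noncomputable section
namespace GelfandTsetlin

/-! ### Traces of powers of the matrix of generators -/

section Block

open Matrix

set_option linter.unusedSectionVars false

variable {ι A : Type*} [Fintype ι] [DecidableEq ι] [Ring A]

/-- The commutation relations of `gl_{k+1}`, written in blocks: `E` is the matrix of the generators
of `gl_k`, `v i = E_{i,k+1}`, `w i = E_{k+1,i}` and `e = E_{k+1,k+1}`. -/
structure BlockRelations (E : Matrix ι ι A) (v w : ι → A) (e : A) : Prop where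
  EE : ∀ i j k l, E i j * E k l =
    E k l * E i j + (if j = k then E i l else 0) - (if l = i then E k j else 0)
  Ev : ∀ i j l, E i j * v l = v l * E i j + if j = l then v i else 0
  Ew : ∀ i j l, E i j * w l = w l * E i j - if i = l then w j else 0
  vw : ∀ i j, v i * w j = w j * v i + E i j - if i = j then e else 0
  ww : ∀ i j, w i * w j = w j * w i
  eE : ∀ i j, e * E i j = E i j * e
  ew : ∀ i, e * w i = w i * (e + 1)

variable {E : Matrix ι ι A} {v w : ι → A} {e : A}

/-- `∑ E_{k+1,i} (E^r)_{ij} E_{j,k+1}`. -/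
def blockInv (E : Matrix ι ι A) (v w : ι → A) (r : ℕ) : A := w ⬝ᵥ (E ^ r *ᵥ v)

theorem pow_succ_mulVec (E : Matrix ι ι A) (v : ι → A) (r : ℕ) :
    E ^ (r + 1) *ᵥ v = E *ᵥ (E ^ r *ᵥ v) := by
  rw [mulVec_mulVec, pow_succ']

theorem vecMul_pow_succ (E : Matrix ι ι A) (w : ι → A) (r : ℕ) :
    w ᵥ* E ^ (r + 1) = (w ᵥ* E ^ r) ᵥ* E := by
  rw [vecMul_vecMul, pow_succ]

theorem mulVec_apply (E : Matrix ι ι A) (u : ι → A) (i : ι) : (E *ᵥ u) i = ∑ j, E i j * u j := rfl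

theorem vecMul_apply (E : Matrix ι ι A) (u : ι → A) (i : ι) : (u ᵥ* E) i = ∑ j, u j * E j i := rfl

/-- If `u` transforms under $\mathfrak{gl}_k$ like a column vector, then so does `E *ᵥ u`: the extra
terms cancel after summation. By induction this covers all `E ^ r *ᵥ v`. -/
theorem BlockRelations.E_mulVec (H : BlockRelations E v w e) {u : ι → A}
    (hu : ∀ i j l, E i j * u l = u l * E i j + if j = l then u i else 0) (i j l : ι) :
    E i j * (E *ᵥ u) l = (E *ᵥ u) l * E i j + if j = l then (E *ᵥ u) i else 0 := by
  rw [mulVec_apply, Finset.mul_sum, Finset.sum_mul]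
  have h : ∀ b, E i j * (E l b * u b) = E l b * u b * E i j + (if j = l then E i b * u b else 0) +
      ((if j = b then E l b * u i else 0) - if b = i then E l j * u b else 0) := by
    intro b
    rw [← mul_assoc, H.EE, sub_mul, add_mul, mul_assoc, hu, mul_add, ← mul_assoc]
    split_ifs <;> (try simp only [mul_zero, zero_mul, add_zero, sub_zero]) <;> abel
  rw [Finset.sum_congr rfl fun b _ => h b, Finset.sum_add_distrib, Finset.sum_add_distrib,
    Finset.sum_sub_distrib, Finset.sum_ite_eq, Finset.sum_ite_eq']
  simp only [Finset.mem_univ, if_true, sub_self, add_zero]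
  split_ifs
  · rfl
  · rw [Finset.sum_const_zero]

theorem BlockRelations.E_vecMul (H : BlockRelations E v w e) {u : ι → A}
    (hu : ∀ i j l, E i j * u l = u l * E i j - if i = l then u j else 0) (i j l : ι) :
    E i j * (u ᵥ* E) l = (u ᵥ* E) l * E i j - if i = l then (u ᵥ* E) j else 0 := by
  rw [vecMul_apply, Finset.mul_sum, Finset.sum_mul]
  have h : ∀ b, E i j * (u b * E b l) = u b * E b l * E i j - (if i = l then u b * E b j else 0) +
      ((if j = b then u b * E i l else 0) - if i = b then u j * E b l else 0) := by
    intro b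
    rw [← mul_assoc, hu, sub_mul, mul_assoc, H.EE, mul_sub, mul_add, ← mul_assoc]
    simp only [eq_comm (a := l) (b := i)]
    split_ifs <;> (try simp only [mul_zero, zero_mul, add_zero, sub_zero]) <;> abel
  rw [Finset.sum_congr rfl fun b _ => h b, Finset.sum_add_distrib, Finset.sum_sub_distrib,
    Finset.sum_sub_distrib, Finset.sum_ite_eq, Finset.sum_ite_eq]
  simp only [Finset.mem_univ, if_true, sub_self, add_zero]
  split_ifs
  · rfl
  · rw [Finset.sum_const_zero]

theorem BlockRelations.E_pow_mulVec (H : BlockRelations E v w e) (r : ℕ) : ∀ i j l,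
    E i j * (E ^ r *ᵥ v) l = (E ^ r *ᵥ v) l * E i j + if j = l then (E ^ r *ᵥ v) i else 0 := by
  induction r with
  | zero => simpa using H.Ev
  | succ r ih => rw [pow_succ_mulVec]; exact H.E_mulVec ih

theorem BlockRelations.E_vecMul_pow (H : BlockRelations E v w e) (r : ℕ) : ∀ i j l,
    E i j * (w ᵥ* E ^ r) l = (w ᵥ* E ^ r) l * E i j - if i = l then (w ᵥ* E ^ r) j else 0 := by
  induction r with
  | zero => simpa using H.Ew
  | succ r ih => rw [vecMul_pow_succ]; exact H.E_vecMul ih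

/-- The commutator of the quadratic Casimir element of `gl_k` with a vector operator. -/
theorem BlockRelations.trace_sq_mul (_ : BlockRelations E v w e) {u : ι → A}
    (hu : ∀ i j l, E i j * u l = u l * E i j + if j = l then u i else 0) (l : ι) :
    trace (E ^ 2) * u l = u l * trace (E ^ 2) + 2 * (E *ᵥ u) l - (Fintype.card ι : A) * u l := by
  have h : ∀ a b, E a b * E b a * u l = u l * (E a b * E b a) +
      ((if a = l then E a b * u b else 0) + (if b = l then E b a * u a else 0) -
        if b = l then u l else 0) := by
    intro a b
    rw [mul_assoc, hu, mul_add, ← mul_assoc (E a b) (u l), hu, add_mul]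
    by_cases h1 : a = l
    · by_cases h2 : b = l
      · subst h1; subst h2
        have := hu b b b
        simp only [if_true] at this ⊢
        rw [this, mul_assoc]; abel
      · simp [h1, h2]; rw [mul_assoc]
    · by_cases h2 : b = l
      · subst h2
        have := hu b a a
        simp only [if_true] at this ⊢
        simp only [h1, if_false, mul_zero, this]
        rw [mul_assoc]; abel
      · simp [h1, h2]; rw [mul_assoc]
  rw [pow_two, trace]
  simp only [diag_apply, mul_apply, Finset.sum_mul, Finset.mul_sum, h, Finset.sum_add_distrib,
    Finset.sum_sub_distrib]
  rw [Finset.sum_comm (f := fun a b => if b = l then E b a * u a else 0)]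
  have h1 : ∑ a, ∑ b, (if a = l then E a b * u b else 0) = (E *ᵥ u) l := by
    rw [Finset.sum_eq_single l]
    · simp [mulVec_apply]
    · intro b _ hb; simp [hb]
    · simp
  rw [h1]
  simp only [Finset.sum_ite_eq', Finset.mem_univ, if_true, Finset.sum_const, Finset.card_univ,
    nsmul_eq_mul]
  rw [two_mul]; abel

/-- The commutator of `(E^r v)_i` and `w_j`. -/
theorem BlockRelations.pow_mulVec_mul_w (H : BlockRelations E v w e) (r : ℕ) : ∀ i j,
    (E ^ r *ᵥ v) i * w j = w j * (E ^ r *ᵥ v) i + (E ^ (r + 1)) i j - e * (E ^ r) i j -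
      ∑ s ∈ Finset.range r, (E ^ s) i j * blockInv E v w (r - 1 - s) := by
  induction r with
  | zero =>
    intro i j
    simp only [pow_zero, one_mulVec, zero_add, pow_one, Finset.range_zero, Finset.sum_empty,
      sub_zero, H.vw i j, one_apply]
    split_ifs <;> simp
  | succ r ih =>
    intro i j
    rw [pow_succ_mulVec, mulVec_apply, Finset.sum_mul, Finset.mul_sum, Finset.sum_range_succ']
    have h : ∀ b, E i b * (E ^ r *ᵥ v) b * w j = w j * (E i b * (E ^ r *ᵥ v) b) +
        E i b * (E ^ (r + 1)) b j - e * (E i b * (E ^ r) b j) -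
        (∑ s ∈ Finset.range r, E i b * (E ^ s) b j * blockInv E v w (r - 1 - s)) -
        (if i = j then w b * (E ^ r *ᵥ v) b else 0) := by
      intro b
      rw [mul_assoc, ih, mul_sub, mul_sub, mul_add, ← mul_assoc (E i b) (w j), H.Ew, sub_mul,
        Finset.mul_sum, ← mul_assoc (E i b) e, ← H.eE, mul_assoc e, mul_assoc (w j)]
      simp only [mul_assoc]
      split_ifs <;> (try simp only [mul_zero, zero_mul, add_zero, sub_zero, zero_add]) <;> abel
    have he : ∑ b, e * (E i b * (E ^ r) b j) = e * (E ^ (r + 1)) i j := by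
      rw [pow_succ', mul_apply, Finset.mul_sum]
    rw [Finset.sum_congr rfl fun b _ => h b]
    simp only [Finset.sum_sub_distrib, Finset.sum_add_distrib]
    rw [Finset.sum_comm, pow_succ' E (r + 1), mul_apply, he,
      Finset.sum_congr rfl (g := fun s => (E ^ (s + 1)) i j * blockInv E v w (r + 1 - 1 - (s + 1)))
        (fun s hs => by
          rw [← Finset.sum_mul, ← mul_apply, ← pow_succ',
            show r - 1 - s = r + 1 - 1 - (s + 1) by omega])]
    have h2 : ∑ b, (if i = j then w b * (E ^ r *ᵥ v) b else 0) =
        (E ^ 0) i j * blockInv E v w (r + 1 - 1 - 0) := by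
      rw [pow_zero, one_apply]
      split_ifs
      · rw [one_mul]; rfl
      · simp
    rw [h2]; abel

/-- `∑ (E^a v)_j w_j`. -/
theorem BlockRelations.pow_mulVec_dot_w (H : BlockRelations E v w e) (r : ℕ) :
    (E ^ r *ᵥ v) ⬝ᵥ w = blockInv E v w r + trace (E ^ (r + 1)) - e * trace (E ^ r) -
      ∑ s ∈ Finset.range r, trace (E ^ s) * blockInv E v w (r - 1 - s) := by
  rw [dotProduct, Finset.sum_congr rfl fun j _ => H.pow_mulVec_mul_w r j j]
  simp only [Finset.sum_sub_distrib, Finset.sum_add_distrib]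
  rw [Finset.sum_comm, ← Finset.mul_sum]
  simp only [← Finset.sum_mul]
  rfl

/-- Moving one factor `E` from the row vector to the column vector produces two corrections, each
$k$ times the scalar product of the two vectors, with opposite signs. -/
theorem BlockRelations.dot_shift (H : BlockRelations E v w e) (a t : ℕ) :
    (E ^ a *ᵥ v) ⬝ᵥ (w ᵥ* E ^ (t + 1)) = (E ^ (a + 1) *ᵥ v) ⬝ᵥ (w ᵥ* E ^ t) := by
  rw [vecMul_pow_succ, pow_succ_mulVec]
  set u := E ^ a *ᵥ v
  set z := w ᵥ* E ^ t
  have hu := H.E_pow_mulVec a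
  have hz := H.E_vecMul_pow t
  have h : ∀ d j, u j * (z d * E d j) = E d j * u j * z d - u d * z d + u j * z j := by
    intro d j
    have h1 := hu d j j
    have h2 := hz d j d
    simp only [if_true] at h1 h2
    rw [h1, add_mul, mul_assoc (u j) (E d j), h2]
    simp only [mul_sub]
    abel
  simp only [dotProduct, vecMul_apply, mulVec_apply, Finset.mul_sum, Finset.sum_mul]
  rw [Finset.sum_comm]
  simp only [h, Finset.sum_add_distrib, Finset.sum_sub_distrib, Finset.sum_const]
  rw [← Finset.smul_sum]
  abel

theorem BlockRelations.dot_eq (H : BlockRelations E v w e) (t : ℕ) : ∀ a,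
    (E ^ a *ᵥ v) ⬝ᵥ (w ᵥ* E ^ t) = (E ^ (a + t) *ᵥ v) ⬝ᵥ w := by
  induction t with
  | zero => intro a; simp
  | succ t ih => intro a; rw [H.dot_shift, ih]; congr 3; omega

/-- In the trace of the fourth power, the corner factor between `v` and `w` contains `blockInv E v w
0`; this moves it to the right. -/
theorem BlockRelations.blockInv_sandwich (H : BlockRelations E v w e) :
    v ⬝ᵥ (fun j => blockInv E v w 0 * w j) =
      (v ⬝ᵥ w) * blockInv E v w 0 + v ⬝ᵥ (w ᵥ* E) - (v ⬝ᵥ w) * e := by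
  have h : ∀ i j, v j * (w i * v i * w j) =
      v j * w j * (w i * v i) + v j * (w i * E i j) - if i = j then v j * w i * e else 0 := by
    intro i j
    rw [mul_assoc (w i), H.vw, mul_sub, mul_add, ← mul_assoc (w i) (w j), H.ww i j, mul_sub, mul_add]
    simp only [← mul_assoc]
    split_ifs <;> simp
  simp only [dotProduct, blockInv, pow_zero, one_mulVec, Finset.sum_mul, Finset.mul_sum, h,
    Finset.sum_sub_distrib, Finset.sum_add_distrib, vecMul_apply]
  congr 2
  · rw [Finset.sum_comm]
  · funext j; simp

/-- The matrix of the generators of `gl_{k+1}`. -/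
abbrev blockMat (E : Matrix ι ι A) (v w : ι → A) (e : A) : Matrix (ι ⊕ Unit) (ι ⊕ Unit) A :=
  fromBlocks E (of fun i _ => v i) (of fun _ j => w j) (of fun _ _ => e)

/-- The `(k+1, k+1)` entries of the powers of the matrix of `gl_{k+1}`. -/
def cornerPow (E : Matrix ι ι A) (v w : ι → A) (e : A) (r : ℕ) : A :=
  (blockMat E v w e ^ r)
    (Sum.inr ()) (Sum.inr ())

section Corner

variable (E v w e)

/-- Entries of powers are sums over walks; cut the walk at its first visit to the last index.
`cornerPow_succ` cuts at the first return, `blockMat_pow_inr_inl` at the last visit. -/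
theorem fromBlocks_pow_inl_inr (r : ℕ) (i : ι) :
    (blockMat E v w e ^ r)
      (Sum.inl i) (Sum.inr ()) =
      ∑ s ∈ Finset.range r, (E ^ s *ᵥ v) i * cornerPow E v w e (r - 1 - s) := by
  induction r generalizing i with
  | zero => simp
  | succ r ih =>
    rw [pow_succ', mul_apply, Fintype.sum_sum_type, Finset.sum_range_succ']
    simp only [fromBlocks_apply₁₁, ih, fromBlocks_apply₁₂, Finset.univ_unique, Finset.sum_singleton,
      Finset.mul_sum]
    rw [Finset.sum_comm]
    congr 1
    · refine Finset.sum_congr rfl fun s _ => ?_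
      rw [pow_succ_mulVec, mulVec_apply, Finset.sum_mul]
      refine Finset.sum_congr rfl fun j _ => ?_
      rw [mul_assoc, show r - 1 - s = r + 1 - 1 - (s + 1) by omega]
    · simp [cornerPow]

theorem cornerPow_zero : cornerPow E v w e 0 = 1 := by simp [cornerPow]

theorem cornerPow_succ (r : ℕ) : cornerPow E v w e (r + 1) = e * cornerPow E v w e r +
    ∑ s ∈ Finset.range r, blockInv E v w s * cornerPow E v w e (r - 1 - s) := by
  rw [cornerPow, pow_succ', mul_apply, Fintype.sum_sum_type, add_comm]
  simp only [fromBlocks_apply₂₁, fromBlocks_apply₂₂, Finset.univ_unique, Finset.sum_singleton,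
    fromBlocks_pow_inl_inr, Finset.mul_sum]
  rw [Finset.sum_comm]
  congr 1
  refine Finset.sum_congr rfl fun s _ => ?_
  rw [blockInv, dotProduct, Finset.sum_mul]
  exact Finset.sum_congr rfl fun j _ => by rw [of_apply, mul_assoc]

theorem trace_fromBlocks_pow_aux (M : Matrix (ι ⊕ Unit) (ι ⊕ Unit) A) :
    trace M = ∑ i, M (Sum.inl i) (Sum.inl i) + M (Sum.inr ()) (Sum.inr ()) := by
  simp [trace]

theorem blockMat_pow_inr_inl (r : ℕ) (j : ι) :
    (blockMat E v w e ^ r) (Sum.inr ()) (Sum.inl j) =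
      ∑ t ∈ Finset.range r, cornerPow E v w e (r - 1 - t) * (w ᵥ* E ^ t) j := by
  induction r generalizing j with
  | zero => simp
  | succ r ih =>
    rw [pow_succ, mul_apply, Fintype.sum_sum_type, Finset.sum_range_succ']
    simp only [fromBlocks_apply₁₁, ih, fromBlocks_apply₂₁, Finset.univ_unique, Finset.sum_singleton,
      Finset.sum_mul]
    rw [Finset.sum_comm]
    congr 1
    · refine Finset.sum_congr rfl fun s _ => ?_
      rw [vecMul_pow_succ, vecMul_apply, Finset.mul_sum]
      refine Finset.sum_congr rfl fun j _ => ?_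
      rw [mul_assoc, show r - 1 - s = r + 1 - 1 - (s + 1) by omega]
    · simp [cornerPow]

theorem blockMat_pow_inl_inl (r : ℕ) (i j : ι) :
    (blockMat E v w e ^ (r + 1)) (Sum.inl i) (Sum.inl j) =
      ∑ l, E i l * (blockMat E v w e ^ r) (Sum.inl l) (Sum.inl j) +
        v i * (blockMat E v w e ^ r) (Sum.inr ()) (Sum.inl j) := by
  rw [pow_succ', mul_apply, Fintype.sum_sum_type]
  simp

end Corner

theorem trace_pow_mul_blockMat (r : ℕ) : ∀ a,
    ∑ i, ∑ l, (E ^ a) i l * (blockMat E v w e ^ r) (Sum.inl l) (Sum.inl i) =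
      trace (E ^ (a + r)) + ∑ s ∈ Finset.range r,
        (E ^ (a + s) *ᵥ v) ⬝ᵥ fun j => (blockMat E v w e ^ (r - 1 - s)) (Sum.inr ()) (Sum.inl j) := by
  induction r with
  | zero =>
    intro a
    simp [trace, one_apply]
  | succ r ih =>
    intro a
    have h : ∀ i, ∑ l, (E ^ a) i l * (blockMat E v w e ^ (r + 1)) (Sum.inl l) (Sum.inl i) =
        ∑ l, (E ^ (a + 1)) i l * (blockMat E v w e ^ r) (Sum.inl l) (Sum.inl i) +
          (E ^ a *ᵥ v) i * (blockMat E v w e ^ r) (Sum.inr ()) (Sum.inl i) := by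
      intro i
      simp only [blockMat_pow_inl_inl, mul_add, Finset.sum_add_distrib, Finset.mul_sum, mulVec_apply,
        Finset.sum_mul, mul_assoc, pow_succ, mul_apply]
      rw [Finset.sum_comm]
    rw [Finset.sum_congr rfl fun i _ => h i, Finset.sum_add_distrib, ih, Finset.sum_range_succ',
      show a + 1 + r = a + (r + 1) by omega, add_assoc]
    congr 2
    refine Finset.sum_congr rfl fun s _ => ?_
    rw [show a + 1 + s = a + (s + 1) by omega, show r - 1 - s = r + 1 - 1 - (s + 1) by omega]

/-- Closed walks either start at the last index, or avoid it, or start elsewhere and visit it; the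
last kind is cut at the first and the last visit. -/
theorem trace_blockMat_pow_eq (r : ℕ) : trace (blockMat E v w e ^ r) =
    cornerPow E v w e r + trace (E ^ r) + ∑ s ∈ Finset.range r, ∑ t ∈ Finset.range (r - 1 - s),
      (E ^ s *ᵥ v) ⬝ᵥ fun j => cornerPow E v w e (r - 1 - s - 1 - t) * (w ᵥ* E ^ t) j := by
  have h := trace_pow_mul_blockMat (E := E) (v := v) (w := w) (e := e) r 0
  simp only [pow_zero, one_apply, ite_mul, one_mul, zero_mul, Finset.sum_ite_eq, Finset.mem_univ,
    if_true, zero_add] at h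
  rw [trace_fromBlocks_pow_aux, h, add_comm, ← add_assoc]
  congr 1
  refine Finset.sum_congr rfl fun s _ => ?_
  simp only [dotProduct, blockMat_pow_inr_inl, Finset.mul_sum]
  rw [Finset.sum_comm]

theorem BlockRelations.e_vecMul_pow (H : BlockRelations E v w e) (t : ℕ) (j : ι) :
    e * (w ᵥ* E ^ t) j = (w ᵥ* E ^ t) j * (e + 1) := by
  induction t generalizing j with
  | zero => simpa using H.ew j
  | succ t ih =>
    rw [vecMul_pow_succ, vecMul_apply, Finset.mul_sum, Finset.sum_mul]
    refine Finset.sum_congr rfl fun i _ => ?_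
    rw [← mul_assoc, ih, mul_assoc, mul_assoc, add_mul, one_mul, H.eE]
    simp only [mul_add, mul_one]

theorem cornerPow_one : cornerPow E v w e 1 = e := by
  simp [cornerPow_succ, cornerPow_zero]

theorem cornerPow_two : cornerPow E v w e 2 = e * e + blockInv E v w 0 := by
  simp [cornerPow_succ E v w e 1, cornerPow_one, cornerPow_zero]

theorem cornerPow_three : cornerPow E v w e 3 =
    e * (e * e + blockInv E v w 0) + (blockInv E v w 0 * e + blockInv E v w 1) := by
  simp [cornerPow_succ E v w e 2, cornerPow_one, cornerPow_zero, cornerPow_two,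
    Finset.sum_range_succ]

theorem cornerPow_four : cornerPow E v w e 4 =
    e * (e * (e * e + blockInv E v w 0) + (blockInv E v w 0 * e + blockInv E v w 1)) +
      (blockInv E v w 0 * (e * e + blockInv E v w 0) + blockInv E v w 1 * e +
        blockInv E v w 2) := by
  simp [cornerPow_succ E v w e 3, cornerPow_one, cornerPow_zero, cornerPow_two, cornerPow_three,
    Finset.sum_range_succ]

/-- Moving `e` to the right past a row vector replaces it by `e + 1`. -/
theorem BlockRelations.dot_e (H : BlockRelations E v w e) (a t : ℕ) :
    ((E ^ a *ᵥ v) ⬝ᵥ fun j => e * (w ᵥ* E ^ t) j) = ((E ^ (a + t) *ᵥ v) ⬝ᵥ w) * (e + 1) := by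
  simp only [H.e_vecMul_pow, ← H.dot_eq]
  simp only [dotProduct, Finset.sum_mul, mul_assoc]

theorem trace_blockMat_pow_one : trace (blockMat E v w e ^ 1) = e + trace E := by
  rw [trace_blockMat_pow_eq]
  simp [cornerPow_one]

theorem trace_blockMat_pow_two :
    trace (blockMat E v w e ^ 2) = cornerPow E v w e 2 + trace (E ^ 2) + v ⬝ᵥ w := by
  simp [trace_blockMat_pow_eq, cornerPow_zero, Finset.sum_range_succ]

theorem BlockRelations.trace_blockMat_pow_three (H : BlockRelations E v w e) :
    trace (blockMat E v w e ^ 3) = cornerPow E v w e 3 + trace (E ^ 3) +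
      2 * ((E *ᵥ v) ⬝ᵥ w) + (v ⬝ᵥ w) * (e + 1) := by
  have h1 := H.dot_e 0 0
  have h2 := H.dot_eq 1 0
  simp only [pow_zero, one_mulVec, vecMul_one, pow_one, zero_add] at h1 h2
  rw [trace_blockMat_pow_eq]
  simp only [Finset.sum_range_succ, Finset.range_zero, Finset.sum_empty, pow_zero, one_mulVec,
    cornerPow_zero, cornerPow_one, pow_one, vecMul_one, Nat.add_one_sub_one, Nat.sub_zero,
    Nat.sub_self, zero_add, add_zero, one_mul, Nat.reduceSub]
  rw [h1, h2, two_mul]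
  abel

theorem BlockRelations.trace_blockMat_pow_four (H : BlockRelations E v w e) :
    trace (blockMat E v w e ^ 4) = cornerPow E v w e 4 + trace (E ^ 4) +
      3 * ((E ^ 2 *ᵥ v) ⬝ᵥ w) + 2 * (((E *ᵥ v) ⬝ᵥ w) * (e + 1)) +
      ((v ⬝ᵥ w) * (e + 1) * (e + 1) + ((v ⬝ᵥ w) * blockInv E v w 0 + (E *ᵥ v) ⬝ᵥ w -
        (v ⬝ᵥ w) * e)) := by
  have h00 := H.dot_e 0 0
  have h10 := H.dot_e 1 0
  have h01 := H.dot_e 0 1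
  have g10 := H.dot_eq 1 0
  have g20 := H.dot_eq 2 0
  have g11 := H.dot_eq 1 1
  have h2 : (v ⬝ᵥ fun j => cornerPow E v w e 2 * w j) = (v ⬝ᵥ w) * (e + 1) * (e + 1) +
      ((v ⬝ᵥ w) * blockInv E v w 0 + (E *ᵥ v) ⬝ᵥ w - (v ⬝ᵥ w) * e) := by
    have h3 := H.blockInv_sandwich
    simp only [pow_zero, one_mulVec, pow_one, zero_add] at g10
    rw [g10] at h3
    rw [← h3]
    simp only [dotProduct, cornerPow_two, add_mul, mul_assoc, H.ew, Finset.sum_add_distrib, mul_add,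
      Finset.sum_mul]
    simp only [← mul_assoc, H.ew]
    simp only [mul_assoc, mul_add, add_mul, Finset.sum_add_distrib, one_mul]
  simp only [pow_zero, one_mulVec, vecMul_one, pow_one, zero_add, add_zero, one_add_one_eq_two]
    at h00 h10 h01 g10 g20 g11
  rw [trace_blockMat_pow_eq]
  simp only [Finset.sum_range_succ, Finset.range_zero, Finset.sum_empty, pow_zero, one_mulVec,
    cornerPow_zero, cornerPow_one, pow_one, vecMul_one, Nat.add_one_sub_one, Nat.sub_zero,
    Nat.sub_self, zero_add, add_zero, one_mul, Nat.reduceSub]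
  rw [h2, h10, h01, g11, g20, two_mul, show (3 : A) = 1 + 1 + 1 by norm_num]
  simp only [add_mul, one_mul]
  abel

end Block

end GelfandTsetlin
end

noncomputable section
namespace GelfandTsetlin

/-! ### The eigenvalues of the Casimir elements -/

section Gamma

open Polynomial

set_option linter.unusedSectionVars false

theorem coeff_modByMonic_eq_zero {D : ℂ[X]} (hD : D.Monic) (F : ℂ[X]) {j : ℕ}
    (hj : D.natDegree ≤ j) : (F %ₘ D).coeff j = 0 := by
  refine coeff_eq_zero_of_degree_lt ((degree_modByMonic_lt F hD).trans_le ?_)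
  rw [degree_eq_natDegree hD.ne_zero]
  exact_mod_cast hj

/-- The product of a linear factor with the remainder can reach degree `D.natDegree`; one more
division step removes that term, and the constant that appears is minus a value of γ. -/
theorem X_add_C_mul_divByMonic {D : ℂ[X]} (hD : D.Monic) (F : ℂ[X]) (c : ℂ) :
    ((X + C c) * F) /ₘ D = (X + C c) * (F /ₘ D) + C ((F %ₘ D).coeff (D.natDegree - 1)) := by
  have h0 : ∀ j, D.natDegree ≤ j → (F %ₘ D).coeff j = 0 :=
    fun j hj => coeff_modByMonic_eq_zero hD F hj
  refine (div_modByMonic_unique (q := (X + C c) * (F /ₘ D) +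
      C ((F %ₘ D).coeff (D.natDegree - 1)))
    (r := (X + C c) * (F %ₘ D) - C ((F %ₘ D).coeff (D.natDegree - 1)) * D) hD ⟨?_, ?_⟩).1
  · conv_rhs => rw [← modByMonic_add_div F D]
    ring
  · rw [degree_eq_natDegree hD.ne_zero, degree_lt_iff_coeff_zero]
    intro j hj
    rw [coeff_sub, add_mul, coeff_add, coeff_C_mul, coeff_C_mul, h0 j hj]
    rcases Nat.eq_zero_or_pos j with rfl | hj0
    · have : D.natDegree = 0 := by omega
      simp [this, h0 0 hj]
    · obtain ⟨j, rfl⟩ := Nat.exists_eq_succ_of_ne_zero hj0.ne'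
      rw [coeff_X_mul]
      rcases Nat.eq_or_lt_of_le hj with h | h
      · have h2 : D.coeff (j + 1) = 1 := by
          have := hD.coeff_natDegree
          rwa [h] at this
        rw [h2, h]; simp
      · rw [h0 j (by omega), coeff_eq_zero_of_natDegree_lt h]; simp

/-- This is the effect on γ of adding an entry `u` to a row: the change is the value at `u` of the
old quotient. -/
theorem mul_X_sub_modByMonic {D : ℂ[X]} (hD : D.Monic) (F : ℂ[X]) (u : ℂ) :
    ((F * (X - C u - 1)) %ₘ (D * (X - C u))).coeff D.natDegree =
      (F %ₘ D).coeff (D.natDegree - 1) - (F /ₘ D).eval u := by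
  have h0 : ∀ j, D.natDegree ≤ j → (F %ₘ D).coeff j = 0 :=
    fun j hj => coeff_modByMonic_eq_zero hD F hj
  obtain ⟨Q', hQ'⟩ := (dvd_iff_isRoot (p := F /ₘ D - C ((F /ₘ D).eval u)) (a := u)).2 (by
    simp)
  have hdeg : (D * (X - C u)).natDegree = D.natDegree + 1 := by
    rw [natDegree_mul hD.ne_zero (X_sub_C_ne_zero u), natDegree_X_sub_C]
  have hco : ∀ j, D.natDegree ≤ j → ((F %ₘ D) * (X - C u)).coeff j =
      if j = D.natDegree then (F %ₘ D).coeff (D.natDegree - 1) else 0 := by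
    intro j hj
    rw [mul_sub, coeff_sub, coeff_mul_C, h0 j hj]
    rcases Nat.eq_zero_or_pos j with rfl | hj0
    · have : D.natDegree = 0 := by omega
      simp [this, h0 0 hj]
    · obtain ⟨j, rfl⟩ := Nat.exists_eq_succ_of_ne_zero hj0.ne'
      rw [coeff_mul_X]
      split_ifs with h
      · rw [← h]; simp
      · rw [h0 j (by omega)]; simp
  have h1 := (div_modByMonic_unique (f := F * (X - C u - 1)) (g := D * (X - C u))
    (q := (F /ₘ D) - Q')
    (r := (F %ₘ D) * (X - C u) - (F %ₘ D) - C ((F /ₘ D).eval u) * D)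
    (hD.mul (monic_X_sub_C u)) ⟨?_, ?_⟩).2
  · rw [h1, coeff_sub, coeff_sub, hco _ le_rfl, if_pos rfl, h0 _ le_rfl, coeff_C_mul,
      hD.coeff_natDegree]
    ring
  · have h2 := modByMonic_add_div F D
    linear_combination (X - C u - 1) * h2 + D * hQ'
  · rw [degree_eq_natDegree (hD.mul (monic_X_sub_C u)).ne_zero, hdeg, degree_lt_iff_coeff_zero]
    intro j hj
    rw [coeff_sub, coeff_sub, hco _ (by omega), if_neg (by omega), h0 _ (by omega), coeff_C_mul,
      coeff_eq_zero_of_natDegree_lt (by omega)]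
    simp

variable {ι : Type*} [DecidableEq ι]

/-- The polynomial `γ` of a row `s` of a tableau, with the shift `c`. -/
def gammaVal (s : Finset ι) (L : ι → ℂ) (c : ℂ) (r : ℕ) : ℂ :=
  -((((X + C c) ^ r * ∏ q ∈ s, (X - C (L q) - 1)) %ₘ ∏ q ∈ s, (X - C (L q))).coeff (s.card - 1))

theorem eval_gammaPoly (n m k : ℕ) (L : Tableau n) :
    MvPolynomial.eval L (gammaPoly n m k) = gammaVal (rowSet n m) L ((m : ℂ) - 1) k := by
  rw [gammaPoly, map_neg, ← Polynomial.coeff_map, Polynomial.map_modByMonic, gammaVal]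
  · congr 3
    · simp [Polynomial.map_prod]
    · simp [Polynomial.map_prod]
  · exact Polynomial.monic_prod_of_monic _ _ fun q _ => Polynomial.monic_X_sub_C _

theorem monic_prod_X_sub_C' (s : Finset ι) (L : ι → ℂ) : (∏ q ∈ s, (X - C (L q))).Monic :=
  monic_prod_of_monic _ _ fun _ _ => monic_X_sub_C _

theorem natDegree_prod_X_sub_C' (s : Finset ι) (L : ι → ℂ) :
    (∏ q ∈ s, (X - C (L q))).natDegree = s.card := by
  rw [natDegree_prod_of_monic _ _ fun q _ => monic_X_sub_C _]; simp

theorem gammaVal_empty (L : ι → ℂ) (c : ℂ) (r : ℕ) : gammaVal ∅ L c r = 0 := by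
  simp [gammaVal]

theorem eval_quot_eq (s : Finset ι) (L : ι → ℂ) (c : ℂ) (u : ℂ) (r : ℕ) :
    ((((X + C c) ^ r * ∏ q ∈ s, (X - C (L q) - 1)) /ₘ ∏ q ∈ s, (X - C (L q))).eval u) =
      (u + c) ^ r - ∑ a ∈ Finset.range r, gammaVal s L c a * (u + c) ^ (r - 1 - a) := by
  set D := ∏ q ∈ s, (X - C (L q)) with hD
  have hDm : D.Monic := monic_prod_X_sub_C' s L
  induction r with
  | zero =>
    rw [pow_zero, one_mul]
    have : (∏ q ∈ s, (X - C (L q) - 1)) /ₘ D = 1 := by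
      have hm : (∏ q ∈ s, (X - C (L q) - 1)).Monic := by
        refine monic_prod_of_monic _ _ fun q _ => ?_
        rw [sub_sub, ← C_1, ← C_add]; exact monic_X_sub_C _
      have hdeg : (∏ q ∈ s, (X - C (L q) - 1)).natDegree = s.card := by
        have := natDegree_prod_X_sub_C' s (fun q => L q + 1)
        simpa only [C_add, C_1, ← sub_sub] using this
      refine (div_modByMonic_unique (q := 1) (r := ∏ q ∈ s, (X - C (L q) - 1) - D) hDm
        ⟨by ring, ?_⟩).1
      have h1 : (∏ q ∈ s, (X - C (L q) - 1)).degree = D.degree := by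
        rw [degree_eq_natDegree hm.ne_zero, degree_eq_natDegree hDm.ne_zero, hdeg,
          natDegree_prod_X_sub_C']
      rw [← h1]
      exact degree_sub_lt_left h1 hm.ne_zero (by rw [hm, hDm])
    rw [this]; simp
  | succ r ih =>
    rw [pow_succ' (X + C c), mul_assoc, X_add_C_mul_divByMonic hDm, eval_add, eval_mul, ih,
      Finset.sum_range_succ, natDegree_prod_X_sub_C']
    have h : ∀ a ∈ Finset.range r, gammaVal s L c a * (u + c) ^ (r + 1 - 1 - a) =
        (u + c) * (gammaVal s L c a * (u + c) ^ (r - 1 - a)) := by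
      intro a ha
      rw [show r + 1 - 1 - a = r - 1 - a + 1 by have := Finset.mem_range.1 ha; omega, pow_succ]
      ring
    rw [Finset.sum_congr rfl h, ← Finset.mul_sum, show r + 1 - 1 - r = 0 by omega, gammaVal]
    simp only [eval_add, eval_X, eval_C]
    ring

/-- Computes γ one entry at a time without denominators, so it also applies to the top row, whose
entries may coincide. -/
theorem gammaVal_insert {s : Finset ι} {q : ι} (hq : q ∉ s) (L : ι → ℂ) (c : ℂ) (r : ℕ) :
    gammaVal (insert q s) L c r = gammaVal s L c r + (L q + c) ^ r -
      ∑ a ∈ Finset.range r, gammaVal s L c a * (L q + c) ^ (r - 1 - a) := by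
  have h := mul_X_sub_modByMonic (monic_prod_X_sub_C' s L)
    ((X + C c) ^ r * ∏ q ∈ s, (X - C (L q) - 1)) (L q)
  rw [eval_quot_eq, natDegree_prod_X_sub_C'] at h
  rw [gammaVal, Finset.card_insert_of_notMem hq, Finset.prod_insert hq, Finset.prod_insert hq,
    mul_comm (X - C (L q)), mul_comm (X - C (L q) - 1), ← mul_assoc, Nat.add_sub_cancel, h, gammaVal]
  ring

/-- The relations between the `γ` of two neighbouring rows that correspond to the recursion of the
traces of powers. -/
def GammaRecursion (g g' : ℕ → ℂ) (k e : ℂ) (α : ℕ → ℂ) : Prop :=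
  g' 1 = e + g 1 ∧
  g' 2 = e * e + α 0 + g 2 + (α 0 + g 1 - k * e) ∧
  g' 3 = e * (e * e + α 0) + (α 0 * e + α 1) + g 3 + 2 * (α 1 + g 2 - e * g 1 - k * α 0) +
    (α 0 + g 1 - k * e) * (e + 1) ∧
  g' 4 = e * (e * (e * e + α 0) + (α 0 * e + α 1)) + (α 0 * (e * e + α 0) + α 1 * e + α 2) +
    g 4 + 3 * (α 2 + g 3 - e * g 2 - (k * α 1 + g 1 * α 0)) +
    2 * ((α 1 + g 2 - e * g 1 - k * α 0) * (e + 1)) +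
    ((α 0 + g 1 - k * e) * (e + 1) * (e + 1) + ((α 0 + g 1 - k * e) * α 0 +
      (α 1 + g 2 - e * g 1 - k * α 0) - (α 0 + g 1 - k * e) * e))

/-- The numbers `∑ x_i μ_i^r` of a row `s` below a row `t`, where `-x_i` are the residues of
`∏_t (u - y) / ∏_s (u - l)`. -/
def rowMoment (s t : Finset ι) (L : ι → ℂ) (c : ℂ) (r : ℕ) : ℂ :=
  ∑ i ∈ s, -((∏ y ∈ t, (L i - L y)) / ∏ j ∈ s.erase i, (L i - L j)) * (L i + c) ^ r

theorem prod_four (x p q r s : ℂ) : (x - p) * ((x - q) * ((x - r) * (x - s))) =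
    x ^ 4 - (p + q + r + s) * x ^ 3 + (p * q + p * r + p * s + q * r + q * s + r * s) * x ^ 2 -
      (p * q * r + p * q * s + p * r * s + q * r * s) * x + p * q * r * s := by
  ring

theorem prod_three (x p q r : ℂ) : (x - p) * ((x - q) * (x - r)) =
    x ^ 3 - (p + q + r) * x ^ 2 + (p * q + p * r + q * r) * x - p * q * r := by
  ring

/-- Here $h_j$ is the complete symmetric polynomial of the poles and $E_j$ the elementary symmetric
polynomial of the zeros: the moments of the residues are polynomials in both. This removes all
denominators from the recursion for γ. -/
theorem moments_three {a b c E₁ E₂ E₃ E₄ : ℂ} {f : ℂ → ℂ}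
    (hf : ∀ x, f x = x ^ 4 - E₁ * x ^ 3 + E₂ * x ^ 2 - E₃ * x + E₄)
    (hab : a - b ≠ 0) (hac : a - c ≠ 0) (hbc : b - c ≠ 0) {h₁ h₂ h₃ h₄ : ℂ}
    (hh₁ : h₁ = a + b + c) (hh₂ : h₂ = a * h₁ + b ^ 2 + b * c + c ^ 2)
    (hh₃ : h₃ = a * h₂ + b ^ 3 + b ^ 2 * c + b * c ^ 2 + c ^ 3)
    (hh₄ : h₄ = a * h₃ + b ^ 4 + b ^ 3 * c + b ^ 2 * c ^ 2 + b * c ^ 3 + c ^ 4) {α : ℕ → ℂ}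
    (hα : ∀ m, α m = -(f a / ((a - b) * (a - c))) * a ^ m +
      (-(f b / ((b - a) * (b - c))) * b ^ m + -(f c / ((c - a) * (c - b))) * c ^ m)) :
    α 0 = -(h₂ - E₁ * h₁ + E₂) ∧ α 1 = -(h₃ - E₁ * h₂ + E₂ * h₁ - E₃) ∧
      α 2 = -(h₄ - E₁ * h₃ + E₂ * h₂ - E₃ * h₁ + E₄) := by
  have hne : (a - b) * (a - c) * (b - c) ≠ 0 := mul_ne_zero (mul_ne_zero hab hac) hbc
  have key : ∀ m, α m = -(f a * a ^ m * (b - c) - f b * b ^ m * (a - c) + f c * c ^ m * (a - b)) /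
        ((a - b) * (a - c) * (b - c)) := by
    intro m
    rw [hα, ← neg_sub a b, ← neg_sub a c, ← neg_sub b c]
    field_simp
    ring
  subst hh₄; subst hh₃; subst hh₂; subst hh₁
  simp only [key, hf]
  refine ⟨?_, ?_, ?_⟩ <;> rw [div_eq_iff hne] <;> ring

theorem moments_two {a b E₁ E₂ E₃ : ℂ} {f : ℂ → ℂ}
    (hf : ∀ x, f x = x ^ 3 - E₁ * x ^ 2 + E₂ * x - E₃) (hab : a - b ≠ 0) {h₁ h₂ h₃ h₄ : ℂ}
    (hh₁ : h₁ = a + b) (hh₂ : h₂ = a * h₁ + b ^ 2) (hh₃ : h₃ = a * h₂ + b ^ 3)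
    (hh₄ : h₄ = a * h₃ + b ^ 4) {α : ℕ → ℂ}
    (hα : ∀ m, α m = -(f a / (a - b)) * a ^ m + -(f b / (b - a)) * b ^ m) :
    α 0 = -(h₂ - E₁ * h₁ + E₂) ∧ α 1 = -(h₃ - E₁ * h₂ + E₂ * h₁ - E₃) ∧
      α 2 = -(h₄ - E₁ * h₃ + E₂ * h₂ - E₃ * h₁) := by
  have key : ∀ m, α m = -(f a * a ^ m - f b * b ^ m) / (a - b) := by
    intro m
    rw [hα, ← neg_sub a b]
    field_simp
    ring
  subst hh₄; subst hh₃; subst hh₂; subst hh₁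
  simp only [key, hf]
  refine ⟨?_, ?_, ?_⟩ <;> rw [div_eq_iff hab] <;> ring

theorem gammaVal_singleton (z : ι) (L : ι → ℂ) (c : ℂ) (m : ℕ) :
    gammaVal {z} L c m = (L z + c) ^ m := by
  rw [← insert_empty_eq, gammaVal_insert (by simp)]
  simp [gammaVal_empty]

/-- With the moments in polynomial form and γ expanded entry by entry, this is an identity of
polynomials in the seven shifted entries. -/
theorem gammaRecursion_three {s t : Finset ι} {L : ι → ℂ} (hL : Set.InjOn L s) (hs : s.card = 3)
    (ht : t.card = 4) :
    GammaRecursion (gammaVal s L (3 - 1)) (gammaVal t L 3) 3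
      (3 + ∑ y ∈ t, L y - ∑ i ∈ s, L i) (rowMoment s t L 3) := by
  obtain ⟨i, j, k, hij, hik, hjk, rfl⟩ := Finset.card_eq_three.1 hs
  obtain ⟨p', t', hp, rfl, ht'⟩ := Finset.card_eq_succ.1 ht
  obtain ⟨q', r', s', hqr, hqs, hrs, rfl⟩ := Finset.card_eq_three.1 ht'
  have hab : (L i + 3) - (L j + 3) ≠ 0 := by
    rw [add_sub_add_right_eq_sub]
    exact sub_ne_zero.2 fun h => hij (hL (by simp) (by simp) h)
  have hac : (L i + 3) - (L k + 3) ≠ 0 := by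
    rw [add_sub_add_right_eq_sub]
    exact sub_ne_zero.2 fun h => hik (hL (by simp) (by simp) h)
  have hbc : (L j + 3) - (L k + 3) ≠ 0 := by
    rw [add_sub_add_right_eq_sub]
    exact sub_ne_zero.2 fun h => hjk (hL (by simp) (by simp) h)
  have e1 : ({i, j, k} : Finset ι).erase i = {j, k} := by ext x; simp; grind
  have e2 : ({i, j, k} : Finset ι).erase j = {i, k} := by ext x; simp; grind
  have e3 : ({i, j, k} : Finset ι).erase k = {i, j} := by ext x; simp; grind
  have n1 : i ∉ ({j, k} : Finset ι) := by simp [hij, hik]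
  have n2 : j ∉ ({k} : Finset ι) := by simp [hjk]
  have n3 : q' ∉ ({r', s'} : Finset ι) := by simp [hqr, hqs]
  have n4 : r' ∉ ({s'} : Finset ι) := by simp [hrs]
  obtain ⟨h0, h1, h2⟩ := moments_three (α := rowMoment {i, j, k} (insert p' {q', r', s'}) L 3)
    (fun x => prod_four x (L p' + 3) (L q' + 3) (L r' + 3)
    (L s' + 3)) hab hac hbc rfl rfl rfl rfl (by
      intro m
      rw [rowMoment, Finset.sum_insert n1, Finset.sum_pair hjk, e1, e2, e3,
        Finset.prod_pair hjk, Finset.prod_pair hik, Finset.prod_pair hij]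
      simp only [Finset.prod_insert hp, Finset.prod_insert n3, Finset.prod_pair hrs,
        add_sub_add_right_eq_sub])
  have hsum : (3 : ℂ) + ∑ y ∈ insert p' {q', r', s'}, L y - ∑ y ∈ {i, j, k}, L y =
      (L p' + 3) + (L q' + 3) + (L r' + 3) + (L s' + 3) - (L i + 3) - (L j + 3) - (L k + 3) := by
    rw [Finset.sum_insert hp, Finset.sum_insert n3, Finset.sum_pair hrs, Finset.sum_insert n1,
      Finset.sum_pair hjk]
    ring
  rw [hsum]
  unfold GammaRecursion
  rw [h0, h1, h2]
  -- The two rows use shifts that differ by one; both are expressed through `L z + 3`.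
  have hsh : ∀ z : ι, L z + ((3 : ℂ) - 1) = L z + 3 - 1 := fun z => by ring
  simp only [gammaVal_insert hp, gammaVal_insert n3, gammaVal_insert n4, gammaVal_insert n1,
    gammaVal_insert n2, gammaVal_singleton, Finset.sum_range_succ, Finset.range_zero,
    Finset.sum_empty, hsh]
  generalize L p' + 3 = p
  generalize L q' + 3 = q
  generalize L r' + 3 = r
  generalize L s' + 3 = s
  generalize L i + 3 = a
  generalize L j + 3 = b
  generalize L k + 3 = c
  refine ⟨?_, ?_, ?_, ?_⟩ <;> norm_num <;> ring

theorem gammaRecursion_two {s t : Finset ι} {L : ι → ℂ} (hL : Set.InjOn L s) (hs : s.card = 2)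
    (ht : t.card = 3) :
    GammaRecursion (gammaVal s L (2 - 1)) (gammaVal t L 2) 2
      (2 + ∑ y ∈ t, L y - ∑ i ∈ s, L i) (rowMoment s t L 2) := by
  obtain ⟨i, j, hij, rfl⟩ := Finset.card_eq_two.1 hs
  obtain ⟨q', r', s', hqr, hqs, hrs, rfl⟩ := Finset.card_eq_three.1 ht
  have hab : (L i + 2) - (L j + 2) ≠ 0 := by
    rw [add_sub_add_right_eq_sub]
    exact sub_ne_zero.2 fun h => hij (hL (by simp) (by simp) h)
  have e1 : ({i, j} : Finset ι).erase i = {j} := by ext x; simp; grind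
  have e2 : ({i, j} : Finset ι).erase j = {i} := by ext x; simp; grind
  have n1 : i ∉ ({j} : Finset ι) := by simp [hij]
  have n3 : q' ∉ ({r', s'} : Finset ι) := by simp [hqr, hqs]
  have n4 : r' ∉ ({s'} : Finset ι) := by simp [hrs]
  obtain ⟨h0, h1, h2⟩ := moments_two (α := rowMoment {i, j} {q', r', s'} L 2)
    (fun x => prod_three x (L q' + 2) (L r' + 2) (L s' + 2)) hab rfl rfl rfl rfl (by
      intro m
      rw [rowMoment, Finset.sum_pair hij, e1, e2]
      simp only [Finset.prod_insert n3, Finset.prod_pair hrs, Finset.prod_singleton,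
        add_sub_add_right_eq_sub])
  have hsum : (2 : ℂ) + ∑ y ∈ {q', r', s'}, L y - ∑ y ∈ {i, j}, L y =
      (L q' + 2) + (L r' + 2) + (L s' + 2) - (L i + 2) - (L j + 2) := by
    rw [Finset.sum_insert n3, Finset.sum_pair hrs, Finset.sum_pair hij]
    ring
  rw [hsum]
  unfold GammaRecursion
  rw [h0, h1, h2]
  have hsh : ∀ z : ι, L z + ((2 : ℂ) - 1) = L z + 2 - 1 := fun z => by ring
  simp only [gammaVal_insert n3, gammaVal_insert n4, gammaVal_insert n1,
    gammaVal_singleton, Finset.sum_range_succ, Finset.range_zero, Finset.sum_empty, hsh]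
  generalize L q' + 2 = q
  generalize L r' + 2 = r
  generalize L s' + 2 = s
  generalize L i + 2 = a
  generalize L j + 2 = b
  refine ⟨?_, ?_, ?_, ?_⟩ <;> norm_num <;> ring

theorem gammaRecursion_one {s t : Finset ι} {L : ι → ℂ} (hs : s.card = 1)
    (ht : t.card = 2) :
    GammaRecursion (gammaVal s L (1 - 1)) (gammaVal t L 1) 1
      (1 + ∑ y ∈ t, L y - ∑ i ∈ s, L i) (rowMoment s t L 1) := by
  obtain ⟨i, rfl⟩ := Finset.card_eq_one.1 hs
  obtain ⟨r', s', hrs, rfl⟩ := Finset.card_eq_two.1 ht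
  have n4 : r' ∉ ({s'} : Finset ι) := by simp [hrs]
  have hα : ∀ m, rowMoment {i} {r', s'} L 1 m =
      -((L i + 1 - (L r' + 1)) * (L i + 1 - (L s' + 1))) * (L i + 1) ^ m := by
    intro m
    simp [rowMoment, Finset.prod_pair hrs]
  have hsum : (1 : ℂ) + ∑ y ∈ {r', s'}, L y - ∑ y ∈ {i}, L y =
      (L r' + 1) + (L s' + 1) - (L i + 1) := by
    rw [Finset.sum_pair hrs, Finset.sum_singleton]
    ring
  rw [hsum]
  unfold GammaRecursion
  rw [hα, hα, hα]
  have hsh : ∀ z : ι, L z + ((1 : ℂ) - 1) = L z + 1 - 1 := fun z => by ring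
  simp only [gammaVal_insert n4, gammaVal_singleton, Finset.sum_range_succ, Finset.range_zero,
    Finset.sum_empty, hsh]
  generalize L r' + 1 = r
  generalize L s' + 1 = s
  generalize L i + 1 = a
  refine ⟨?_, ?_, ?_, ?_⟩ <;> norm_num <;> ring

theorem gammaRecursion_zero {t : Finset ι} {L : ι → ℂ} (c : ℂ) (ht : t.card = 1) :
    GammaRecursion (gammaVal ∅ L c) (gammaVal t L 0) 0
      (0 + ∑ y ∈ t, L y - ∑ i ∈ ∅, L i) (rowMoment ∅ t L 0) := by
  obtain ⟨s', rfl⟩ := Finset.card_eq_one.1 ht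
  simp only [GammaRecursion, rowMoment, gammaVal_singleton, gammaVal_empty, Finset.sum_empty,
    Finset.sum_singleton]
  refine ⟨?_, ?_, ?_, ?_⟩ <;> ring

/-- The `γ` of two neighbouring rows with at most `3` and `4` entries. -/
theorem gammaRecursion_gammaVal {s t : Finset ι} {L : ι → ℂ} (hL : Set.InjOn L s) {k : ℕ}
    (hk : k ≤ 3) (hs : s.card = k) (ht : t.card = k + 1) :
    GammaRecursion (gammaVal s L ((k : ℂ) - 1)) (gammaVal t L k) k
      (k + ∑ y ∈ t, L y - ∑ i ∈ s, L i) (rowMoment s t L k) := by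
  interval_cases k
  · rw [Finset.card_eq_zero.1 hs]
    exact_mod_cast gammaRecursion_zero _ ht
  · exact_mod_cast gammaRecursion_one hs ht
  · exact_mod_cast gammaRecursion_two hL hs ht
  · exact_mod_cast gammaRecursion_three hL hs ht

end Gamma

end GelfandTsetlin
end

/-! ### Eigenvalues of the corner entries of powers of the generator matrix -/

noncomputable section
namespace GelfandTsetlin

section Corner

variable {ι : Type*} [DecidableEq ι]

/-- The partial fraction expansion without denominators in `u`, so that `u` may be one of the poles.
It is applied at entries of the row above, which may equal entries of `s`. -/
theorem partialFractions_cleared {s t : Finset ι} {l : ι → ℂ} (hl : Set.InjOn l s)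
    (h : t.card = s.card + 1) (u : ℂ) :
    ∏ j ∈ t, (u - l j) = (u + ∑ i ∈ s, l i - ∑ j ∈ t, l j) * ∏ i ∈ s, (u - l i) +
      ∑ i ∈ s, (∏ j ∈ t, (l i - l j)) / (∏ j ∈ s.erase i, (l i - l j)) *
        ∏ j ∈ s.erase i, (u - l j) := by
  by_cases hu : ∀ i ∈ s, u ≠ l i
  · have h1 := partialFractions_succ s t l l hl h u hu
    have h2 : ∏ i ∈ s, (u - l i) ≠ 0 := prod_sub_ne_zero hu
    rw [eq_div_iff h2] at h1
    rw [← h1, add_mul, Finset.sum_mul]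
    congr 1
    refine Finset.sum_congr rfl fun i hi => ?_
    rw [← Finset.mul_prod_erase s _ hi, div_mul_eq_mul_div, ← mul_assoc,
      mul_right_comm, mul_div_assoc, div_self (sub_ne_zero.2 (hu i hi)), mul_one]
  · push Not at hu
    obtain ⟨a, ha, rfl⟩ := hu
    rw [Finset.prod_eq_zero ha (sub_self _), mul_zero, zero_add, Finset.sum_eq_single a]
    · rw [div_mul_cancel₀ _ (prod_erase_sub_ne_zero hl ha)]
    · intro b hb hba
      rw [Finset.prod_eq_zero (f := fun j => l a - l j) (Finset.mem_erase.2 ⟨hba.symm, ha⟩)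
        (sub_self _), mul_zero]
    · exact fun h => absurd ha h

/-- The moments `∑ ρ_j (l_j + c)^r` of the row `t` above the row `s`. -/
def cornerMoment (s t : Finset ι) (L : ι → ℂ) (c : ℂ) (r : ℕ) : ℂ :=
  ∑ j ∈ t, (∏ x ∈ s, (L j - L x)) / (∏ i ∈ t.erase j, (L j - L i)) * (L j + c) ^ r

theorem cornerMoment_zero {s t : Finset ι} {L : ι → ℂ} (hL : Set.InjOn L t)
    (h : t.card = s.card + 1) (c : ℂ) : cornerMoment s t L c 0 = 1 := by
  have h1 := sum_residues_one (t.image L) s L (by rw [Finset.card_image_of_injOn hL, h])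
  rw [sum_image_residues t L hL fun r => ∏ j ∈ s, (r - L j)] at h1
  simpa [cornerMoment] using h1

theorem sum_residues_erase_eq_zero {s t : Finset ι} {L : ι → ℂ} (hL : Set.InjOn L t)
    (h : t.card = s.card + 1) {i : ι} (hi : i ∈ s) :
    ∑ j ∈ t, (∏ x ∈ s.erase i, (L j - L x)) / ∏ i ∈ t.erase j, (L j - L i) = 0 := by
  have h1 := sum_residues_zero (t.image L) (s.erase i) L (by
    rw [Finset.card_image_of_injOn hL, h, Finset.card_erase_of_mem hi]
    have := Finset.card_pos.2 ⟨i, hi⟩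
    omega)
  rwa [sum_image_residues t L hL fun r => ∏ j ∈ s.erase i, (r - L j)] at h1

/-- The scalar counterpart of `cornerPow_succ`; it identifies the eigenvalues of the corner entries.
-/
theorem cornerMoment_succ {s t : Finset ι} {L : ι → ℂ} (hL : Set.InjOn L t)
    (hs : Set.InjOn L s) (h : t.card = s.card + 1) (c : ℂ) (r : ℕ) :
    cornerMoment s t L c (r + 1) = (c + ∑ y ∈ t, L y - ∑ x ∈ s, L x) * cornerMoment s t L c r +
      ∑ a ∈ Finset.range r, rowMoment s t L c a * cornerMoment s t L c (r - 1 - a) := by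
  have h1 : ∀ j ∈ t, ∑ i ∈ s, (∏ y ∈ t, (L i - L y)) / (∏ j ∈ s.erase i, (L i - L j)) *
      ∏ x ∈ s.erase i, (L j - L x) =
        -((L j + ∑ x ∈ s, L x - ∑ y ∈ t, L y) * ∏ x ∈ s, (L j - L x)) := by
    intro j hj
    have := partialFractions_cleared hs h (L j)
    rw [Finset.prod_eq_zero hj (sub_self _)] at this
    linear_combination -this
  -- The geometric sum telescopes against the factor `L j - L i` of the numerator.
  have h2 : ∀ i ∈ s, ∀ j, (∏ x ∈ s, (L j - L x)) *
      ∑ a ∈ Finset.range r, (L i + c) ^ a * (L j + c) ^ (r - 1 - a) =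
        (∏ x ∈ s.erase i, (L j - L x)) * ((L j + c) ^ r - (L i + c) ^ r) := by
    intro i hi j
    have := (Commute.all (L i + c) (L j + c)).geom_sum₂_mul r
    rw [← Finset.mul_prod_erase s _ hi]
    linear_combination -(∏ x ∈ s.erase i, (L j - L x)) * this
  have h3 : ∑ a ∈ Finset.range r, rowMoment s t L c a * cornerMoment s t L c (r - 1 - a) =
      ∑ j ∈ t, ∑ i ∈ s, -((∏ y ∈ t, (L i - L y)) / ∏ j ∈ s.erase i, (L i - L j)) *
        ((∏ x ∈ s.erase i, (L j - L x)) * ((L j + c) ^ r - (L i + c) ^ r)) /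
          ∏ i ∈ t.erase j, (L j - L i) := by
    simp only [rowMoment, cornerMoment, Finset.sum_mul_sum]
    rw [Finset.sum_comm]
    rw [Finset.sum_comm (s := t)]
    refine Finset.sum_congr rfl fun i hi => ?_
    rw [Finset.sum_comm]
    refine Finset.sum_congr rfl fun j _ => ?_
    rw [← h2 i hi j, Finset.mul_sum, Finset.mul_sum, Finset.sum_div]
    refine Finset.sum_congr rfl fun a _ => ?_
    ring
  -- For fixed `i` this is a sum of residues whose numerator has degree two less than the number of
  -- poles.
  have h4 : ∑ j ∈ t, ∑ i ∈ s, -((∏ y ∈ t, (L i - L y)) / ∏ j ∈ s.erase i, (L i - L j)) *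
        ((∏ x ∈ s.erase i, (L j - L x)) * (L i + c) ^ r) / ∏ i ∈ t.erase j, (L j - L i) = 0 := by
    rw [Finset.sum_comm]
    refine Finset.sum_eq_zero fun i hi => ?_
    have := sum_residues_erase_eq_zero hL h hi
    rw [← mul_zero (-((∏ y ∈ t, (L i - L y)) / ∏ j ∈ s.erase i, (L i - L j)) * (L i + c) ^ r),
      ← this, Finset.mul_sum]
    refine Finset.sum_congr rfl fun j _ => ?_
    ring
  have h5 : ∀ j ∈ t, ∑ i ∈ s, -((∏ y ∈ t, (L i - L y)) / ∏ j ∈ s.erase i, (L i - L j)) *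
        ((∏ x ∈ s.erase i, (L j - L x)) * (L j + c) ^ r) / ∏ i ∈ t.erase j, (L j - L i) =
        (∏ x ∈ s, (L j - L x)) / (∏ i ∈ t.erase j, (L j - L i)) *
          ((L j + ∑ x ∈ s, L x - ∑ y ∈ t, L y) * (L j + c) ^ r) := by
    intro j hj
    have := h1 j hj
    calc _ = -(∑ i ∈ s, (∏ y ∈ t, (L i - L y)) / (∏ j ∈ s.erase i, (L i - L j)) *
          ∏ x ∈ s.erase i, (L j - L x)) * (L j + c) ^ r / ∏ i ∈ t.erase j, (L j - L i) := by
          rw [← Finset.sum_neg_distrib, Finset.sum_mul, Finset.sum_div]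
          refine Finset.sum_congr rfl fun i _ => ?_
          ring
      _ = _ := by rw [this]; ring
  rw [h3]
  simp only [mul_sub, sub_div, Finset.sum_sub_distrib]
  rw [h4, Finset.sum_congr rfl h5, sub_zero, cornerMoment, cornerMoment, Finset.mul_sum,
    ← Finset.sum_add_distrib]
  refine Finset.sum_congr rfl fun j _ => ?_
  rw [pow_succ]
  ring

end Corner

end GelfandTsetlin
end

noncomputable section
namespace GelfandTsetlin

/-! ### The matrices of generators of a module -/

section Ops

open Matrix

set_option linter.unusedSectionVars false

/-- The indices below `k`. -/
abbrev Idx (n k : ℕ) : Type := {i : Fin n // i.val < k}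

variable {n : ℕ} {W : Type*} [AddCommGroup W] [Module ℂ W] (ρ : Gl n →ₗ⁅ℂ⁆ Module.End ℂ W)

/-- The matrix of the generators of `gl_k`, acting on a module. -/
def opMat (k : ℕ) : Matrix (Idx n k) (Idx n k) (Module.End ℂ W) :=
  of fun i j => ρ (E i.1 j.1)

/-- The operators `E_{iκ}`, `i < κ`. -/
def colOp (κ : Fin n) : Idx n κ.val → Module.End ℂ W := fun i => ρ (E i.1 κ)

/-- The operators `E_{κj}`, `j < κ`. -/
def rowOp (κ : Fin n) : Idx n κ.val → Module.End ℂ W := fun j => ρ (E κ j.1)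

theorem op_mul (i j k l : Fin n) : ρ (E i j) * ρ (E k l) = ρ (E k l) * ρ (E i j) +
    ((if j = k then ρ (E i l) else 0) - if l = i then ρ (E k j) else 0) := by
  have h : ⁅ρ (E i j), ρ (E k l)⁆ = _ := (ρ.map_lie (E i j) (E k l)).symm
  rw [E_lie_E, LieRing.of_associative_ring_bracket, sub_eq_iff_eq_add] at h
  rw [h, add_comm]
  congr 1
  rw [map_sub]
  split_ifs <;> simp

theorem blockRelations_op (κ : Fin n) :
    BlockRelations (opMat ρ κ.val) (colOp ρ κ) (rowOp ρ κ) (ρ (E κ κ)) where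
  EE i j k l := by
    simp only [opMat, of_apply, op_mul ρ i.1 j.1, Subtype.ext_iff, add_sub_assoc]
  Ev i j l := by
    have h : κ ≠ i.1 := fun h => by have := i.2; simp [← h] at this
    simp only [opMat, colOp, of_apply, op_mul ρ i.1 j.1, Subtype.ext_iff, if_neg h, sub_zero]
  Ew i j l := by
    have h : j.1 ≠ κ := fun h => by have := j.2; simp [h] at this
    simp only [opMat, rowOp, of_apply, op_mul ρ i.1 j.1, Subtype.ext_iff, if_neg h,
      sub_eq_add_neg, eq_comm (a := l.1)]
    split_ifs <;> simp
  vw i j := by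
    simp only [opMat, rowOp, colOp, of_apply, op_mul ρ i.1 κ, Subtype.ext_iff, if_true,
      eq_comm (a := j.1), add_sub_assoc]
  ww i j := by
    have h : i.1 ≠ κ := fun h => by have := i.2; simp [h] at this
    have h' : j.1 ≠ κ := fun h => by have := j.2; simp [h] at this
    simp only [rowOp, op_mul ρ κ i.1, if_neg h, if_neg h', sub_self, add_zero]
  eE i j := by
    have h : κ ≠ i.1 := fun h => by have := i.2; simp [← h] at this
    have h' : j.1 ≠ κ := fun h => by have := j.2; simp [h] at this
    simp only [opMat, of_apply, op_mul ρ κ κ, if_neg h, if_neg h', sub_self, add_zero]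
  ew i := by
    have h' : i.1 ≠ κ := fun h => by have := i.2; simp [h] at this
    simp only [rowOp, op_mul ρ κ κ, if_neg h', if_true, sub_zero, mul_add, mul_one]

/-- Splitting off the last index. -/
def idxEquiv (κ : Fin n) : Idx n κ.val ⊕ Unit ≃ Idx n (κ.val + 1) where
  toFun := Sum.elim (fun i => ⟨i.1, by have := i.2; omega⟩) fun _ => ⟨κ, by omega⟩
  invFun i := if h : i.1.val < κ.val then Sum.inl ⟨i.1, h⟩ else Sum.inr ()
  left_inv i := by
    rcases i with i | i
    · simp [i.2]
    · simp
  right_inv i := by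
    by_cases h : i.1.val < κ.val
    · simp [h]
    · simp only [h, dif_neg, not_false_eq_true, Sum.elim_inr]
      exact Subtype.ext (Fin.ext (by have := i.2; simp; omega))

theorem opMat_submatrix (κ : Fin n) :
    (opMat ρ (κ.val + 1)).submatrix (idxEquiv κ) (idxEquiv κ) =
      blockMat (opMat ρ κ.val) (colOp ρ κ) (rowOp ρ κ) (ρ (E κ κ)) := by
  ext i j : 1
  rcases i with i | i <;> rcases j with j | j <;> rfl

theorem opMat_pow_submatrix (κ : Fin n) (r : ℕ) :
    (opMat ρ (κ.val + 1) ^ r).submatrix (idxEquiv κ) (idxEquiv κ) =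
      blockMat (opMat ρ κ.val) (colOp ρ κ) (rowOp ρ κ) (ρ (E κ κ)) ^ r := by
  induction r with
  | zero => simp
  | succ r ih => rw [pow_succ, pow_succ, ← ih, ← opMat_submatrix, submatrix_mul_equiv]

theorem trace_opMat_pow (κ : Fin n) (r : ℕ) : trace (opMat ρ (κ.val + 1) ^ r) =
    trace (blockMat (opMat ρ κ.val) (colOp ρ κ) (rowOp ρ κ) (ρ (E κ κ)) ^ r) := by
  rw [← opMat_pow_submatrix, trace, trace]
  exact (Equiv.sum_comp (idxEquiv κ) _).symm

theorem opMat_pow_last (κ : Fin n) (r : ℕ) :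
    (opMat ρ (κ.val + 1) ^ r) ⟨κ, Nat.lt_succ_self _⟩ ⟨κ, Nat.lt_succ_self _⟩ =
      cornerPow (opMat ρ κ.val) (colOp ρ κ) (rowOp ρ κ) (ρ (E κ κ)) r := by
  rw [cornerPow, ← opMat_pow_submatrix]
  rfl

theorem actU_casimir (V : Type*) [AddCommGroup V] [Module ℂ V] [LieRingModule (Gl n) V]
    [LieModule ℂ (Gl n) V] (m k : ℕ) :
    actU n V (casimir n m k) = trace (opMat (LieModule.toEnd ℂ (Gl n) V) m ^ k) := by
  have h : (opMat (LieModule.toEnd ℂ (Gl n) V) m) = (actU n V).toRingHom.mapMatrix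
      (Matrix.of fun i j : {i : Fin n // i.val < m} =>
        (UniversalEnvelopingAlgebra.ι ℂ (E i.1 j.1) : U n)) := by
    ext i j : 1
    simp [opMat, actU]
  rw [h, ← map_pow, casimir, RingHom.mapMatrix_apply, trace, trace, map_sum]
  rfl

end Ops

end GelfandTsetlin
end

/-! ### Rows of a tableau and matrix coefficients in the tableau basis -/

noncomputable section
namespace GelfandTsetlin

section Rows

set_option linter.unusedSectionVars false

theorem mem_rowSet {n m : ℕ} {p : Pos n} : p ∈ rowSet n m ↔ p.row = m := by
  simp [rowSet]

theorem rowSet_zero (n : ℕ) : rowSet n 0 = ∅ := by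
  ext p; simp [mem_rowSet, Pos.row]

theorem Pos.row_le {n : ℕ} (p : Pos n) : p.row ≤ n := p.1.2

theorem Pos.row_pos {n : ℕ} (p : Pos n) : 1 ≤ p.row := Nat.succ_pos _

theorem card_rowSet {n m : ℕ} (h : m ≤ n) : (rowSet n m).card = m := by
  rcases Nat.eq_zero_or_pos m with rfl | hm
  · rw [rowSet_zero]; rfl
  · have : rowSet n m = Finset.univ.map (Function.Embedding.sigmaMk
        (β := fun i : Fin n => Fin (i.val + 1)) (⟨m - 1, by omega⟩ : Fin n)) := by
      ext ⟨i, j⟩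
      simp only [mem_rowSet, Pos.row, Finset.mem_map, Finset.mem_univ, true_and,
        Function.Embedding.sigmaMk_apply, Sigma.mk.injEq]
      constructor
      · intro h
        subst h
        exact ⟨j, Fin.ext (by simp), HEq.rfl⟩
      · rintro ⟨j, h, -⟩
        have := congrArg Fin.val h
        simp at this
        omega
    rw [this]
    simp
    omega

theorem Tableau.Noncritical.injOn {n : ℕ} {T : Tableau n} (h : T.Noncritical) {m : ℕ}
    (hm : m < n) : Set.InjOn T (rowSet n m) := by
  intro p hp q hq hpq
  rw [Finset.mem_coe, mem_rowSet] at hp hq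
  by_contra hne
  exact h p q (hp.trans hq.symm) (by omega) hne hpq

variable {ι : Type*} [DecidableEq ι]

theorem gammaVal_congr {s : Finset ι} {L L' : ι → ℂ} (h : ∀ i ∈ s, L i = L' i) (c : ℂ) (r : ℕ) :
    gammaVal s L c r = gammaVal s L' c r := by
  have h1 : ∏ q ∈ s, (Polynomial.X - Polynomial.C (L q) - 1) =
      ∏ q ∈ s, (Polynomial.X - Polynomial.C (L' q) - 1) :=
    Finset.prod_congr rfl fun q hq => by rw [h q hq]
  have h2 : ∏ q ∈ s, (Polynomial.X - Polynomial.C (L q)) =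
      ∏ q ∈ s, (Polynomial.X - Polynomial.C (L' q)) :=
    Finset.prod_congr rfl fun q hq => by rw [h q hq]
  rw [gammaVal, gammaVal, h1, h2]

theorem gammaVal_pow_zero (s : Finset ι) (L : ι → ℂ) (c : ℂ) : gammaVal s L c 0 = s.card := by
  induction s using Finset.induction_on with
  | empty => simp [gammaVal_empty]
  | insert q s hq ih =>
    rw [gammaVal_insert hq, ih, Finset.card_insert_of_notMem hq]; simp

/-- The change of the quadratic Casimir element when an entry is raised. -/
theorem gammaVal_two_raise {s : Finset ι} {i : ι} (hi : i ∈ s) {L L' : ι → ℂ}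
    (h : ∀ j ∈ s, L' j = L j + if j = i then 1 else 0) (c : ℂ) :
    gammaVal s L' c 2 - gammaVal s L c 2 = 2 * (L i + c) + 2 - s.card := by
  have h0 : i ∉ s.erase i := Finset.notMem_erase i s
  have hc : ∀ r, gammaVal (s.erase i) L' c r = gammaVal (s.erase i) L c r := fun r =>
    gammaVal_congr (fun j hj => by
      rw [h j (Finset.mem_of_mem_erase hj), if_neg (Finset.ne_of_mem_erase hj), add_zero]) c r
  have hcard : ((s.erase i).card : ℂ) = s.card - 1 := by
    rw [Finset.card_erase_of_mem hi, Nat.cast_sub (Finset.card_pos.2 ⟨i, hi⟩), Nat.cast_one]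
  have hi' : L' i = L i + 1 := by rw [h i hi, if_pos rfl]
  rw [← Finset.insert_erase hi, gammaVal_insert h0, gammaVal_insert h0]
  simp only [hc, Finset.sum_range_succ, Finset.range_zero, Finset.sum_empty, hi',
    gammaVal_pow_zero, hcard, Finset.insert_erase hi]
  norm_num
  ring

end Rows

section Coefficients

variable {n : ℕ} {B : Set (Tableau n)} {W : Type*} [AddCommGroup W] [Module ℂ W]
  (b : Module.Basis B ℂ W)

/-- The operators that are diagonal in the basis `b`. -/
def diagOp : (B → ℂ) →+* Module.End ℂ W where
  toFun f := b.constr ℂ fun T => f T • b T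
  map_one' := b.ext fun T => by simp
  map_mul' f g := b.ext fun T => by
    simp only [Module.Basis.constr_basis, Module.End.mul_apply, Pi.mul_apply, map_smul, smul_smul,
      mul_comm]
  map_zero' := b.ext fun T => by simp
  map_add' f g := b.ext fun T => by simp [add_smul]

theorem diagOp_basis (f : B → ℂ) (T : B) : diagOp b f (b T) = f T • b T := by
  change b.constr ℂ (fun T => f T • b T) (b T) = _
  simp

variable {b}

theorem eq_diagOp {u : Module.End ℂ W} {f : B → ℂ} (h : ∀ T, u (b T) = f T • b T) :
    u = diagOp b f :=
  b.ext fun T => by rw [h, diagOp_basis]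

theorem repr_diagOp (f : B → ℂ) (v : W) (R : B) :
    b.repr (diagOp b f v) R = f R * b.repr v R := by
  have : b.coord R ∘ₗ diagOp b f = f R • b.coord R := b.ext fun T => by
    by_cases h : T = R
    · subst h; simp [diagOp_basis]
    · simp [diagOp_basis, h]
  exact congrArg (fun φ => φ v) this

open Classical in
theorem repr_tableauVector (R' : Tableau n) (R : B) :
    b.repr (tableauVector b R') R = if R.1 = R' then 1 else 0 := by
  unfold tableauVector
  by_cases h : R' ∈ B
  · rw [dif_pos h, b.repr_self, Finsupp.single_apply]
    congr 1
    exact propext ⟨fun h => by rw [← h], fun h => Subtype.ext h.symm⟩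
  · rw [dif_neg h, map_zero, if_neg (fun h' : R.1 = R' => h (h' ▸ R.2))]
    rfl

theorem repr_apply_eq_sum (u : Module.End ℂ W) (v : W) (R : B) :
    b.repr (u v) R = (b.repr v).sum fun S c => c * b.repr (u (b S)) R := by
  conv_lhs => rw [← b.linearCombination_repr v, Finsupp.linearCombination_apply]
  simp [Finsupp.sum, map_sum, map_smul]

theorem exists_repr_ne_zero {u v : Module.End ℂ W} {T R : B}
    (h : b.repr ((u * v) (b T)) R ≠ 0) :
    ∃ S, b.repr (v (b T)) S ≠ 0 ∧ b.repr (u (b S)) R ≠ 0 := by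
  rw [Module.End.mul_apply, repr_apply_eq_sum] at h
  obtain ⟨S, -, hS⟩ := Finset.exists_ne_zero_of_sum_ne_zero h
  exact ⟨S, left_ne_zero_of_mul hS, right_ne_zero_of_mul hS⟩

variable (b)

/-- `u` does not change the rows from row `k` on. -/
def FixesRows (k : ℕ) (u : Module.End ℂ W) : Prop :=
  ∀ T R, b.repr (u (b T)) R ≠ 0 → ∀ p : Pos n, k ≤ p.row → R.1 p = T.1 p

/-- `u` raises one entry of row `k` and does not change the rows above it. -/
def RaisesRow (k : ℕ) (u : Module.End ℂ W) : Prop :=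
  ∀ T R, b.repr (u (b T)) R ≠ 0 → ∃ i ∈ rowSet n k, ∀ p : Pos n, k ≤ p.row →
    R.1 p = T.1.raise i p

variable {b} {ρ : Gl n →ₗ⁅ℂ⁆ Module.End ℂ W}

theorem FollowsGTFormulas.exists_raise (hF : FollowsGTFormulas ρ b) {k : ℕ} (hk : k + 1 < n)
    {T R : B} (h : b.repr (ρ (E ⟨k, Nat.lt_of_succ_lt hk⟩ ⟨k + 1, hk⟩) (b T)) R ≠ 0) :
    ∃ i ∈ rowSet n (k + 1), R.1 = T.1.raise i := by
  rw [hF.raise, map_sum, Finsupp.finsetSum_apply] at h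
  obtain ⟨i, hi, h⟩ := Finset.exists_ne_zero_of_sum_ne_zero h
  refine ⟨i, hi, ?_⟩
  by_contra hne
  apply h
  rw [map_smul, Finsupp.smul_apply, repr_tableauVector, if_neg hne, smul_zero]

theorem raise_apply (T : Tableau n) (i p : Pos n) :
    T.raise i p = T p + if p = i then 1 else 0 := by
  simp [Tableau.raise, Pi.single_apply]

theorem lower_apply (T : Tableau n) (i p : Pos n) :
    T.lower i p = T p - if p = i then 1 else 0 := by
  simp [Tableau.lower, Pi.single_apply]

theorem FollowsGTFormulas.fixesRows (hF : FollowsGTFormulas ρ b) {k l : ℕ} (hk : k + 1 < n)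
    (hl : k + 1 < l) :
    FixesRows b l (ρ (E ⟨k, Nat.lt_of_succ_lt hk⟩ ⟨k + 1, hk⟩)) := by
  intro T R h p hp
  obtain ⟨i, hi, hR⟩ := hF.exists_raise hk h
  rw [hR, raise_apply, if_neg, add_zero]
  rintro rfl
  rw [mem_rowSet] at hi
  omega

/-- Induction through $E_{l\kappa}=[E_{l,l+1},E_{l+1,\kappa}]$: the factor $E_{l,l+1}$ acts only in
rows below row `κ.val`, so the other factor accounts for the single change there. -/
theorem FollowsGTFormulas.raisesRow (hF : FollowsGTFormulas ρ b) (κ : Fin n) (d : ℕ) :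
    ∀ l : Fin n, l.val + d + 1 = κ.val → RaisesRow b κ.val (ρ (E l κ)) := by
  induction d with
  | zero =>
    intro l hl T R h
    have hκ : κ = ⟨l.val + 1, by omega⟩ := Fin.ext hl.symm
    rw [hκ] at h
    obtain ⟨i, hi, hR⟩ := hF.exists_raise (by omega) h
    refine ⟨i, by rwa [← hl], fun p _ => by rw [hR]⟩
  | succ d ih =>
    intro l hl T R h
    have hl1 : l.val + 1 < n := by have := κ.2; omega
    set l' : Fin n := ⟨l.val + 1, hl1⟩ with hl'
    have h1 := op_mul ρ l l' l' κ
    have h2 : ¬ κ = l := fun h => by rw [h] at hl; omega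
    rw [if_pos rfl, if_neg h2, sub_zero] at h1
    have h3 : ρ (E l κ) = ρ (E l l') * ρ (E l' κ) - ρ (E l' κ) * ρ (E l l') := by
      rw [h1]; abel
    have hfix : FixesRows b κ.val (ρ (E l l')) := hF.fixesRows hl1 (by omega)
    have hr := ih l' (by simp [hl']; omega)
    rw [h3, LinearMap.sub_apply, map_sub, Finsupp.sub_apply] at h
    by_cases h4 : b.repr ((ρ (E l l') * ρ (E l' κ)) (b T)) R = 0
    · rw [h4, zero_sub, neg_ne_zero] at h
      obtain ⟨S, hS, hR⟩ := exists_repr_ne_zero h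
      obtain ⟨i, hi, hR'⟩ := hr S R hR
      refine ⟨i, hi, fun p hp => ?_⟩
      rw [hR' p hp, raise_apply, raise_apply, hfix T S hS p hp]
    · obtain ⟨S, hS, hR⟩ := exists_repr_ne_zero h4
      obtain ⟨i, hi, hS'⟩ := hr T S hS
      exact ⟨i, hi, fun p hp => by rw [hfix S R hR p hp, hS' p hp]⟩

theorem FollowsGTFormulas.raisesRow_colOp (hF : FollowsGTFormulas ρ b) (κ : Fin n)
    (l : Idx n κ.val) : RaisesRow b κ.val (colOp ρ κ l) :=
  hF.raisesRow κ (κ.val - l.1.val - 1) l.1 (by have := l.2; omega)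

end Coefficients

end GelfandTsetlin
end

noncomputable section
namespace GelfandTsetlin

/-! ### The Casimir elements and the row relations of a tableaux module -/

/-- The Vandermonde argument: combine the powers to a polynomial that vanishes at all nodes but one.
-/
theorem eq_zero_of_sum_pow_smul {ι W : Type*} [DecidableEq ι] [AddCommGroup W] [Module ℂ W]
    {s : Finset ι} {a : ι → ℂ} (ha : Set.InjOn a s) {z : ι → W}
    (h : ∀ r < s.card, ∑ i ∈ s, a i ^ r • z i = 0) : ∀ i ∈ s, z i = 0 := by
  intro i hi
  have h1 : ∀ P : Polynomial ℂ, P.natDegree < s.card → ∑ j ∈ s, P.eval (a j) • z j = 0 := by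
    intro P hP
    simp only [Polynomial.eval_eq_sum_range' hP, Finset.sum_smul, mul_smul]
    rw [Finset.sum_comm]
    refine Finset.sum_eq_zero fun r hr => ?_
    rw [← Finset.smul_sum, h r (Finset.mem_range.1 hr), smul_zero]
  have h2 := h1 (∏ j ∈ s.erase i, (Polynomial.X - Polynomial.C (a j))) (by
    rw [natDegree_prod_X_sub_C', Finset.card_erase_of_mem hi]
    exact Nat.sub_lt (Finset.card_pos.2 ⟨i, hi⟩) one_pos)
  simp only [eval_prod_X_sub_C] at h2
  rw [Finset.sum_eq_single i] at h2
  · exact (smul_eq_zero.1 h2).resolve_left (prod_erase_sub_ne_zero ha hi)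
  · intro j hj hji
    rw [Finset.prod_eq_zero (i := j) (Finset.mem_erase.2 ⟨hji, hj⟩) (sub_self _), zero_smul]
  · exact fun h => absurd hi h

section VSide

open Matrix

variable {n : ℕ} {B : Set (Tableau n)} {W : Type*} [AddCommGroup W] [Module ℂ W]
  {b : Module.Basis B ℂ W} {ρ : Gl n →ₗ⁅ℂ⁆ Module.End ℂ W}

/-- The eigenvalues of the trace of the `r`-th power of the matrix of `gl_k`. -/
def rowGamma (B : Set (Tableau n)) (k r : ℕ) : B → ℂ := fun T =>
  gammaVal (rowSet n k) T.1 ((k : ℂ) - 1) r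

/-- By `trace_sq_mul`, $2(Eu)_l=[\operatorname{tr}E^2,u_l]+\kappa u_l$. As $\operatorname{tr}E^2$ is
diagonal, applying the matrix once multiplies the coefficient from `T` to `R` by a scalar. -/
theorem pow_colOp_repr_aux {κ : Fin n}
    (hτ : trace (opMat ρ κ.val ^ 2) = diagOp b (rowGamma B κ.val 2)) (l : Idx n κ.val) (T R : B)
    (r : ℕ) : b.repr ((opMat ρ κ.val ^ r *ᵥ colOp ρ κ) l (b T)) R =
      ((rowGamma B κ.val 2 R - rowGamma B κ.val 2 T + κ.val) / 2) ^ r *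
        b.repr (colOp ρ κ l (b T)) R := by
  induction r with
  | zero => simp
  | succ r ih =>
    have h := (blockRelations_op ρ κ).trace_sq_mul ((blockRelations_op ρ κ).E_pow_mulVec r) l
    rw [hτ, ← pow_succ_mulVec] at h
    have hcard : Fintype.card (Idx n κ.val) = κ.val := by
      rw [Fintype.card_subtype]
      have : (Finset.univ.filter fun i : Fin n => i.val < κ.val) = Finset.Iio κ := by
        ext i; simp
      rw [this, Fin.card_Iio]
    have h2 := congrArg (fun u => b.repr (u (b T)) R) h
    simp only [hcard, Module.End.mul_apply, LinearMap.add_apply, LinearMap.sub_apply, map_add,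
      map_sub, Finsupp.add_apply, Finsupp.sub_apply, diagOp_basis, map_smul, Finsupp.smul_apply,
      repr_diagOp, ih, smul_eq_mul, ← Nat.cast_smul_eq_nsmul ℂ, Module.End.natCast_apply] at h2
    rw [show ((2 : Module.End ℂ W)) = ((2 : ℕ) : Module.End ℂ W) from rfl,
      Module.End.natCast_apply, ← Nat.cast_smul_eq_nsmul ℂ, map_smul, Finsupp.smul_apply,
      smul_eq_mul] at h2
    rw [pow_succ ((rowGamma B κ.val 2 R - rowGamma B κ.val 2 T + κ.val) / 2)]
    push_cast at h2
    linear_combination -(1 / 2 : ℂ) * h2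

/-- When the entry at `i` is raised, the change of the quadratic Casimir eigenvalue turns the scalar
of `pow_colOp_repr_aux` into `T.1 i + κ.val`. -/
theorem pow_colOp_repr {κ : Fin n}
    (hτ : trace (opMat ρ κ.val ^ 2) = diagOp b (rowGamma B κ.val 2)) (l : Idx n κ.val) {T R : B}
    (r : ℕ) {i : Pos n} (hi : i ∈ rowSet n κ.val)
    (hR : ∀ p : Pos n, κ.val ≤ p.row → R.1 p = T.1.raise i p) :
    b.repr ((opMat ρ κ.val ^ r *ᵥ colOp ρ κ) l (b T)) R =
      (T.1 i + κ.val) ^ r * b.repr (colOp ρ κ l (b T)) R := by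
  have h := gammaVal_two_raise hi (L := T.1) (L' := R.1) (fun j hj => by
    rw [hR j (mem_rowSet.1 hj).ge, raise_apply]) ((κ.val : ℂ) - 1)
  rw [card_rowSet κ.2.le] at h
  rw [pow_colOp_repr_aux hτ]
  congr 2
  unfold rowGamma
  rw [h]
  ring

theorem raise_inj {T : Tableau n} {i j : Pos n} (h : T.raise i j = T.raise j j) : i = j := by
  by_contra hne
  rw [raise_apply, raise_apply, if_pos rfl, if_neg (Ne.symm hne)] at h
  simp at h

open Classical in
-- Group the components of the column operators by the entry of row `κ.val` that they raise. The
-- vectors `y i` do not depend on `r`.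
theorem exists_blockInv_eq (hF : FollowsGTFormulas ρ b) {κ : Fin n}
    (hτ : trace (opMat ρ κ.val ^ 2) = diagOp b (rowGamma B κ.val 2)) (T : B) :
    ∃ y : Pos n → W, ∀ r,
      blockInv (opMat ρ κ.val) (colOp ρ κ) (rowOp ρ κ) r (b T) =
        ∑ i ∈ rowSet n κ.val, (T.1 i + κ.val) ^ r • y i := by
  let z : Idx n κ.val → Pos n → W := fun l i => b.repr.symm
    ((b.repr (colOp ρ κ l (b T))).filter fun R => ∀ p : Pos n, κ.val ≤ p.row →
      R.1 p = T.1.raise i p)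
  refine ⟨fun i => ∑ l, rowOp ρ κ l (z l i), fun r => ?_⟩
  have hz : ∀ l, (opMat ρ κ.val ^ r *ᵥ colOp ρ κ) l (b T) =
      ∑ i ∈ rowSet n κ.val, (T.1 i + κ.val) ^ r • z l i := by
    intro l
    apply b.repr.injective
    ext R
    simp only [map_sum, Finsupp.finsetSum_apply, map_smul, Finsupp.smul_apply, z,
      LinearEquiv.apply_symm_apply, Finsupp.filter_apply, smul_eq_mul]
    by_cases h0 : b.repr (colOp ρ κ l (b T)) R = 0
    · rw [pow_colOp_repr_aux hτ, h0]
      simp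
    · obtain ⟨i, hi, hR⟩ := hF.raisesRow_colOp κ l T R h0
      rw [pow_colOp_repr hτ l r hi hR, Finset.sum_eq_single i, if_pos hR]
      · intro j hj hji
        rw [if_neg, mul_zero]
        intro h
        have h1 := h j (mem_rowSet.1 hj).ge
        rw [hR j (mem_rowSet.1 hj).ge] at h1
        exact hji (raise_inj h1).symm
      · exact fun h => absurd hi h
  rw [blockInv, dotProduct, LinearMap.sum_apply]
  simp only [Module.End.mul_apply, hz, map_sum, map_smul]
  rw [Finset.sum_comm]
  simp only [Finset.smul_sum]

/-- The operators applied to a basis vector are power sums at $\kappa$ distinct nodes, so their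
values for `r < κ.val` determine all of them. -/
theorem blockInv_eq_of_lt (hF : FollowsGTFormulas ρ b) {κ : Fin n}
    (hB : ∀ T ∈ B, T.Noncritical)
    (hτ : trace (opMat ρ κ.val ^ 2) = diagOp b (rowGamma B κ.val 2))
    (h : ∀ r < κ.val, blockInv (opMat ρ κ.val) (colOp ρ κ) (rowOp ρ κ) r =
      diagOp b fun T => rowMoment (rowSet n κ.val) (rowSet n (κ.val + 1)) T.1 κ.val r) (r : ℕ) :
    blockInv (opMat ρ κ.val) (colOp ρ κ) (rowOp ρ κ) r =
      diagOp b fun T => rowMoment (rowSet n κ.val) (rowSet n (κ.val + 1)) T.1 κ.val r := by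
  refine eq_diagOp fun T => ?_
  obtain ⟨y, hy⟩ := exists_blockInv_eq hF hτ T
  have hinj := (hB T.1 T.2).injOn κ.2
  have h1 := eq_zero_of_sum_pow_smul (injOn_shift hinj (κ.val : ℂ)) (z := fun i => y i -
    (-((∏ q ∈ rowSet n (κ.val + 1), (T.1 i - T.1 q)) /
      ∏ j ∈ (rowSet n κ.val).erase i, (T.1 i - T.1 j))) • b T) (by
      intro r hr
      rw [card_rowSet κ.2.le] at hr
      simp only [smul_sub, Finset.sum_sub_distrib, ← hy, h r hr, diagOp_basis, rowMoment,
        Finset.sum_smul, smul_smul]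
      rw [sub_eq_zero]
      exact Finset.sum_congr rfl fun i _ => by rw [mul_comm])
  rw [hy, rowMoment, Finset.sum_smul]
  refine Finset.sum_congr rfl fun i hi => ?_
  rw [sub_eq_zero.1 (h1 i hi), smul_smul, mul_comm]

end VSide

end GelfandTsetlin
end

/-! ### From the Casimir elements to the invariants of neighbouring rows -/

noncomputable section
namespace GelfandTsetlin

section VSide

open Matrix

variable {n : ℕ} {B : Set (Tableau n)} {W : Type*} [AddCommGroup W] [Module ℂ W]
  {b : Module.Basis B ℂ W} {ρ : Gl n →ₗ⁅ℂ⁆ Module.End ℂ W}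

/-- The eigenvalues of `E_{κκ}`. -/
def diagValue (B : Set (Tableau n)) (κ : ℕ) : B → ℂ := fun T =>
  (κ : ℂ) + ∑ p ∈ rowSet n (κ + 1), T.1 p - ∑ p ∈ rowSet n κ, T.1 p

/-- The eigenvalues of the elements `∑ E_{κi} (E^r)_{ij} E_{jκ}`. -/
def momentValue (B : Set (Tableau n)) (κ r : ℕ) : B → ℂ := fun T =>
  rowMoment (rowSet n κ) (rowSet n (κ + 1)) T.1 κ r

/-- The invariant of index $r<\kappa$ is solved from the Casimir element of degree $r+2\le\kappa+1$,
whose action is known. `blockInv_eq_of_lt` gives the invariants of all indices, and fed back into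
the recursion they give the traces up to degree $4$, as the next row requires. -/
theorem casimir_step (hF : FollowsGTFormulas ρ b) (hB : ∀ T ∈ B, T.Noncritical) {κ : Fin n}
    (hκ : κ.val ≤ 3)
    (hprev : ∀ r, 1 ≤ r → r ≤ 4 → trace (opMat ρ κ.val ^ r) = diagOp b (rowGamma B κ.val r))
    (hcas : ∀ r, 1 ≤ r → r ≤ κ.val + 1 →
      trace (opMat ρ (κ.val + 1) ^ r) = diagOp b (rowGamma B (κ.val + 1) r)) :
    (∀ r, blockInv (opMat ρ κ.val) (colOp ρ κ) (rowOp ρ κ) r =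
      diagOp b (momentValue B κ.val r)) ∧
    ∀ r, 1 ≤ r → r ≤ 4 →
      trace (opMat ρ (κ.val + 1) ^ r) = diagOp b (rowGamma B (κ.val + 1) r) := by
  set Δ := diagOp b with hΔ
  set ε := diagValue B κ.val
  set α := momentValue B κ.val
  set g := rowGamma B κ.val
  set g' := rowGamma B (κ.val + 1) with hg'
  have H := blockRelations_op ρ κ
  have he : ρ (E κ κ) = Δ ε := eq_diagOp fun T => hF.diag κ T
  have h0 : trace (opMat ρ κ.val ^ 0) = (κ.val : Module.End ℂ W) := by
    rw [pow_zero, trace_one]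
    have : (Finset.univ.filter fun i : Fin n => i.val < κ.val) = Finset.Iio κ := by
      ext i; simp
    rw [Fintype.card_subtype, this, Fin.card_Iio]
  have hrec : ∀ T : B, GammaRecursion (fun r => g r T) (fun r => g' r T) κ.val (ε T)
      (fun r => α r T) := by
    intro T
    have := gammaRecursion_gammaVal ((hB T.1 T.2).injOn κ.2) hκ (card_rowSet κ.2.le)
      (card_rowSet (m := κ.val + 1) κ.2)
    simpa [g, g', rowGamma, ε, diagValue, α, momentValue] using this
  have h1 := hprev 1 le_rfl (by norm_num)
  have h2 := hprev 2 (by norm_num) (by norm_num)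
  have h3 := hprev 3 (by norm_num) (by norm_num)
  have h4 := hprev 4 (by norm_num) le_rfl
  have d0 := H.pow_mulVec_dot_w 0
  have d1 := H.pow_mulVec_dot_w 1
  have d2 := H.pow_mulVec_dot_w 2
  simp only [pow_zero, one_mulVec, zero_add, Finset.range_zero, Finset.sum_empty, sub_zero,
    Finset.sum_range_succ, Nat.add_one_sub_one, Nat.sub_self, Nat.sub_zero, one_add_one_eq_two,
    Nat.reduceAdd, Nat.reduceSub] at d0 d1 d2
  rw [← pow_zero (opMat ρ κ.val), h0, h1, he] at d0
  rw [← pow_zero (opMat ρ κ.val), h0, h1, h2, he, pow_one] at d1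
  rw [← pow_zero (opMat ρ κ.val), h0, h1, h2, h3, he] at d2
  have t1 := trace_blockMat_pow_one (E := opMat ρ κ.val) (v := colOp ρ κ) (w := rowOp ρ κ)
    (e := ρ (E κ κ))
  have t2 := trace_blockMat_pow_two (E := opMat ρ κ.val) (v := colOp ρ κ) (w := rowOp ρ κ)
    (e := ρ (E κ κ))
  have t3 := H.trace_blockMat_pow_three
  have t4 := H.trace_blockMat_pow_four
  rw [← trace_opMat_pow, ← pow_one (opMat ρ κ.val), h1, he] at t1
  rw [← trace_opMat_pow, h2, d0, cornerPow_two, he] at t2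
  rw [← trace_opMat_pow, h3, d0, d1, cornerPow_three, he] at t3
  rw [← trace_opMat_pow, h4, d0, d1, d2, cornerPow_four, he] at t4
  set A := blockInv (opMat ρ κ.val) (colOp ρ κ) (rowOp ρ κ)
  have hc : Δ ε * (κ.val : Module.End ℂ W) = κ.val * Δ ε := (Nat.cast_commute _ _).symm.eq
  rw [hc] at t2 t3 t4
  have e1 : g' 1 = ε + g 1 := funext fun T => (hrec T).1
  have e2 : g' 2 = ε * ε + α 0 + g 2 + (α 0 + g 1 - κ.val * ε) :=
    funext fun T => (hrec T).2.1
  have e3 : g' 3 = ε * (ε * ε + α 0) + (α 0 * ε + α 1) + g 3 +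
      (2 : ℕ) * (α 1 + g 2 - ε * g 1 - κ.val * α 0) + (α 0 + g 1 - κ.val * ε) * (ε + 1) :=
    funext fun T => (hrec T).2.2.1
  have e4 : g' 4 = ε * (ε * (ε * ε + α 0) + (α 0 * ε + α 1)) +
      (α 0 * (ε * ε + α 0) + α 1 * ε + α 2) + g 4 +
      (3 : ℕ) * (α 2 + g 3 - ε * g 2 - (κ.val * α 1 + g 1 * α 0)) +
      (2 : ℕ) * ((α 1 + g 2 - ε * g 1 - κ.val * α 0) * (ε + 1)) +
      ((α 0 + g 1 - κ.val * ε) * (ε + 1) * (ε + 1) + ((α 0 + g 1 - κ.val * ε) * α 0 +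
        (α 1 + g 2 - ε * g 1 - κ.val * α 0) - (α 0 + g 1 - κ.val * ε) * ε)) :=
    funext fun T => (hrec T).2.2.2
  replace e2 := congrArg Δ e2
  replace e3 := congrArg Δ e3
  replace e4 := congrArg Δ e4
  simp only [map_add, map_sub, map_mul, map_natCast, map_one] at e2 e3 e4
  -- In the trace of degree $N$ the new unknown, of index $N-2$, occurs with total coefficient $N$:
  -- once from the corner power and $N-1$ times from the column products.
  have smul_cancel : ∀ (N : ℂ) (u v : Module.End ℂ W), N ≠ 0 → N • (u - v) = 0 → u = v :=
    fun N u v hN h => sub_eq_zero.1 ((smul_eq_zero.1 h).resolve_left hN)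
  have a0 : 1 ≤ κ.val → A 0 = Δ (α 0) := by
    intro hk
    rw [hcas 2 (by norm_num) (by omega), e2] at t2
    refine smul_cancel 2 _ _ two_ne_zero ?_
    linear_combination (norm := module) -t2
  have a1 : 2 ≤ κ.val → A 1 = Δ (α 1) := by
    intro hk
    rw [hcas 3 (by norm_num) (by omega), e3, a0 (by omega), Nat.cast_ofNat] at t3
    refine smul_cancel 3 _ _ three_ne_zero ?_
    simp only [mul_sub, mul_add, two_mul, sub_mul, add_mul] at t3
    linear_combination (norm := module) -t3
  have a2 : 3 ≤ κ.val → A 2 = Δ (α 2) := by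
    intro hk
    rw [hcas 4 (by norm_num) (by omega), e4, a0 (by omega), a1 (by omega), Nat.cast_ofNat,
      Nat.cast_ofNat, show (3 : Module.End ℂ W) = 1 + 1 + 1 by norm_num] at t4
    refine smul_cancel 4 _ _ (by norm_num) ?_
    simp only [mul_sub, mul_add, two_mul, sub_mul, add_mul, one_mul] at t4
    linear_combination (norm := module) -t4
  have hall : ∀ r, A r = Δ (α r) := by
    refine blockInv_eq_of_lt hF hB h2 fun r hr => ?_
    have hr3 : r < 3 := by omega
    interval_cases r
    · exact a0 hr
    · exact a1 hr
    · exact a2 hr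
  refine ⟨hall, fun r hr1 hr4 => ?_⟩
  interval_cases r
  · rw [t1, e1, map_add]
  · rw [t2, e2, hall]
  · rw [t3, e3, hall, hall, Nat.cast_ofNat]
  · rw [t4, e4, hall, hall, hall, Nat.cast_ofNat, Nat.cast_ofNat]

/-- The traces of the powers of the matrices of generators act by the polynomials `γ`. -/
theorem trace_opMat_pow_eq (hF : FollowsGTFormulas ρ b) (hB : ∀ T ∈ B, T.Noncritical)
    (hn : n ≤ 4)
    (hcas : ∀ m r, 1 ≤ r → r ≤ m → m ≤ n → trace (opMat ρ m ^ r) = diagOp b (rowGamma B m r))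
    (m : ℕ) (hm : m ≤ n) : ∀ r, 1 ≤ r → r ≤ 4 →
      trace (opMat ρ m ^ r) = diagOp b (rowGamma B m r) := by
  induction m with
  | zero =>
    intro r hr _
    have : IsEmpty (Idx n 0) := ⟨fun i => by have := i.2; omega⟩
    have h0 : rowGamma B 0 r = 0 := funext fun T => by
      rw [rowGamma, rowSet_zero, gammaVal_empty]; rfl
    rw [h0, map_zero]
    exact Finset.sum_of_isEmpty _
  | succ m ih =>
    exact (casimir_step hF hB (κ := ⟨m, hm⟩) (by simp; omega) (ih (by omega))
      fun r hr1 hr => hcas _ r hr1 hr hm).2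

theorem blockInv_eq (hF : FollowsGTFormulas ρ b) (hB : ∀ T ∈ B, T.Noncritical)
    (hn : n ≤ 4)
    (hcas : ∀ m r, 1 ≤ r → r ≤ m → m ≤ n → trace (opMat ρ m ^ r) = diagOp b (rowGamma B m r))
    (κ : Fin n) (r : ℕ) : blockInv (opMat ρ κ.val) (colOp ρ κ) (rowOp ρ κ) r =
      diagOp b (momentValue B κ.val r) :=
  (casimir_step hF hB (by have := κ.2; omega) (trace_opMat_pow_eq hF hB hn hcas _ κ.2.le)
      fun r hr1 hr => hcas _ r hr1 hr κ.2).1 r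

end VSide

end GelfandTsetlin
end

/-! ### The moment relation of a row of a tableaux module -/

noncomputable section
namespace GelfandTsetlin

section VSide

open Matrix

variable {n : ℕ} {B : Set (Tableau n)} {W : Type*} [AddCommGroup W] [Module ℂ W]
  {b : Module.Basis B ℂ W} {ρ : Gl n →ₗ⁅ℂ⁆ Module.End ℂ W}

/-- The operators and the scalar moments satisfy the same recursion with the same initial value. The
initial value uses that the entries of row `κ.val + 1` are distinct, hence `hκ`. -/
theorem cornerPow_eq (hF : FollowsGTFormulas ρ b) (hB : ∀ T ∈ B, T.Noncritical) {κ : Fin n}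
    (hκ : κ.val + 1 < n)
    (hA : ∀ r, blockInv (opMat ρ κ.val) (colOp ρ κ) (rowOp ρ κ) r =
      diagOp b (momentValue B κ.val r)) (r : ℕ) :
    cornerPow (opMat ρ κ.val) (colOp ρ κ) (rowOp ρ κ) (ρ (E κ κ)) r =
      diagOp b fun T => cornerMoment (rowSet n κ.val) (rowSet n (κ.val + 1)) T.1 κ.val r := by
  have he : ρ (E κ κ) = diagOp b (diagValue B κ.val) := eq_diagOp fun T => hF.diag κ T
  have hcard : (rowSet n (κ.val + 1)).card = (rowSet n κ.val).card + 1 := by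
    rw [card_rowSet κ.2, card_rowSet κ.2.le]
  induction r using Nat.strong_induction_on with
  | _ r ih =>
    rcases r with _ | r
    · rw [cornerPow_zero, ← map_one (diagOp b)]
      congr 1
      funext T
      exact (cornerMoment_zero ((hB T.1 T.2).injOn hκ) hcard _).symm
    · rw [cornerPow_succ, ih r r.lt_succ_self, he, ← map_mul]
      have : ∀ s ∈ Finset.range r, blockInv (opMat ρ κ.val) (colOp ρ κ) (rowOp ρ κ) s *
          cornerPow (opMat ρ κ.val) (colOp ρ κ) (rowOp ρ κ) (ρ (E κ κ)) (r - 1 - s) =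
          diagOp b ((momentValue B κ.val s) * fun T => cornerMoment (rowSet n κ.val)
            (rowSet n (κ.val + 1)) T.1 κ.val (r - 1 - s)) := by
        intro s hs
        rw [hA, ih _ (by omega), map_mul]
      rw [← he, Finset.sum_congr rfl this, ← map_sum, ← map_add]
      congr 1
      funext T
      rw [cornerMoment_succ ((hB T.1 T.2).injOn hκ) ((hB T.1 T.2).injOn κ.2) hcard]
      simp [diagValue, momentValue]

open Classical in
theorem apply_tableauVector (u : Module.End ℂ W) (R : Tableau n) :
    u (tableauVector b R) = if h : R ∈ B then u (b ⟨R, h⟩) else 0 := by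
  unfold tableauVector
  split_ifs <;> simp

theorem pow_colOp_last (hF : FollowsGTFormulas ρ b) {k : ℕ} (hk : k + 1 < n)
    (hτ : trace (opMat ρ (k + 1) ^ 2) = diagOp b (rowGamma B (k + 1) 2)) (T : B) (r : ℕ) :
    (opMat ρ (k + 1) ^ r *ᵥ colOp ρ ⟨k + 1, hk⟩) ⟨⟨k, by omega⟩, Nat.lt_succ_self k⟩ (b T) =
      ∑ i ∈ rowSet n (k + 1), ((T.1 i + (k + 1 : ℕ)) ^ r * raiseCoeff T.1 i) •
        tableauVector b (T.1.raise i) := by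
  have hcol : ∀ T : B, colOp ρ ⟨k + 1, hk⟩ ⟨⟨k, by omega⟩, Nat.lt_succ_self k⟩ (b T) =
      ∑ p ∈ rowSet n (k + 1), raiseCoeff T.1 p • tableauVector b (T.1.raise p) :=
    fun T => hF.raise k hk T
  apply b.repr.injective
  ext R
  by_cases h : ∃ i ∈ rowSet n (k + 1), R.1 = T.1.raise i
  · obtain ⟨i, hi, hR⟩ := h
    have h2 : ∀ j ∈ rowSet n (k + 1), j ≠ i → R.1 ≠ T.1.raise j := fun j _ hji h =>
      hji (raise_inj (congrFun (hR.symm.trans h) j)).symm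
    rw [pow_colOp_repr (κ := ⟨k + 1, hk⟩) hτ _ r hi fun p _ => by rw [hR], hcol]
    simp only [map_sum, Finsupp.finsetSum_apply, map_smul, Finsupp.smul_apply, smul_eq_mul,
      repr_tableauVector]
    rw [Finset.sum_eq_single i, Finset.sum_eq_single i, if_pos hR, mul_one, mul_one]
    · intro j hj hji
      rw [if_neg (h2 j hj hji), mul_zero]
    · exact fun h => absurd hi h
    · intro j hj hji
      rw [if_neg (h2 j hj hji), mul_zero]
    · exact fun h => absurd hi h
  · push Not at h
    rw [pow_colOp_repr_aux (κ := ⟨k + 1, hk⟩) hτ, hcol]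
    simp only [map_sum, Finsupp.finsetSum_apply, map_smul, Finsupp.smul_apply, smul_eq_mul,
      repr_tableauVector]
    rw [Finset.sum_eq_zero fun i hi => by rw [if_neg (h i hi), mul_zero],
      Finset.sum_eq_zero fun i hi => by rw [if_neg (h i hi), mul_zero], mul_zero]

open Classical in
/-- The contribution of `T - δ^j` to the diagonal of the product of the two generators. -/
def lowerRaise (B : Set (Tableau n)) (T : Tableau n) (j : Pos n) : ℂ :=
  if T.lower j ∈ B then lowerCoeff T j * raiseCoeff (T.lower j) j else 0

open Classical in
/-- The contribution of `T + δ^i` to the diagonal of the product of the two generators. -/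
def raiseLower (B : Set (Tableau n)) (T : Tableau n) (i : Pos n) : ℂ :=
  if T.raise i ∈ B then raiseCoeff T i * lowerCoeff (T.raise i) i else 0

theorem eq_lower_raise_iff {T : Tableau n} {i j : Pos n} : T = (T.lower j).raise i ↔ i = j := by
  constructor
  · intro h
    have := congrFun h j
    rw [raise_apply, lower_apply, if_pos rfl] at this
    by_contra hne
    rw [if_neg (Ne.symm hne)] at this
    exact one_ne_zero (by linear_combination this : (1 : ℂ) = 0)
  · rintro rfl
    simp [Tableau.lower, Tableau.raise]

theorem eq_raise_lower_iff {T : Tableau n} {i j : Pos n} : T = (T.raise j).lower i ↔ i = j := by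
  constructor
  · intro h
    have := congrFun h j
    rw [lower_apply, raise_apply, if_pos rfl] at this
    by_contra hne
    rw [if_neg (Ne.symm hne)] at this
    simp at this
  · rintro rfl
    simp [Tableau.lower, Tableau.raise]

/-- Compare the coefficients of `b T` in the image of `b T` under both sides of `pow_mulVec_mul_w`,
with both indices equal to the last index of $\mathfrak{gl}_{k+1}$, for each exponent `r`. On the
path through `T.lower j` the weight is taken at the lowered entry, which explains the shift by one
between the two families of nodes. -/
theorem rowRelation_of_tableaux (hF : FollowsGTFormulas ρ b) (hB : ∀ T ∈ B, T.Noncritical)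
    {k : ℕ} (hk : k + 1 < n)
    (hτ : trace (opMat ρ (k + 1) ^ 2) = diagOp b (rowGamma B (k + 1) 2))
    (hA : ∀ (κ : Fin n) r, blockInv (opMat ρ κ.val) (colOp ρ κ) (rowOp ρ κ) r =
      diagOp b (momentValue B κ.val r)) (T : B) :
    RowRelation (rowSet n (k + 1)) (rowSet n k) (rowSet n (k + 2)) T.1 ((k + 1 : ℕ) : ℂ)
      (lowerRaise B T.1) (raiseLower B T.1) := by
  refine momentRelation_of_pow fun r => ?_
  set κ : Fin n := ⟨k + 1, hk⟩ with hκ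
  set κ' : Fin n := ⟨k, by omega⟩ with hκ'
  set l : Idx n κ.val := ⟨κ', Nat.lt_succ_self k⟩ with hl
  have H := (blockRelations_op ρ κ).pow_mulVec_mul_w r l l
  have hcorner : ∀ s, (opMat ρ κ.val ^ s) l l = diagOp b fun T => cornerMoment (rowSet n k)
      (rowSet n (k + 1)) T.1 k s := fun s =>
    (opMat_pow_last ρ κ' s).trans (cornerPow_eq hF hB (κ := κ') hk (hA κ') s)
  have he : ρ (E κ κ) = diagOp b (diagValue B κ.val) := eq_diagOp fun T => hF.diag κ T
  have hrow : ∀ T : B, rowOp ρ κ l (b T) =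
      ∑ p ∈ rowSet n (k + 1), lowerCoeff T.1 p • tableauVector b (T.1.lower p) :=
    fun T => hF.lower k hk T
  have hcol : ∀ T : B, (opMat ρ κ.val ^ r *ᵥ colOp ρ κ) l (b T) = _ :=
    fun T => pow_colOp_last hF hk hτ T r
  rw [hcorner, hcorner, he] at H
  simp only [hcorner, hA] at H
  have h := congrArg (fun u => b.repr (u (b T)) T) H
  have g1 : b.repr ((opMat ρ κ.val ^ r *ᵥ colOp ρ κ) l (rowOp ρ κ l (b T))) T =
      ∑ j ∈ rowSet n (k + 1), lowerRaise B T.1 j * (T.1 j + (k + 1 : ℕ) - 1) ^ r := by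
    rw [hrow]
    simp only [map_sum, Finsupp.finsetSum_apply, map_smul, Finsupp.smul_apply, smul_eq_mul]
    refine Finset.sum_congr rfl fun j hj => ?_
    rw [apply_tableauVector, lowerRaise]
    by_cases hm : T.1.lower j ∈ B
    · rw [dif_pos hm, if_pos hm, hcol]
      simp only [map_sum, Finsupp.finsetSum_apply, map_smul, Finsupp.smul_apply, smul_eq_mul,
        repr_tableauVector, eq_lower_raise_iff]
      rw [Finset.sum_eq_single j]
      · rw [if_pos rfl, lower_apply, if_pos rfl]; ring
      · intro i _ hij; rw [if_neg hij, mul_zero]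
      · exact fun h => absurd hj h
    · rw [dif_neg hm, if_neg hm]; simp
  have g2 : b.repr (rowOp ρ κ l ((opMat ρ κ.val ^ r *ᵥ colOp ρ κ) l (b T))) T =
      ∑ j ∈ rowSet n (k + 1), raiseLower B T.1 j * (T.1 j + (k + 1 : ℕ)) ^ r := by
    rw [hcol]
    simp only [map_sum, Finsupp.finsetSum_apply, map_smul, Finsupp.smul_apply, smul_eq_mul]
    refine Finset.sum_congr rfl fun j hj => ?_
    rw [apply_tableauVector, raiseLower]
    by_cases hm : T.1.raise j ∈ B
    · rw [dif_pos hm, if_pos hm, hrow]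
      simp only [map_sum, Finsupp.finsetSum_apply, map_smul, Finsupp.smul_apply, smul_eq_mul,
        repr_tableauVector, eq_raise_lower_iff]
      rw [Finset.sum_eq_single j]
      · rw [if_pos rfl]; ring
      · intro i _ hij; rw [if_neg hij, mul_zero]
      · exact fun h => absurd hj h
    · rw [dif_neg hm, if_neg hm]; simp
  simp only [Module.End.mul_apply, LinearMap.add_apply, LinearMap.sub_apply, LinearMap.sum_apply,
    map_add, map_sub, map_sum, Finsupp.add_apply, Finsupp.sub_apply, Finsupp.finsetSum_apply,
    diagOp_basis, map_smul, Finsupp.smul_apply, b.repr_self, Finsupp.single_eq_same, smul_eq_mul,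
    mul_one, g1, g2] at h
  have hβ : ∀ j : Pos n, T.1 j + ((k + 1 : ℕ) : ℂ) - 1 = T.1 j + k := fun j => by push_cast; ring
  simp only [MomentRelation, Polynomial.eval_pow, Polynomial.eval_X, divDiff_X_pow]
  rw [sub_eq_iff_eq_add] 
  rw [h]
  -- The convolution of the two moment sequences is the divided difference of $X^r$.
  have hsum : ∑ s ∈ Finset.range r, momentValue B κ.val (r - 1 - s) T *
      cornerMoment (rowSet n k) (rowSet n (k + 1)) T.1 k s =
      ∑ j ∈ rowSet n (k + 1), ∑ i ∈ rowSet n (k + 1),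
        (∏ x ∈ rowSet n k, (T.1 j - T.1 x)) / (∏ j' ∈ (rowSet n (k + 1)).erase j, (T.1 j - T.1 j')) *
          -((∏ y ∈ rowSet n (k + 2), (T.1 i - T.1 y)) /
            ∏ j' ∈ (rowSet n (k + 1)).erase i, (T.1 i - T.1 j')) *
          ∑ a ∈ Finset.range r, (T.1 j + ((k + 1 : ℕ) : ℂ) - 1) ^ a *
            (T.1 i + ((k + 1 : ℕ) : ℂ)) ^ (r - 1 - a) := by
    simp only [momentValue, rowMoment, cornerMoment, Finset.sum_mul_sum, hβ]
    rw [Finset.sum_comm]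
    simp only [Finset.mul_sum]
    rw [Finset.sum_comm (s := rowSet n (k + 1)) (t := rowSet n (k + 1))]
    refine Finset.sum_congr rfl fun i _ => ?_
    rw [Finset.sum_comm]
    refine Finset.sum_congr rfl fun j _ => Finset.sum_congr rfl fun a _ => ?_
    simp only [hκ]
    ring
  have hmain : ∑ j ∈ rowSet n (k + 1),
      (∏ x ∈ rowSet n k, (T.1 j - T.1 x)) / (∏ j' ∈ (rowSet n (k + 1)).erase j, (T.1 j - T.1 j')) *
        ((T.1 j + ((k + 1 : ℕ) : ℂ) - 1) ^ r * (T.1 j + ((k + 1 : ℕ) : ℂ) - 1 -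
          (((k + 1 : ℕ) : ℂ) + ∑ y ∈ rowSet n (k + 2), T.1 y - ∑ i ∈ rowSet n (k + 1), T.1 i))) =
      cornerMoment (rowSet n k) (rowSet n (k + 1)) T.1 k (r + 1) -
        diagValue B κ.val T * cornerMoment (rowSet n k) (rowSet n (k + 1)) T.1 k r := by
    rw [cornerMoment, cornerMoment, Finset.mul_sum, ← Finset.sum_sub_distrib]
    refine Finset.sum_congr rfl fun j _ => ?_
    rw [hβ]
    simp only [hκ, diagValue]
    ring
  rw [← hsum, hmain]
  simp only [mul_comm]
  ring

end VSide

end GelfandTsetlin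
end

/-! ### Consequences of irreducibility -/

noncomputable section
namespace GelfandTsetlin

section Irreducible

open Matrix

variable {n : ℕ} {B : Set (Tableau n)} {V : Type*} [AddCommGroup V] [Module ℂ V]
  [LieRingModule (Gl n) V] [LieModule ℂ (Gl n) V] {b : Module.Basis B ℂ V}

/-- A set of basis tableaux that is closed under the moves with nonzero coefficient is empty or
everything if the module is irreducible. -/
theorem eq_univ_of_closed (hirr : LieModule.IsIrreducible ℂ (Gl n) V)
    (hF : FollowsGTFormulas (LieModule.toEnd ℂ (Gl n) V) b) {S : Set (Tableau n)}
    (hne : ∃ T ∈ B, T ∈ S)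
    (hraise : ∀ T ∈ B, T ∈ S → ∀ p : Pos n, p.row < n → T.raise p ∈ B → raiseCoeff T p ≠ 0 →
      T.raise p ∈ S)
    (hlower : ∀ T ∈ B, T ∈ S → ∀ p : Pos n, p.row < n → T.lower p ∈ B → lowerCoeff T p ≠ 0 →
      T.lower p ∈ S) : ∀ T ∈ B, T ∈ S := by
  set M : Submodule ℂ V := Submodule.span ℂ (b '' {T | T.1 ∈ S}) with hM
  have hinv : ∀ u : Module.End ℂ V, (∀ T : B, T.1 ∈ S → u (b T) ∈ M) → ∀ v ∈ M, u v ∈ M := by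
    intro u hu v hv
    have : M ≤ M.comap u := by
      rw [hM, Submodule.span_le]
      rintro _ ⟨T, hT, rfl⟩
      exact hu T hT
    exact this hv
  -- The stabilizer of `M` is a Lie subalgebra, so invariance has to be checked for the generators
  -- only.
  let A : LieSubalgebra ℂ (Gl n) :=
    { carrier := {x | ∀ v ∈ M, ⁅x, v⁆ ∈ M}
      add_mem' := fun hx hy v hv => by
        rw [add_lie]; exact M.add_mem (hx v hv) (hy v hv)
      zero_mem' := fun v _ => by rw [zero_lie]; exact M.zero_mem
      smul_mem' := fun c x hx v hv => by rw [smul_lie]; exact M.smul_mem c (hx v hv)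
      lie_mem' := fun hx hy v hv => by
        rw [lie_lie]; exact M.sub_mem (hx _ (hy v hv)) (hy _ (hx v hv)) }
  have hvec : ∀ R, (R ∈ B → R ∈ S) → tableauVector b R ∈ M := by
    intro R h
    unfold tableauVector
    split_ifs with hR
    · exact Submodule.subset_span ⟨⟨R, hR⟩, h hR, rfl⟩
    · exact M.zero_mem
  have hA : A = ⊤ := by
    refine generators_induction A (fun k hk => ?_) (fun k hk => ?_) (fun i => ?_)
    · refine hinv (LieModule.toEnd ℂ (Gl n) V (E ⟨k, Nat.lt_of_succ_lt hk⟩ ⟨k + 1, hk⟩))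
        fun T hT => ?_
      rw [hF.raise]
      refine M.sum_mem fun p hp => ?_
      by_cases h0 : raiseCoeff T.1 p = 0
      · rw [h0, zero_smul]; exact M.zero_mem
      · exact M.smul_mem _ (hvec _ fun h =>
          hraise T.1 T.2 hT p (by rw [mem_rowSet.1 hp]; exact hk) h h0)
    · refine hinv (LieModule.toEnd ℂ (Gl n) V (E ⟨k + 1, hk⟩ ⟨k, Nat.lt_of_succ_lt hk⟩))
        fun T hT => ?_
      rw [hF.lower]
      refine M.sum_mem fun p hp => ?_
      by_cases h0 : lowerCoeff T.1 p = 0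
      · rw [h0, zero_smul]; exact M.zero_mem
      · exact M.smul_mem _ (hvec _ fun h =>
          hlower T.1 T.2 hT p (by rw [mem_rowSet.1 hp]; exact hk) h h0)
    · refine hinv (LieModule.toEnd ℂ (Gl n) V (E i i)) fun T hT => ?_
      rw [hF.diag]
      exact M.smul_mem _ (Submodule.subset_span ⟨T, hT, rfl⟩)
  let N : LieSubmodule ℂ (Gl n) V :=
    { M with lie_mem := fun {x v} hv => (hA ▸ LieSubalgebra.mem_top x : x ∈ A) v hv }
  have hN : N = ⊤ := by
    refine (eq_bot_or_eq_top N).resolve_left fun h => ?_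
    obtain ⟨T, hT, hTS⟩ := hne
    have h1 : b ⟨T, hT⟩ ∈ N := Submodule.subset_span ⟨⟨T, hT⟩, hTS, rfl⟩
    rw [h, LieSubmodule.mem_bot] at h1
    exact b.ne_zero _ h1
  intro T hT
  have h1 : b ⟨T, hT⟩ ∈ M := by
    have : b ⟨T, hT⟩ ∈ N := hN ▸ LieSubmodule.mem_top _
    exact this
  rw [hM, b.mem_span_image, b.repr_self] at h1
  have h2 : (⟨T, hT⟩ : B) ∈ {T : B | T.1 ∈ S} := h1 (by simp)
  exact h2

end Irreducible

end GelfandTsetlin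
end

/-! ### Integral differences, and the structure of the basis of an irreducible module -/

noncomputable section
namespace GelfandTsetlin

section Sets

variable {n : ℕ}

/-- `a - b` is a nonnegative integer. -/
def GeZ (a b : ℂ) : Prop := ∃ m : ℤ, 0 ≤ m ∧ a - b = m

/-- `a - b` is an integer. -/
def IntDiff (a b : ℂ) : Prop := ∃ m : ℤ, a - b = m

theorem GeZ.refl (a : ℂ) : GeZ a a := ⟨0, le_rfl, by simp⟩

theorem GeZ.trans {a b c : ℂ} (h : GeZ a b) (h' : GeZ b c) : GeZ a c := by
  obtain ⟨m, hm, e⟩ := h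
  obtain ⟨m', hm', e'⟩ := h'
  exact ⟨m + m', by omega, by push_cast; linear_combination e + e'⟩

theorem GeZ.antisymm {a b : ℂ} (h : GeZ a b) (h' : GeZ b a) : a = b := by
  obtain ⟨m, hm, e⟩ := h
  obtain ⟨m', hm', e'⟩ := h'
  have : (m + m' : ℤ) = 0 := by
    have : ((m + m' : ℤ) : ℂ) = 0 := by push_cast; linear_combination -e - e'
    exact_mod_cast this
  have h0 : m = 0 := by omega
  rw [h0, Int.cast_zero] at e
  exact sub_eq_zero.1 e

theorem GeZ.intDiff {a b : ℂ} (h : GeZ a b) : IntDiff a b := by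
  obtain ⟨m, -, e⟩ := h
  exact ⟨m, e⟩

theorem IntDiff.symm {a b : ℂ} (h : IntDiff a b) : IntDiff b a := by
  obtain ⟨m, e⟩ := h
  exact ⟨-m, by push_cast; linear_combination -e⟩

theorem IntDiff.trans {a b c : ℂ} (h : IntDiff a b) (h' : IntDiff b c) : IntDiff a c := by
  obtain ⟨m, e⟩ := h
  obtain ⟨m', e'⟩ := h'
  exact ⟨m + m', by push_cast; linear_combination e + e'⟩

theorem geZ_add_one_right {a b : ℂ} : GeZ a (b + 1) ↔ ∃ m : ℤ, 0 < m ∧ a - b = m := by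
  constructor
  · rintro ⟨m, hm, e⟩
    exact ⟨m + 1, by omega, by push_cast; linear_combination e⟩
  · rintro ⟨m, hm, e⟩
    exact ⟨m - 1, by omega, by push_cast; linear_combination e⟩

/-- The trichotomy of integral differences. -/
theorem IntDiff.geZ_or {a b : ℂ} (h : IntDiff a b) : GeZ a b ∨ GeZ b (a + 1) := by
  obtain ⟨m, e⟩ := h
  rcases le_or_gt 0 m with hm | hm
  · exact Or.inl ⟨m, hm, e⟩
  · exact Or.inr ⟨-m - 1, by omega, by push_cast; linear_combination -e⟩

theorem GeZ.eq_or {a b : ℂ} (h : GeZ a b) : a = b ∨ GeZ a (b + 1) := by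
  obtain ⟨m, hm, e⟩ := h
  rcases hm.eq_or_lt with rfl | hm
  · exact Or.inl (sub_eq_zero.1 (by simpa using e))
  · exact Or.inr (geZ_add_one_right.2 ⟨m, hm, e⟩)

theorem geZ_add_one_self (a : ℂ) : GeZ (a + 1) a := ⟨1, by norm_num, by simp⟩

theorem GeZ.of_add_one {a b : ℂ} (h : GeZ a (b + 1)) : GeZ a b := h.trans (geZ_add_one_self b)

theorem not_geZ_of_geZ_add_one {a b : ℂ} (h : GeZ a (b + 1)) : ¬ GeZ b a := by
  intro h'
  obtain ⟨m, hm, e⟩ := h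
  obtain ⟨m', hm', e'⟩ := h'
  have : ((m + m' + 1 : ℤ) : ℂ) = 0 := by push_cast; linear_combination -e - e'
  have : (m + m' + 1 : ℤ) = 0 := by exact_mod_cast this
  omega

theorem GeZ.add_one {a b : ℂ} : GeZ (a + 1) (b + 1) ↔ GeZ a b := by
  unfold GeZ
  simp

theorem satisfiesRel_ge {T : Tableau n} {p q : Pos n} :
    T.SatisfiesRel (.ge p q) ↔ GeZ (T p) (T q) := Iff.rfl

theorem satisfiesRel_gt {T : Tableau n} {p q : Pos n} :
    T.SatisfiesRel (.gt p q) ↔ GeZ (T p) (T q + 1) := geZ_add_one_right.symm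

/-- The properties of a set `B` of basis tableaux and its set `C` of relations that are used in
the proof of admissibility. -/
structure TableauxSet (C : Set (Relation n)) (B : Set (Tableau n)) : Prop where
  subset : C ⊆ relR n ∪ relR0 n
  nonempty : B.Nonempty
  noncritical : ∀ T ∈ B, T.Noncritical
  integral : ∀ T ∈ B, ∀ T' ∈ B, ∀ p, IntDiff (T p) (T' p)
  top : ∀ T ∈ B, ∀ T' ∈ B, ∀ p : Pos n, p.row = n → T p = T' p
  sat : ∀ T ∈ B, T.Satisfies C
  ge_mem : ∀ T ∈ B, ∀ y p : Pos n, y.row = p.row + 1 → GeZ (T y) (T p) → .ge y p ∈ C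
  gt_mem : ∀ T ∈ B, ∀ p y : Pos n, y.row = p.row + 1 → GeZ (T p) (T y + 1) → .gt p y ∈ C
  top_mem : ∀ T ∈ B, ∀ y y' : Pos n, y.row = n → y'.row = n → y ≠ y' → GeZ (T y) (T y') →
    .ge y y' ∈ C
  raise_mem : ∀ T ∈ B, ∀ p : Pos n, p.row < n → (∀ y : Pos n, y.row = p.row + 1 → T p ≠ T y) →
    (∀ x : Pos n, x.row + 1 = p.row → T p + 1 ≠ T x) → T.raise p ∈ B
  lower_mem : ∀ T ∈ B, ∀ p : Pos n, p.row < n →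
    (∀ y : Pos n, y.row = p.row + 1 → T p ≠ T y + 1) →
    (∀ x : Pos n, x.row + 1 = p.row → T p ≠ T x) → T.lower p ∈ B
  tangent : ∀ T ∈ B, ∀ p q : Pos n, p.row = q.row → p.row < n → T p = T q + 1 →
    ((∃ y : Pos n, y.row = p.row + 1 ∧ T y = T q) ∧ ∃ x : Pos n, x.row + 1 = p.row ∧ T x = T p) ∨
    ∃ y y' : Pos n, y ≠ y' ∧ y.row = p.row + 1 ∧ y'.row = p.row + 1 ∧ T y = T q ∧ T y' = T q

/-- The relations of `𝓡 ∪ 𝓡⁰` that are satisfied by all tableaux of `B`. -/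
def commonRelations (B : Set (Tableau n)) : Set (Relation n) :=
  {r | r ∈ relR n ∪ relR0 n ∧ ∀ T ∈ B, T.SatisfiesRel r}

/-- The properties of the basis of a tableaux module in terms of the coefficients of the
Gelfand-Tsetlin formulas. -/
structure TableauxBasis (B : Set (Tableau n)) : Prop where
  nonempty : B.Nonempty
  noncritical : ∀ T ∈ B, T.Noncritical
  rowRelation : ∀ T ∈ B, ∀ k, k + 1 < n → RowRelation (rowSet n (k + 1)) (rowSet n k)
    (rowSet n (k + 2)) T ((k + 1 : ℕ) : ℂ) (lowerRaise B T) (raiseLower B T)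
  eq_univ : ∀ S : Set (Tableau n), (∃ T ∈ B, T ∈ S) →
    (∀ T ∈ B, T ∈ S → ∀ p : Pos n, p.row < n → T.raise p ∈ B → raiseCoeff T p ≠ 0 →
      T.raise p ∈ S) →
    (∀ T ∈ B, T ∈ S → ∀ p : Pos n, p.row < n → T.lower p ∈ B → lowerCoeff T p ≠ 0 →
      T.lower p ∈ S) → ∀ T ∈ B, T ∈ S

namespace TableauxBasis

variable {B : Set (Tableau n)}

theorem mem_of_raiseLower {T : Tableau n} {p : Pos n} (h : raiseLower B T p ≠ 0) :
    T.raise p ∈ B := by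
  unfold raiseLower at h
  by_contra hn
  exact h (if_neg hn)

theorem mem_of_lowerRaise {T : Tableau n} {p : Pos n} (h : lowerRaise B T p ≠ 0) :
    T.lower p ∈ B := by
  unfold lowerRaise at h
  by_contra hn
  exact h (if_neg hn)

/-- Lowering `p` or raising `q` would make two entries of the row equal, so these tableaux are not
in `B` and both contributions vanish. This is the hypothesis of `RowRelation.tangent`. -/
theorem tangent (H : TableauxBasis B) {T : Tableau n} (hT : T ∈ B) {p q : Pos n}
    (hpq : p.row = q.row) (hp : p.row < n) (h : T p = T q + 1) :
    ((∃ y : Pos n, y.row = p.row + 1 ∧ T y = T q) ∧ ∃ x : Pos n, x.row + 1 = p.row ∧ T x = T p) ∨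
    ∃ y y' : Pos n, y ≠ y' ∧ y.row = p.row + 1 ∧ y'.row = p.row + 1 ∧ T y = T q ∧ T y' = T q := by
  obtain ⟨k, hk⟩ := Nat.exists_eq_add_of_le' p.row_pos
  have hT0 := H.noncritical T hT
  have hne : p ≠ q := fun hpq => by rw [hpq] at h; simp at h
  have h1 : lowerRaise B T p = 0 := by
    by_contra h0
    refine H.noncritical _ (mem_of_lowerRaise h0) p q hpq hp hne ?_
    rw [lower_apply, lower_apply, if_pos rfl, if_neg hne.symm, h]; ring
  have h2 : raiseLower B T q = 0 := by
    by_contra h0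
    refine H.noncritical _ (mem_of_raiseLower h0) p q hpq hp hne ?_
    rw [raise_apply, raise_apply, if_pos rfl, if_neg hne, h]; ring
  have h3 := (H.rowRelation T hT k (by omega)).tangent (hT0.injOn (by omega)) (hT0.injOn (by omega))
    (by rw [card_rowSet (by omega), card_rowSet (by omega)]; omega)
    (by rw [card_rowSet (by omega), card_rowSet (by omega)])
    (mem_rowSet.2 hk) (mem_rowSet.2 (hpq ▸ hk)) h h1 h2
  simp only [mem_rowSet] at h3
  rw [hk]
  rcases h3 with ⟨⟨y, hy, e⟩, x, hx, e'⟩ | ⟨y, hy, y', hy', hyy, e, e'⟩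
  · exact Or.inl ⟨⟨y, hy, e⟩, x, by omega, e'⟩
  · exact Or.inr ⟨y, y', hyy, hy, hy', e, e'⟩

/-- The contribution of the raised tableau to the diagonal is nonzero, and it would be zero by
definition if the tableau were not in `B`. -/
theorem raise_mem (H : TableauxBasis B) {T : Tableau n} (hT : T ∈ B) {p : Pos n}
    (hp : p.row < n) (hy : ∀ y : Pos n, y.row = p.row + 1 → T p ≠ T y)
    (hx : ∀ x : Pos n, x.row + 1 = p.row → T p + 1 ≠ T x) : T.raise p ∈ B := by
  obtain ⟨k, hk⟩ := Nat.exists_eq_add_of_le' p.row_pos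
  refine mem_of_raiseLower ((H.rowRelation T hT k (by omega)).raise_ne_zero
    ((H.noncritical T hT).injOn (by omega))
    (by rw [card_rowSet (by omega), card_rowSet (by omega)]; omega) (mem_rowSet.2 hk) ?_ ?_ ?_)
  -- An entry `q` of the same row with `T q = T p + 1` would, by the tangent alternative, bring an
  -- entry equal to `T p` in the row above.
  · intro q hq h
    rw [mem_rowSet] at hq
    rcases H.tangent hT (p := q) (q := p) (by omega) (by omega) h.symm with
      ⟨⟨y, hy', e⟩, -⟩ | ⟨y, -, -, hy', -, e, -⟩
    · exact hy y (by omega) e.symm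
    · exact hy y (by omega) e.symm
  · exact fun y h => hy y (by rw [mem_rowSet.1 h, hk])
  · exact fun x h => hx x (by rw [mem_rowSet.1 h, hk])

theorem lower_mem (H : TableauxBasis B) {T : Tableau n} (hT : T ∈ B) {p : Pos n}
    (hp : p.row < n) (hy : ∀ y : Pos n, y.row = p.row + 1 → T p ≠ T y + 1)
    (hx : ∀ x : Pos n, x.row + 1 = p.row → T p ≠ T x) : T.lower p ∈ B := by
  obtain ⟨k, hk⟩ := Nat.exists_eq_add_of_le' p.row_pos
  refine mem_of_lowerRaise ((H.rowRelation T hT k (by omega)).lower_ne_zero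
    ((H.noncritical T hT).injOn (by omega))
    (by rw [card_rowSet (by omega), card_rowSet (by omega)]) (mem_rowSet.2 hk) ?_ ?_ ?_)
  · intro q hq h
    rw [mem_rowSet] at hq
    have h' : T p = T q + 1 := by rw [← h]; ring
    rcases H.tangent hT (p := p) (q := q) (by omega) (by omega) h' with
      ⟨⟨y, hy', e⟩, -⟩ | ⟨y, -, -, hy', -, e, -⟩
    · exact hy y (by omega) (by rw [e, h'])
    · exact hy y (by omega) (by rw [e, h'])
  · exact fun y h h' => hy y (by rw [mem_rowSet.1 h, hk]) (by rw [← h']; ring)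
  · exact fun x h => hx x (by rw [mem_rowSet.1 h, hk])

/-- Moves change one entry below the top row by one, so the tableaux with these properties relative
to `T` are closed under moves; irreducibility does the rest. -/
theorem integral (H : TableauxBasis B) {T T' : Tableau n} (hT : T ∈ B) (hT' : T' ∈ B) :
    (∀ p, IntDiff (T p) (T' p)) ∧ ∀ p : Pos n, p.row = n → T p = T' p := by
  refine H.eq_univ {T' | (∀ p, IntDiff (T p) (T' p)) ∧ ∀ p : Pos n, p.row = n → T p = T' p}
    ⟨T, hT, fun p => (GeZ.refl _).intDiff, fun _ _ => rfl⟩ ?_ ?_ T' hT'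
  · rintro S - ⟨h1, h2⟩ p hp - -
    refine ⟨fun q => (h1 q).trans ?_, fun q hq => ?_⟩
    · rw [raise_apply]
      split_ifs
      · exact ⟨-1, by push_cast; ring⟩
      · exact ⟨0, by simp⟩
    · rw [raise_apply, if_neg (by rintro rfl; omega), add_zero, h2 q hq]
  · rintro S - ⟨h1, h2⟩ p hp - -
    refine ⟨fun q => (h1 q).trans ?_, fun q hq => ?_⟩
    · rw [lower_apply]
      split_ifs
      · exact ⟨1, by push_cast; ring⟩
      · exact ⟨0, by simp⟩
    · rw [lower_apply, if_neg (by rintro rfl; omega), sub_zero, h2 q hq]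

theorem raiseCoeff_eq_zero {T : Tableau n} {p y : Pos n} (hy : y.row = p.row + 1)
    (h : T p = T y) : raiseCoeff T p = 0 := by
  rw [raiseCoeff, Finset.prod_eq_zero (mem_rowSet.2 hy) (sub_eq_zero.2 h), zero_div, neg_zero]

theorem lowerCoeff_eq_zero {T : Tableau n} {p x : Pos n} (hx : x.row + 1 = p.row)
    (h : T p = T x) : lowerCoeff T p = 0 := by
  rw [lowerCoeff, Finset.prod_eq_zero (mem_rowSet.2 (by omega : x.row = p.row - 1))
    (sub_eq_zero.2 h), zero_div]

/-- The inequality can only be lost by raising `p` or lowering `y` when the two entries are equal,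
and then the coefficient of the move contains the factor zero. -/
theorem ge_all (H : TableauxBasis B) {T T' : Tableau n} (hT : T ∈ B) (hT' : T' ∈ B)
    {y p : Pos n} (hyp : y.row = p.row + 1) (h : GeZ (T y) (T p)) : GeZ (T' y) (T' p) := by
  have hne : y ≠ p := by rintro rfl; omega
  refine H.eq_univ {T' | GeZ (T' y) (T' p)} ⟨T, hT, h⟩ ?_ ?_ T' hT'
  · intro S _ hS q _ _ hc
    simp only [Set.mem_ofPred_eq, raise_apply] at hS ⊢
    by_cases hq : p = q
    · subst hq
      rw [if_neg hne, if_pos rfl, add_zero]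
      exact hS.eq_or.resolve_left fun h => hc (raiseCoeff_eq_zero hyp h.symm)
    · rw [if_neg hq, add_zero]
      split_ifs
      · exact (geZ_add_one_self _).trans hS
      · rwa [add_zero]
  · intro S _ hS q _ _ hc
    simp only [Set.mem_ofPred_eq, lower_apply] at hS ⊢
    by_cases hq : y = q
    · subst hq
      rw [if_pos rfl, if_neg hne.symm, sub_zero]
      have := hS.eq_or.resolve_left fun h => hc (lowerCoeff_eq_zero hyp.symm h)
      rw [← GeZ.add_one]
      simpa using this
    · rw [if_neg hq, sub_zero]
      split_ifs
      · exact hS.trans (by rw [← GeZ.add_one]; simpa using geZ_add_one_self _)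
      · rwa [sub_zero]

theorem tableauxSet (H : TableauxBasis B) : TableauxSet (commonRelations B) B where
  subset r hr := hr.1
  nonempty := H.nonempty
  noncritical := H.noncritical
  integral T hT T' hT' := (H.integral hT hT').1
  top T hT T' hT' := (H.integral hT hT').2
  sat T hT r hr := hr.2 T hT
  ge_mem T hT y p hyp h :=
    ⟨Or.inl ⟨y, p, hyp, Or.inl rfl⟩, fun T' hT' => H.ge_all hT hT' hyp h⟩
  gt_mem T hT p y hyp h := by
    refine ⟨Or.inl ⟨y, p, hyp, Or.inr rfl⟩, fun T' hT' => satisfiesRel_gt.2 ?_⟩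
    have h1 : IntDiff (T' y) (T' p) :=
      (((H.integral hT' hT).1 y).trans (h.of_add_one.intDiff.symm)).trans ((H.integral hT hT').1 p)
    -- For integral differences the strict relation is the negation of the weak one; a failure at
    -- `T'` would propagate back to `T`.
    exact h1.geZ_or.resolve_left fun h2 =>
      not_geZ_of_geZ_add_one h (H.ge_all hT' hT hyp h2)
  top_mem T hT y y' hy hy' hne h := by
    refine ⟨Or.inr ⟨y, y', hy, hy', hne, rfl⟩, fun T' hT' => ?_⟩
    rw [satisfiesRel_ge, ← (H.integral hT hT').2 y hy, ← (H.integral hT hT').2 y' hy']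
    exact h
  raise_mem T hT p := H.raise_mem hT
  lower_mem T hT p := H.lower_mem hT
  tangent T hT p q := H.tangent hT

end TableauxBasis

end Sets

end GelfandTsetlin
end

/-! ### The basis is the full set of tableaux satisfying the relations -/

noncomputable section
namespace GelfandTsetlin

section Sets

variable {n : ℕ} {C : Set (Relation n)} {B : Set (Tableau n)}

namespace TableauxSet

theorem ge_sat (H : TableauxSet C B) {T : Tableau n} (hT : T ∈ B) {y p : Pos n}
    (hyp : y.row = p.row + 1) (h : GeZ (T y) (T p)) {S : Tableau n} (hS : S.Satisfies C) :
    GeZ (S y) (S p) := hS _ (H.ge_mem T hT y p hyp h)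

theorem gt_sat (H : TableauxSet C B) {T : Tableau n} (hT : T ∈ B) {p y : Pos n}
    (hyp : y.row = p.row + 1) (h : GeZ (T p) (T y + 1)) {S : Tableau n} (hS : S.Satisfies C) :
    GeZ (S p) (S y + 1) := satisfiesRel_gt.1 (hS _ (H.gt_mem T hT p y hyp h))

theorem ne_of_geZ_add_one {a b : ℂ} (h : GeZ a (b + 1)) : a ≠ b := by
  rintro rfl
  exact not_geZ_of_geZ_add_one h (GeZ.refl _)

/-- Among the entries that still have to be raised, take one that maximizes `2 * (T p).re + p.row`.
An entry of an adjacent row that blocked it would, by the relations that `S` satisfies, also have to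
be raised, and would have a weight larger by one. -/
theorem exists_raise_mem (H : TableauxSet C B) {S T : Tableau n} (hS : S.Satisfies C)
    (hT : T ∈ B) (htop : ∀ p : Pos n, p.row = n → S p = T p)
    (hne : ∃ p, GeZ (S p) (T p + 1)) : ∃ p, GeZ (S p) (T p + 1) ∧ T.raise p ∈ B := by
  classical
  obtain ⟨p₀, hp₀⟩ := hne
  obtain ⟨p, hp, hmax⟩ := Finset.exists_max_image (Finset.univ.filter fun p => GeZ (S p) (T p + 1))
    (fun p => 2 * (T p).re + p.row) ⟨p₀, by simpa using hp₀⟩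
  simp only [Finset.mem_filter, Finset.mem_univ, true_and] at hp hmax
  have hrow : p.row < n := lt_of_le_of_ne p.row_le fun h => ne_of_geZ_add_one hp (htop p h)
  refine ⟨p, hp, H.raise_mem T hT p hrow ?_ ?_⟩
  · intro y hy h
    have h1 := H.ge_sat hT hy (by rw [h]; exact GeZ.refl _) hS
    have h2 := hmax y (h1.trans (by rwa [← h]))
    rw [hy, h] at h2
    push_cast at h2
    linarith
  · intro x hx h
    have h1 := H.gt_sat hT hx.symm (by rw [h]; exact GeZ.refl _) hS
    have h2 := hmax x (h1.trans (GeZ.add_one.2 (by rwa [← h])))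
    rw [← hx, ← h] at h2
    push_cast at h2
    simp at h2
    linarith

theorem exists_lower_mem (H : TableauxSet C B) {S T : Tableau n} (hS : S.Satisfies C)
    (hT : T ∈ B) (htop : ∀ p : Pos n, p.row = n → S p = T p)
    (hne : ∃ p, GeZ (T p) (S p + 1)) : ∃ p, GeZ (T p) (S p + 1) ∧ T.lower p ∈ B := by
  classical
  obtain ⟨p₀, hp₀⟩ := hne
  obtain ⟨p, hp, hmin⟩ := Finset.exists_min_image (Finset.univ.filter fun p => GeZ (T p) (S p + 1))
    (fun p => 2 * (T p).re + p.row) ⟨p₀, by simpa using hp₀⟩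
  simp only [Finset.mem_filter, Finset.mem_univ, true_and] at hp hmin
  have hrow : p.row < n := lt_of_le_of_ne p.row_le fun h => ne_of_geZ_add_one hp (htop p h).symm
  refine ⟨p, hp, H.lower_mem T hT p hrow ?_ ?_⟩
  · intro y hy h
    have h1 := H.gt_sat hT hy (by rw [h]; exact GeZ.refl _) hS
    have h2 := hmin y ((GeZ.add_one.1 (h ▸ hp)).trans h1)
    rw [hy, h] at h2
    push_cast at h2
    simp at h2
    linarith
  · intro x hx h
    have h1 := H.ge_sat hT hx.symm (by rw [h]; exact GeZ.refl _) hS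
    have h2 := hmin x (by rw [← h]; exact hp.trans (GeZ.add_one.2 h1))
    rw [← hx, ← h] at h2
    push_cast at h2
    linarith

/-- Walk from `T` to `S` inside `B`, each step decreasing the sum of the absolute differences of the
entries. -/
theorem mem_of_satisfies_aux (H : TableauxSet C B) {S : Tableau n} (hS : S.Satisfies C) (N : ℕ) :
    ∀ T ∈ B, ∀ z : Pos n → ℤ, (∀ p, S p - T p = z p) → (∀ p : Pos n, p.row = n → z p = 0) →
      ∑ p, (z p).natAbs = N → S ∈ B := by
  induction N using Nat.strong_induction_on with
  | _ N ih =>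
    intro T hT z hz htop hN
    have htop' : ∀ p : Pos n, p.row = n → S p = T p := fun p hp => by
      have := hz p
      rw [htop p hp, Int.cast_zero] at this
      exact sub_eq_zero.1 this
    have hdec : ∀ (p : Pos n) (s : ℤ), (s = 1 ∧ 0 < z p) ∨ (s = -1 ∧ z p < 0) →
        ∑ q, (z q - if q = p then s else 0).natAbs < N := by
      intro p s hs
      rw [← hN]
      refine Finset.sum_lt_sum (fun q _ => ?_) ⟨p, Finset.mem_univ _, ?_⟩
      · split_ifs with h
        · subst h; omega
        · simp
      · rw [if_pos rfl]; omega
    have hpn : ∀ p, z p ≠ 0 → p.row ≠ n := fun p hp h => hp (htop p h)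
    by_cases hpos : ∃ p, 0 < z p
    · obtain ⟨p₀, hp₀⟩ := hpos
      obtain ⟨p, hp, hm⟩ := H.exists_raise_mem hS hT htop'
        ⟨p₀, geZ_add_one_right.2 ⟨z p₀, hp₀, hz p₀⟩⟩
      obtain ⟨m, hm0, e⟩ := geZ_add_one_right.1 hp
      have hzp : 0 < z p := by
        have : z p = m := by exact_mod_cast (hz p).symm.trans e
        omega
      refine ih _ (hdec p 1 (Or.inl ⟨rfl, hzp⟩)) _ hm (fun q => z q - if q = p then 1 else 0)
        (fun q => ?_) (fun q hq => ?_) rfl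
      · rw [raise_apply]
        push_cast
        rw [← hz q]
        ring
      · rw [htop q hq, if_neg (by rintro rfl; exact hpn q hzp.ne' hq), sub_zero]
    · by_cases hneg : ∃ p, z p < 0
      · obtain ⟨p₀, hp₀⟩ := hneg
        obtain ⟨p, hp, hm⟩ := H.exists_lower_mem hS hT htop'
          ⟨p₀, geZ_add_one_right.2 ⟨-z p₀, by omega, by push_cast; rw [← hz p₀]; ring⟩⟩
        obtain ⟨m, hm0, e⟩ := geZ_add_one_right.1 hp
        have hzp : z p < 0 := by
          have : ((z p : ℤ) : ℂ) = ((-m : ℤ) : ℂ) := by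
            push_cast; rw [← hz p, ← e]; ring
          have : z p = -m := by exact_mod_cast this
          omega
        refine ih _ (hdec p (-1) (Or.inr ⟨rfl, hzp⟩)) _ hm
          (fun q => z q - if q = p then -1 else 0) (fun q => ?_) (fun q hq => ?_) rfl
        · rw [lower_apply]
          split_ifs <;> (push_cast; rw [← hz q]; ring)
        · rw [htop q hq, if_neg (by rintro rfl; exact hpn q hzp.ne hq), sub_zero]
      · have : S = T := funext fun p => by
          have h := hz p
          push Not at hpos hneg
          rw [le_antisymm (hpos p) (hneg p), Int.cast_zero] at h
          exact sub_eq_zero.1 h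
        rwa [this]

theorem mem_of_satisfies (H : TableauxSet C B) {S T : Tableau n} (hT : T ∈ B)
    (hint : ∀ p, IntDiff (S p) (T p)) (htop : ∀ p : Pos n, p.row = n → S p = T p)
    (hS : S.Satisfies C) : S ∈ B := by
  choose z hz using hint
  refine H.mem_of_satisfies_aux hS _ T hT z hz (fun p hp => ?_) rfl
  have := hz p
  rw [htop p hp, sub_self] at this
  exact_mod_cast this.symm

theorem eq_basisSet (H : TableauxSet C B) {T : Tableau n} (hT : T ∈ B) : B = basisSet C T := by
  ext S
  constructor
  · intro hS
    refine ⟨?_, H.sat S hS⟩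
    choose z hz using H.integral S hS T hT
    refine ⟨z, fun p hp => ?_, fun p => by rw [← hz p]; ring⟩
    have := hz p
    rw [H.top S hS T hT p hp, sub_self] at this
    exact_mod_cast this.symm
  · rintro ⟨⟨z, hz0, hz⟩, hS⟩
    refine H.mem_of_satisfies hT (fun p => ⟨z p, by rw [hz]; ring⟩) (fun p hp => ?_) hS
    rw [hz, hz0 p hp, Int.cast_zero, add_zero]

theorem isRealization (H : TableauxSet C B) {T : Tableau n} (hT : T ∈ B) : IsRealization C T :=
  ⟨H.sat T hT, fun R hR => H.noncritical R (by rwa [H.eq_basisSet hT])⟩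

end TableauxSet

end Sets

end GelfandTsetlin
end

/-! ### Separation of the entries of a row by the relations -/

noncomputable section
namespace GelfandTsetlin

section Sets

variable {n : ℕ} {C : Set (Relation n)} {B : Set (Tableau n)}

theorem GeZ.eq_of_sandwich {a b c : ℂ} (h : GeZ a (b + 1)) (h' : GeZ b c) (hac : a = c + 1) :
    b = c := by
  subst hac
  exact GeZ.antisymm h' (GeZ.add_one.1 h)

/-- `C` consists of relations of `𝓡 ∪ 𝓡⁰`: the cases. -/
theorem ge_cases (hC : C ⊆ relR n ∪ relR0 n) {p q : Pos n} (h : .ge p q ∈ C) :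
    p.row = q.row + 1 ∨ (p.row = n ∧ q.row = n ∧ p ≠ q) := by
  rcases hC h with ⟨p', q', hr, he | he⟩ | ⟨p', q', hp, hq, hne, he⟩
  · cases he; exact Or.inl hr
  · cases he
  · cases he; exact Or.inr ⟨hp, hq, hne⟩

theorem gt_cases (hC : C ⊆ relR n ∪ relR0 n) {p q : Pos n} (h : .gt p q ∈ C) :
    q.row = p.row + 1 := by
  rcases hC h with ⟨p', q', hr, he | he⟩ | ⟨p', q', hp, hq, hne, he⟩
  · cases he
  · cases he; exact hr
  · cases he

theorem Tableau.Satisfies.ge {R : Tableau n} (hR : R.Satisfies C) {p q : Pos n}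
    (h : .ge p q ∈ C) : GeZ (R p) (R q) := hR _ h

theorem Tableau.Satisfies.gt {R : Tableau n} (hR : R.Satisfies C) {p q : Pos n}
    (h : .gt p q ∈ C) : GeZ (R p) (R q + 1) := satisfiesRel_gt.1 (hR _ h)

/-- Neighbouring entries of a row that are separated by the row below are separated by the row
above. -/
def TangentAbove (C : Set (Relation n)) (R : Tableau n) : Prop :=
  ∀ p q x : Pos n, p.row = q.row → p.row < n → R p = R q + 1 → .ge p x ∈ C → .gt x q ∈ C →
    ∃ y, y.row = p.row + 1 ∧ .gt p y ∈ C ∧ .ge y q ∈ C ∧ R y = R q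

/-- Lower `a` together with everything that tight relations force to be lowered. The cascade only
descends: if it had to turn upwards, `TangentAbove` would provide a tight strict relation from an
already lowered entry to the row above it, tracing back to one at `a`. -/
theorem exists_lowered (hC : C ⊆ relR n ∪ relR0 n) {R : Tableau n} (hR : R.Satisfies C)
    (htan : TangentAbove C R) {a : Pos n} (ha : a.row < n)
    (hno : ∀ y, .gt a y ∈ C → R a ≠ R y + 1) :
    ∃ R' : Tableau n, R'.Satisfies C ∧ (∀ p, IntDiff (R' p) (R p)) ∧ R' a = R a - 1 ∧
      ∀ p, a.row ≤ p.row → p ≠ a → R' p = R p := by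
  classical
  let blocks : Pos n → Pos n → Prop := fun s t =>
    (.ge s t ∈ C ∧ R s = R t) ∨ (.gt s t ∈ C ∧ R s = R t + 1)
  -- The cascade: all positions reachable from `a` through relations that are tight in `R`.
  let S : Set (Pos n) := {s | Relation.ReflTransGen blocks a s}
  have hinv : ∀ s ∈ S, s.row ≤ a.row ∧ (s.row = a.row → s = a) ∧
      ∀ y, .gt s y ∈ C → R s ≠ R y + 1 := by
    intro s hs
    induction hs with
    | refl => exact ⟨le_rfl, fun _ => rfl, hno⟩
    | @tail s t _ hst ih =>
      obtain ⟨h1, h2, h3⟩ := ih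
      rcases hst with ⟨hge, he⟩ | ⟨hgt, he⟩
      · have hrow := (ge_cases hC hge).resolve_right fun h => by omega
        refine ⟨by omega, fun h => by omega, fun y hy he' => ?_⟩
        have hyr := gt_cases hC hy
        obtain ⟨z, -, hz, -, hz'⟩ := htan s y t (by omega) (by omega) (by rw [he, he']) hge hy
        exact h3 z hz (by rw [hz', he, he'])
      · exact absurd he (h3 t hgt)
  refine ⟨fun p => R p - if p ∈ S then 1 else 0, ?_, fun p => ?_, ?_, fun p hp hne => ?_⟩
  · intro r hr
    rcases r with ⟨p, q⟩ | ⟨p, q⟩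
    · have h := hR.ge hr
      rw [satisfiesRel_ge]
      by_cases hp : p ∈ S
      · by_cases hq : q ∈ S
        · simp only [if_pos hp, if_pos hq]
          rw [← GeZ.add_one]; simpa using h
        · simp only [if_pos hp, if_neg hq, sub_zero]
          rw [← GeZ.add_one, sub_add_cancel]
          exact h.eq_or.resolve_left fun he => hq (Relation.ReflTransGen.tail hp (Or.inl ⟨hr, he⟩))
      · simp only [if_neg hp, sub_zero]
        refine h.trans ?_
        split_ifs
        · exact ⟨1, by norm_num, by simp⟩
        · rw [sub_zero]; exact GeZ.refl _
    · have h := hR.gt hr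
      rw [satisfiesRel_gt]
      by_cases hp : p ∈ S
      · by_cases hq : q ∈ S
        · simp only [if_pos hp, if_pos hq]
          rw [← GeZ.add_one]; simpa using h
        · simp only [if_pos hp, if_neg hq, sub_zero]
          rw [← GeZ.add_one, sub_add_cancel]
          exact h.eq_or.resolve_left fun he => hq (Relation.ReflTransGen.tail hp (Or.inr ⟨hr, he⟩))
      · simp only [if_neg hp, sub_zero]
        refine h.trans ?_
        split_ifs
        · exact ⟨1, by norm_num, by simp⟩
        · rw [sub_zero]; exact GeZ.refl _
  · dsimp only
    split_ifs
    · exact ⟨-1, by simp⟩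
    · exact ⟨0, by simp⟩
  · dsimp only
    rw [if_pos (show a ∈ S from Relation.ReflTransGen.refl)]
  · dsimp only
    rw [if_neg, sub_zero]
    intro hpS
    obtain ⟨h1, h2, -⟩ := hinv p hpS
    exact hne (h2 (le_antisymm h1 hp))

theorem exists_raised (hC : C ⊆ relR n ∪ relR0 n) {R : Tableau n} (hR : R.Satisfies C)
    (htan : TangentAbove C R) {a : Pos n} (ha : a.row < n)
    (hno : ∀ y, .ge y a ∈ C → R y ≠ R a) :
    ∃ R' : Tableau n, R'.Satisfies C ∧ (∀ p, IntDiff (R' p) (R p)) ∧ R' a = R a + 1 ∧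
      ∀ p, a.row ≤ p.row → p ≠ a → R' p = R p := by
  classical
  let blocks : Pos n → Pos n → Prop := fun s t =>
    (.ge t s ∈ C ∧ R t = R s) ∨ (.gt t s ∈ C ∧ R t = R s + 1)
  let S : Set (Pos n) := {s | Relation.ReflTransGen blocks a s}
  have hinv : ∀ s ∈ S, s.row ≤ a.row ∧ (s.row = a.row → s = a) ∧
      ∀ y, .ge y s ∈ C → R y ≠ R s := by
    intro s hs
    induction hs with
    | refl => exact ⟨le_rfl, fun _ => rfl, hno⟩
    | @tail s t _ hst ih =>
      obtain ⟨h1, h2, h3⟩ := ih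
      rcases hst with ⟨hge, he⟩ | ⟨hgt, he⟩
      · exact absurd he (h3 t hge)
      · have hrow := gt_cases hC hgt
        refine ⟨by omega, fun h => by omega, fun y hy he' => ?_⟩
        have hyr := (ge_cases hC hy).resolve_right fun h => by omega
        obtain ⟨z, -, -, hz, hz'⟩ := htan y s t (by omega) (by omega) (by rw [he', he]) hy hgt
        exact h3 z hz hz'
  refine ⟨fun p => R p + if p ∈ S then 1 else 0, ?_, fun p => ?_, ?_, fun p hp hne => ?_⟩
  · intro r hr
    rcases r with ⟨p, q⟩ | ⟨p, q⟩
    · have h := hR.ge hr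
      rw [satisfiesRel_ge]
      by_cases hq : q ∈ S
      · by_cases hp : p ∈ S
        · simp only [if_pos hp, if_pos hq]
          exact GeZ.add_one.2 h
        · simp only [if_pos hq, if_neg hp, add_zero]
          exact h.eq_or.resolve_left fun he => hp (Relation.ReflTransGen.tail hq (Or.inl ⟨hr, he⟩))
      · simp only [if_neg hq, add_zero]
        refine GeZ.trans ?_ h
        split_ifs
        · exact geZ_add_one_self _
        · rw [add_zero]; exact GeZ.refl _
    · have h := hR.gt hr
      rw [satisfiesRel_gt]
      by_cases hq : q ∈ S
      · by_cases hp : p ∈ S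
        · simp only [if_pos hp, if_pos hq]
          exact GeZ.add_one.2 h
        · simp only [if_pos hq, if_neg hp, add_zero]
          exact h.eq_or.resolve_left fun he => hp (Relation.ReflTransGen.tail hq (Or.inr ⟨hr, he⟩))
      · simp only [if_neg hq, add_zero]
        refine GeZ.trans ?_ h
        split_ifs
        · exact geZ_add_one_self _
        · rw [add_zero]; exact GeZ.refl _
  · dsimp only
    split_ifs
    · exact ⟨1, by simp⟩
    · exact ⟨0, by simp⟩
  · dsimp only
    rw [if_pos (show a ∈ S from Relation.ReflTransGen.refl)]
  · dsimp only
    rw [if_neg, add_zero]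
    intro hpS
    obtain ⟨h1, h2, -⟩ := hinv p hpS
    exact hne (h2 (le_antisymm h1 hp))

/-- The ways in which the relations separate two entries of a row. -/
def Separated (C : Set (Relation n)) (a b : Pos n) : Prop :=
  (∃ y x, .gt a y ∈ C ∧ .ge y b ∈ C ∧ .ge a x ∈ C ∧ .gt x b ∈ C) ∨
  (∃ y y', y ≠ y' ∧ .gt a y ∈ C ∧ .ge y y' ∈ C ∧ .ge y' b ∈ C ∧ .gt a y' ∈ C) ∨
  ∀ R : Tableau n, R.Satisfies C → GeZ (R a) (R b + 1 + 1)

theorem Separated.geZ {a b : Pos n} (h : Separated C a b) {R : Tableau n} (hR : R.Satisfies C) :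
    GeZ (R a) (R b + 1) := by
  rcases h with ⟨y, x, h1, h2, -, -⟩ | ⟨y, y', -, -, -, h3, h4⟩ | h
  · exact (hR.gt h1).trans (GeZ.add_one.2 (hR.ge h2))
  · exact (hR.gt h4).trans (GeZ.add_one.2 (hR.ge h3))
  · exact (h R hR).of_add_one

theorem ne_of_geZ_add_two {a b : ℂ} (h : GeZ a (b + 1 + 1)) : a ≠ b + 1 := by
  rintro rfl
  exact not_geZ_of_geZ_add_one h (GeZ.refl _)

namespace TableauxSet

/-- The alternative for entries of `B` whose difference is one, in terms of relations. -/
theorem tangent_relations (H : TableauxSet C B) {T : Tableau n} (hT : T ∈ B) {p q : Pos n}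
    (hpq : p.row = q.row) (hp : p.row < n) (h : T p = T q + 1) :
    ∃ y, y.row = p.row + 1 ∧ .gt p y ∈ C ∧ .ge y q ∈ C ∧ T y = T q ∧
      ((∃ x, .ge p x ∈ C ∧ .gt x q ∈ C) ∨ ∃ y', y ≠ y' ∧ .ge y y' ∈ C ∧ .ge y' q ∈ C ∧
        .gt p y' ∈ C) := by
  have hgt : ∀ y : Pos n, y.row = p.row + 1 → T y = T q → .gt p y ∈ C := fun y hy e =>
    H.gt_mem T hT p y hy (by rw [e, h]; exact GeZ.refl _)
  have hge : ∀ y : Pos n, y.row = p.row + 1 → T y = T q → .ge y q ∈ C := fun y hy e =>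
    H.ge_mem T hT y q (by omega) (by rw [e]; exact GeZ.refl _)
  rcases H.tangent T hT p q hpq hp h with ⟨⟨y, hy, e⟩, x, hx, e'⟩ | ⟨y, y', hne, hy, hy', e, e'⟩
  · refine ⟨y, hy, hgt y hy e, hge y hy e, e, Or.inl ⟨x, ?_, ?_⟩⟩
    · exact H.ge_mem T hT p x hx.symm (by rw [e']; exact GeZ.refl _)
    · exact H.gt_mem T hT x q (by omega) (by rw [e', h]; exact GeZ.refl _)
  · refine ⟨y, hy, hgt y hy e, hge y hy e, e, Or.inr ⟨y', hne, ?_, hge y' hy' e', hgt y' hy' e'⟩⟩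
    have hn : y.row = n := by
      by_contra hn
      exact H.noncritical T hT y y' (by omega) (by have := y.row_le; omega) hne (e.trans e'.symm)
    exact H.top_mem T hT y y' hn (by omega) hne (by rw [e, e']; exact GeZ.refl _)

theorem tangentAbove_of_mem (H : TableauxSet C B) {T : Tableau n} (hT : T ∈ B) :
    TangentAbove C T := by
  intro p q x hpq hp h _ _
  obtain ⟨y, hy, h1, h2, h3, -⟩ := H.tangent_relations hT hpq hp h
  exact ⟨y, hy, h1, h2, h3⟩

theorem mem_of_modified (H : TableauxSet C B) {T R : Tableau n} (hT : T ∈ B)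
    (hint : ∀ p, IntDiff (R p) (T p)) (hR : R.Satisfies C) {a : Pos n} (ha : a.row < n)
    (heq : ∀ p, a.row ≤ p.row → p ≠ a → R p = T p) : R ∈ B :=
  H.mem_of_satisfies hT hint
    (fun p hp => heq p (by omega) (by rintro rfl; omega)) hR

/-- Induction on the difference: lower `a` or raise `b` inside `B` as long as this is possible. If
both are stuck while the difference exceeds one, they are held by entries `y` and `y'` of the row
above, also at a positive difference. In the top row this is the second alternative; otherwise `y`
and `y'` are separated, and inserting them between `a` and `b` gives a difference of at least two
whenever `C` holds. -/
theorem separated_aux (H : TableauxSet C B) {a b : Pos n} (hab : a.row = b.row) (ha : a.row < n)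
    (hup : ∀ y y' : Pos n, y.row = a.row + 1 → y'.row = a.row + 1 → y.row < n → ∀ T ∈ B,
      GeZ (T y) (T y' + 1) → Separated C y y') (m : ℕ) :
    ∀ T ∈ B, T a = T b + m + 1 → Separated C a b := by
  have hne : ∀ T : Tableau n, ∀ m : ℕ, T a = T b + m + 1 → a ≠ b := by
    rintro T m h rfl
    have : ((m + 1 : ℕ) : ℂ) = 0 := by push_cast; linear_combination -h
    exact Nat.succ_ne_zero m (by exact_mod_cast this)
  induction m with
  | zero =>
    intro T hT h
    obtain ⟨y, hy, h1, h2, -, ⟨x, h3, h4⟩ | ⟨y', h3, h4, h5, h6⟩⟩ :=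
      H.tangent_relations hT hab ha (by simpa using h)
    · exact Or.inl ⟨y, x, h1, h2, h3, h4⟩
    · exact Or.inr (Or.inl ⟨y, y', h3, h1, h4, h5, h6⟩)
  | succ m ih =>
    intro T hT h
    have hne' := hne T _ h
    by_cases h1 : ∀ y, .gt a y ∈ C → T a ≠ T y + 1
    · obtain ⟨R, hR, hint, ha', hR'⟩ :=
        exists_lowered H.subset (H.sat T hT) (H.tangentAbove_of_mem hT) ha h1
      refine ih R (H.mem_of_modified hT hint hR ha hR') ?_
      rw [ha', hR' b hab.le hne'.symm, h]
      push_cast; ring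
    by_cases h2 : ∀ y, .ge y b ∈ C → T y ≠ T b
    · obtain ⟨R, hR, hint, hb', hR'⟩ :=
        exists_raised H.subset (H.sat T hT) (H.tangentAbove_of_mem hT) (by omega) h2
      refine ih R (H.mem_of_modified hT hint hR (by omega) hR') ?_
      rw [hb', hR' a hab.ge hne', h]
      push_cast; ring
    push Not at h1 h2
    obtain ⟨y, hy, e⟩ := h1
    obtain ⟨y', hy', e'⟩ := h2
    have hyr := gt_cases H.subset hy
    have hyr' := (ge_cases H.subset hy').resolve_right fun h => by omega
    have hyy : GeZ (T y) (T y' + 1) := ⟨m, by omega, by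
      rw [e', eq_sub_of_add_eq e.symm, h]; push_cast; ring⟩
    have hyne : y ≠ y' := by
      rintro rfl
      exact not_geZ_of_geZ_add_one hyy (GeZ.refl _)
    by_cases hn : y.row = n
    · refine Or.inr (Or.inl ⟨y, y', hyne, hy, ?_, hy', ?_⟩)
      · exact H.top_mem T hT y y' hn (by omega) hyne hyy.of_add_one
      · exact H.gt_mem T hT a y' (by omega) (by rw [e]; exact GeZ.add_one.2 hyy.of_add_one)
    · have hsep := hup y y' hyr (by omega) (by have := y.row_le; omega) T hT hyy
      exact Or.inr (Or.inr fun R hR => (hR.gt hy).trans (GeZ.add_one.2 ((hsep.geZ hR).trans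
        (GeZ.add_one.2 (hR.ge hy')))))

/-- Entries of a row of a tableau of `B` with a positive integral difference are separated. -/
theorem separated (H : TableauxSet C B) (d : ℕ) : ∀ a b : Pos n, a.row = b.row →
    a.row < n → n ≤ a.row + d → ∀ T ∈ B, GeZ (T a) (T b + 1) → Separated C a b := by
  induction d with
  | zero => intro a b _ h1 h2; omega
  | succ d ih =>
    intro a b hab ha hd T hT h
    obtain ⟨m, hm, e⟩ := h
    refine H.separated_aux hab ha (fun y y' hy hy' hn => ih y y' (by omega) hn (by omega))
      m.toNat T hT ?_
    have : ((m.toNat : ℕ) : ℂ) = m := by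
      rw [← Int.cast_natCast, Int.toNat_of_nonneg hm]
    rw [this, ← e]; ring

/-- Separation is proved with a tableau of `B`, but its conclusions concern `C` alone, so they apply
to every `R` that satisfies `C`. -/
theorem tangentAbove (H : TableauxSet C B) {R : Tableau n} (hR : R.Satisfies C) :
    TangentAbove C R := by
  intro p q x hpq hp h hpx hxq
  obtain ⟨T, hT⟩ := H.nonempty
  have hT' := H.sat T hT
  have hsep := H.separated n p q hpq hp (by omega) T hT
    ((hT'.ge hpx).trans (hT'.gt hxq))
  rcases hsep with ⟨y, x, h1, h2, -, -⟩ | ⟨y, y', -, -, -, h3, h4⟩ | h5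
  · exact ⟨y, gt_cases H.subset h1, h1, h2, (hR.gt h1).eq_of_sandwich (hR.ge h2) h⟩
  · exact ⟨y', gt_cases H.subset h4, h4, h3, (hR.gt h4).eq_of_sandwich (hR.ge h3) h⟩
  · exact absurd h (ne_of_geZ_add_two (h5 R hR))

end TableauxSet

theorem basisSet_of_modified {L R R' : Tableau n} (hR : R ∈ basisSet C L)
    (hint : ∀ p, IntDiff (R' p) (R p)) (hR' : R'.Satisfies C)
    (htop : ∀ p : Pos n, p.row = n → R' p = R p) : R' ∈ basisSet C L := by
  obtain ⟨⟨z, hz0, hz⟩, -⟩ := hR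
  choose w hw using hint
  refine ⟨⟨fun p => z p + w p, fun p hp => ?_, fun p => ?_⟩, hR'⟩
  · have := hw p
    rw [htop p hp, sub_self] at this
    dsimp only
    rw [hz0 p hp, zero_add]
    exact_mod_cast this.symm
  · push_cast
    rw [← hw, hz]; ring

namespace TableauxSet

/-- In a realization neighbouring entries of a row with difference one are separated. -/
theorem tangent_realization (H : TableauxSet C B) {L : Tableau n} (hL : IsRealization C L)
    {R : Tableau n} (hR : R ∈ basisSet C L) {p q : Pos n} (hpq : p.row = q.row) (hp : p.row < n)
    (h : R p = R q + 1) :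
    ∃ y y', .gt p y ∈ C ∧ .ge y' q ∈ C ∧ R y = R q ∧ R y' = R q ∧ y.row = p.row + 1 ∧
      y'.row = p.row + 1 ∧
      ((p.row + 1 = n ∧ y ≠ y') ∨ ∃ x, x.row + 1 = p.row ∧ .ge p x ∈ C ∧ .gt x q ∈ C ∧
        R x = R p) := by
  have hsat := hR.2
  have hne : p ≠ q := by rintro rfl; simp at h
  -- Otherwise `p` could be lowered onto the value of `q`, giving a critical tableau in the
  -- realization.
  have h1 : ∃ y, .gt p y ∈ C ∧ R p = R y + 1 := by
    by_contra hno
    push Not at hno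
    obtain ⟨R', hR', hint, hp', heq⟩ := exists_lowered H.subset hsat (H.tangentAbove hsat) hp hno
    refine hL.2 R' (basisSet_of_modified hR hint hR' fun t ht => heq t (by omega)
      (by rintro rfl; omega)) p q hpq hp hne ?_
    rw [hp', heq q hpq.le hne.symm, h]; ring
  have h2 : ∃ y', .ge y' q ∈ C ∧ R y' = R q := by
    by_contra hno
    push Not at hno
    obtain ⟨R', hR', hint, hq', heq⟩ :=
      exists_raised H.subset hsat (H.tangentAbove hsat) (by omega : q.row < n) hno
    refine hL.2 R' (basisSet_of_modified hR hint hR' fun t ht => heq t (by omega)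
      (by rintro rfl; omega)) p q hpq hp hne ?_
    rw [hq', heq p hpq.ge hne, h]
  obtain ⟨y, hy, e⟩ := h1
  obtain ⟨y', hy', e'⟩ := h2
  have hyr := gt_cases H.subset hy
  have hyr' := (ge_cases H.subset hy').resolve_right fun h => by omega
  have e2 : R y = R q := add_right_cancel (e.symm.trans h)
  -- If the two entries differ, they are equal values in one row, which noncriticality permits only
  -- in the top row.
  by_cases hyy : y = y'
  · subst hyy
    obtain ⟨T, hT⟩ := H.nonempty
    have hT' := H.sat T hT
    have hsep := H.separated n p q hpq hp (by omega) T hT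
      ((hT'.gt hy).trans (GeZ.add_one.2 (hT'.ge hy')))
    rcases hsep with ⟨_, x, -, -, h3, h4⟩ | ⟨u, u', hu, h3, h4, h5, h6⟩ | h5
    · have hx := gt_cases H.subset h4
      have hsand := hsat.gt h4
      have h7 := hsat.ge h3
      refine ⟨y, y, hy, hy', e2, e2, hyr, by omega, Or.inr ⟨x, by omega, h3, h4, ?_⟩⟩
      rw [h] at h7 ⊢
      exact GeZ.antisymm hsand h7
    · have hur := gt_cases H.subset h3
      have hur' := gt_cases H.subset h6
      have hun : u.row = n := by
        rcases ge_cases H.subset h4 with h | h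
        · omega
        · exact h.1
      have e5 : R u' = R q := (hsat.gt h6).eq_of_sandwich (hsat.ge h5) h
      have e4 : R u = R q := (hsat.gt h3).eq_of_sandwich ((hsat.ge h4).trans (hsat.ge h5)) h
      exact ⟨u, u', h3, h5, e4, e5, hur, hur', Or.inl ⟨by omega, hu⟩⟩
    · exact absurd h (ne_of_geZ_add_two (h5 R hsat))
  · refine ⟨y, y', hy, hy', e2, e', hyr, by omega, Or.inl ⟨?_, hyy⟩⟩
    by_contra hn
    exact hL.2 R hR y y' (by omega) (by have := y.row_le; omega) hyy (e2.trans e'.symm)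

end TableauxSet

end Sets

end GelfandTsetlin
end

noncomputable section
namespace GelfandTsetlin

/-! ### Truncated raising and lowering operators -/

section Moves

variable {n : ℕ}

/-- `L + σ δ^p`. -/
def Tableau.move (σ : ℂ) (L : Tableau n) (p : Pos n) : Tableau n := L + Pi.single p σ

theorem move_apply (σ : ℂ) (L : Tableau n) (p q : Pos n) :
    L.move σ p q = L q + if q = p then σ else 0 := by
  simp [Tableau.move, Pi.single_apply]

theorem move_self (σ : ℂ) (L : Tableau n) (p : Pos n) : L.move σ p p = L p + σ := by
  simp [move_apply]

theorem move_of_ne (σ : ℂ) (L : Tableau n) {p q : Pos n} (h : q ≠ p) : L.move σ p q = L q := by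
  simp [move_apply, h]

theorem move_comm (σ τ : ℂ) (L : Tableau n) (p q : Pos n) :
    (L.move σ p).move τ q = (L.move τ q).move σ p := add_right_comm _ _ _

/-- The coefficient of the move of `p` in a system of moves in which the row `nb k` gives the zeros
of the coefficients of the moves in row `k`. -/
def moveCoeff (nb : ℕ → ℕ) (L : Tableau n) (p : Pos n) : ℂ :=
  (∏ q ∈ rowSet n (nb p.row), (L p - L q)) / ∏ q ∈ (rowSet n p.row).erase p, (L p - L q)

theorem moveCoeff_eq_zero {nb : ℕ → ℕ} {L : Tableau n} {p y : Pos n} (hy : y.row = nb p.row)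
    (h : L p = L y) : moveCoeff nb L p = 0 := by
  rw [moveCoeff, Finset.prod_eq_zero (mem_rowSet.2 hy) (sub_eq_zero.2 h), zero_div]

theorem moveCoeff_congr {nb : ℕ → ℕ} {R R' : Tableau n} {p : Pos n}
    (h : ∀ t : Pos n, t.row = p.row ∨ t.row = nb p.row → R' t = R t) :
    moveCoeff nb R' p = moveCoeff nb R p := by
  have hp := h p (Or.inl rfl)
  rw [moveCoeff, moveCoeff, hp]
  congr 1
  · exact Finset.prod_congr rfl fun q hq => by rw [h q (Or.inr (mem_rowSet.1 hq))]
  · exact Finset.prod_congr rfl fun q hq => by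
      rw [h q (Or.inl (mem_rowSet.1 (Finset.mem_of_mem_erase hq)))]

theorem moveCoeff_move {nb : ℕ → ℕ} {R : Tableau n} {p q : Pos n} (h1 : q.row ≠ p.row)
    (h2 : q.row ≠ nb p.row) (σ : ℂ) : moveCoeff nb (R.move σ q) p = moveCoeff nb R p :=
  moveCoeff_congr fun t ht => move_of_ne σ R (by rintro rfl; exact ht.elim h1 h2)

/-- Isolates how the coefficient depends on one entry, with `g` independent of that entry. Here and
in the next lemmas this reduces the Serre relations to identities in a few variables. -/
theorem exists_moveCoeff_eq {nb : ℕ → ℕ} {R : Tableau n} {p q : Pos n} (hq : q.row = nb p.row)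
    (hpq : q.row ≠ p.row) : ∃ g, ∀ R' : Tableau n, (∀ t, t ≠ q → R' t = R t) →
      moveCoeff nb R' p = (R p - R' q) * g := by
  refine ⟨(∏ t ∈ (rowSet n (nb p.row)).erase q, (R p - R t)) /
    ∏ t ∈ (rowSet n p.row).erase p, (R p - R t), fun R' h => ?_⟩
  have hp : R' p = R p := h p (by rintro rfl; exact hpq rfl)
  rw [moveCoeff, ← Finset.mul_prod_erase _ _ (mem_rowSet.2 hq), hp, mul_div_assoc]
  congr 2
  · exact Finset.prod_congr rfl fun t ht => by rw [h t (Finset.ne_of_mem_erase ht)]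
  · refine Finset.prod_congr rfl fun t ht => ?_
    rw [h t]
    rintro rfl
    exact hpq (mem_rowSet.1 (Finset.mem_of_mem_erase ht))

theorem exists_moveCoeff_eq_div {nb : ℕ → ℕ} {R : Tableau n} {p p' q : Pos n}
    (hq : q.row = nb p.row) (hpq : q.row ≠ p.row) (hpp : p ≠ p') (hrow : p.row = p'.row) :
    ∃ g, ∀ R' : Tableau n, (∀ t, t ≠ q → t ≠ p' → R' t = R t) →
      moveCoeff nb R' p = (R p - R' q) * g / (R p - R' p') := by
  refine ⟨(∏ t ∈ (rowSet n (nb p.row)).erase q, (R p - R t)) /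
    ∏ t ∈ ((rowSet n p.row).erase p).erase p', (R p - R t), fun R' h => ?_⟩
  have hp : R' p = R p := h p (by rintro rfl; exact hpq rfl) hpp
  rw [moveCoeff, ← Finset.mul_prod_erase _ _ (mem_rowSet.2 hq),
    ← Finset.mul_prod_erase ((rowSet n p.row).erase p) _
      (Finset.mem_erase.2 ⟨hpp.symm, mem_rowSet.2 hrow.symm⟩), hp]
  have e1 : ∏ t ∈ (rowSet n (nb p.row)).erase q, (R p - R' t) =
      ∏ t ∈ (rowSet n (nb p.row)).erase q, (R p - R t) :=
    Finset.prod_congr rfl fun t ht => by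
      rw [h t (Finset.ne_of_mem_erase ht)]
      rintro rfl
      have := mem_rowSet.1 (Finset.mem_of_mem_erase ht)
      exact hpq (by rw [hq, ← this, hrow])
  have e2 : ∏ t ∈ ((rowSet n p.row).erase p).erase p', (R p - R' t) =
      ∏ t ∈ ((rowSet n p.row).erase p).erase p', (R p - R t) :=
    Finset.prod_congr rfl fun t ht => by
      rw [h t _ (Finset.ne_of_mem_erase ht)]
      rintro rfl
      exact hpq (mem_rowSet.1 (Finset.mem_of_mem_erase (Finset.mem_of_mem_erase ht)))
  rw [e1, e2, ← mul_div_assoc, div_div, mul_comm (R p - R' p')]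

theorem exists_moveCoeff_eq_div_sub {nb : ℕ → ℕ} {R : Tableau n} {q q' : Pos n}
    (hnb : nb q.row ≠ q.row) (hqq : q ≠ q') (hrow : q.row = q'.row) :
    ∃ g, ∀ R' : Tableau n,
      (∀ t : Pos n, t.row = q.row ∨ t.row = nb q.row → t ≠ q' → R' t = R t) →
      moveCoeff nb R' q = g / (R q - R' q') := by
  refine ⟨(∏ t ∈ rowSet n (nb q.row), (R q - R t)) /
    ∏ t ∈ ((rowSet n q.row).erase q).erase q', (R q - R t), fun R' h => ?_⟩
  have hp : R' q = R q := h q (Or.inl rfl) hqq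
  rw [moveCoeff, ← Finset.mul_prod_erase ((rowSet n q.row).erase q) _
      (Finset.mem_erase.2 ⟨hqq.symm, mem_rowSet.2 hrow.symm⟩), hp]
  have e1 : ∏ t ∈ rowSet n (nb q.row), (R q - R' t) = ∏ t ∈ rowSet n (nb q.row), (R q - R t) :=
    Finset.prod_congr rfl fun t ht => by
      have ht' := mem_rowSet.1 ht
      rw [h t (Or.inr ht')]
      rintro rfl
      exact hnb (by rw [← ht', hrow])
  have e2 : ∏ t ∈ ((rowSet n q.row).erase q).erase q', (R q - R' t) =
      ∏ t ∈ ((rowSet n q.row).erase q).erase q', (R q - R t) :=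
    Finset.prod_congr rfl fun t ht => by
      rw [h t (Or.inl (mem_rowSet.1 (Finset.mem_of_mem_erase (Finset.mem_of_mem_erase ht))))
        (Finset.ne_of_mem_erase ht)]
  rw [e1, e2, div_div, mul_comm (R q - R' q')]

theorem exists_moveCoeff_eq_mul {nb : ℕ → ℕ} {R : Tableau n} {p q q' : Pos n}
    (hq : q.row = nb p.row) (hpq : q.row ≠ p.row) (hqq : q ≠ q') (hrow : q.row = q'.row) :
    ∃ g, ∀ R' : Tableau n, (∀ t, t ≠ q → t ≠ q' → R' t = R t) →
      moveCoeff nb R' p = (R p - R' q) * (R p - R' q') * g := by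
  refine ⟨(∏ t ∈ ((rowSet n (nb p.row)).erase q).erase q', (R p - R t)) /
    ∏ t ∈ (rowSet n p.row).erase p, (R p - R t), fun R' h => ?_⟩
  have hp : R' p = R p := h p (by rintro rfl; exact hpq rfl)
    (by rintro rfl; exact hpq hrow)
  rw [moveCoeff, ← Finset.mul_prod_erase _ _ (mem_rowSet.2 hq),
    ← Finset.mul_prod_erase ((rowSet n (nb p.row)).erase q) _
      (Finset.mem_erase.2 ⟨hqq.symm, mem_rowSet.2 (hrow ▸ hq)⟩), hp, ← mul_assoc, mul_div_assoc]
  congr 2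
  · refine Finset.prod_congr rfl fun t ht => ?_
    rw [h t (Finset.ne_of_mem_erase (Finset.mem_of_mem_erase ht)) (Finset.ne_of_mem_erase ht)]
  · refine Finset.prod_congr rfl fun t ht => ?_
    have ht' := mem_rowSet.1 (Finset.mem_of_mem_erase ht)
    rw [h t]
    · rintro rfl
      exact hpq ht'
    · rintro rfl
      exact hpq (hrow.trans ht')

/-- A set of tableaux with the moves `L ↦ L + σ δ^p`: a move that leaves the set has coefficient
zero, or it moves an entry to one that has to be moved before. -/
structure MoveSystem (B : Set (Tableau n)) (σ : ℂ) (nb : ℕ → ℕ) : Prop where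
  sigma_ne_zero : σ ≠ 0
  noncritical : ∀ R ∈ B, R.Noncritical
  block : ∀ R ∈ B, ∀ a : Pos n, a.row < n → R.move σ a ∉ B →
    (∃ y : Pos n, y.row = nb a.row ∧ R a = R y) ∨
    ∃ x : Pos n, a.row = nb x.row ∧ R x = R a + σ ∧ ∀ S ∈ B, ∀ m : ℕ, S a ≠ S x + m * σ
  tangent : ∀ R ∈ B, ∀ p p' : Pos n, p.row = p'.row → p.row < n → R p' = R p + σ →
    ∀ S ∈ B, S p = R p + σ → (∃ y : Pos n, y.row = p.row + 1 ∧ S y ≠ R y) ∧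
      (p.row + 1 = n ∨ ∃ x : Pos n, x.row + 1 = p.row ∧ S x ≠ R x)

namespace MoveSystem

variable {B : Set (Tableau n)} {σ : ℂ} {nb : ℕ → ℕ}

/-- If the first move leaves `B` with nonzero coefficient, an entry `x` at distance `σ` stands in
its way. Either the second move is that of `x`, whose coefficient now vanishes because `a` has
reached its value, or the result violates the separation of `a` and `x` in `B`. -/
theorem coeff_mul_eq_zero (H : MoveSystem B σ nb) {R : Tableau n} (hR : R ∈ B) {a b : Pos n}
    (ha : a.row < n) (hS : (R.move σ a).move σ b ∈ B) (h : R.move σ a ∉ B) :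
    moveCoeff nb R a * moveCoeff nb (R.move σ a) b = 0 := by
  rcases H.block R hR a ha h with ⟨y, hy, e⟩ | ⟨x, hx, e, hsep⟩
  · rw [moveCoeff_eq_zero hy e, zero_mul]
  · have hxa : x ≠ a := by
      rintro rfl
      exact H.sigma_ne_zero (by simpa using e)
    by_cases hb : b = x
    · subst hb
      rw [moveCoeff_eq_zero (p := b) hx (by rw [move_self, move_of_ne _ _ hxa, e]), mul_zero]
    · exfalso
      by_cases hab : a = b
      · subst hab
        apply hsep _ hS 1
        rw [move_self, move_self, move_of_ne _ _ hxa, move_of_ne _ _ hxa, e]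
        push_cast; ring
      · apply hsep _ hS 0
        rw [move_of_ne _ _ hab, move_self, move_of_ne _ _ (Ne.symm hb), move_of_ne _ _ hxa, e]
        push_cast; ring

theorem coeff_mul_mul_eq_zero (H : MoveSystem B σ nb) {R : Tableau n} (hR : R ∈ B)
    {a b c : Pos n} (ha : a.row < n) (hS : ((R.move σ a).move σ b).move σ c ∈ B)
    (h : R.move σ a ∉ B) : moveCoeff nb R a * moveCoeff nb (R.move σ a) b *
      moveCoeff nb ((R.move σ a).move σ b) c = 0 := by
  rcases H.block R hR a ha h with ⟨y, hy, e⟩ | ⟨x, hx, e, hsep⟩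
  · rw [moveCoeff_eq_zero hy e, zero_mul, zero_mul]
  · have hxa : x ≠ a := by
      rintro rfl
      exact H.sigma_ne_zero (by simpa using e)
    by_cases hb : b = x
    · subst hb
      rw [moveCoeff_eq_zero (p := b) hx (by rw [move_self, move_of_ne _ _ hxa, e]), mul_zero,
        zero_mul]
    by_cases hc : c = x
    · subst hc
      by_cases hab : a = b
      · subst hab
        exfalso
        apply hsep _ hS 0
        simp only [move_apply, if_true, if_neg hxa, if_neg hxa.symm, e]
        push_cast; ring
      · rw [moveCoeff_eq_zero (p := c) hx, mul_zero]
        simp only [move_apply, if_true, if_neg hxa, if_neg (Ne.symm hb), if_neg hab, e]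
        ring
    · exfalso
      have hxb := Ne.symm hb
      have hxc := Ne.symm hc
      by_cases hab : a = b <;> by_cases hac : a = c
      · apply hsep _ hS 2
        simp only [move_apply, if_pos hab, if_pos hac, if_neg hxa, if_neg hxb, if_neg hxc, e, if_true]
        push_cast; ring
      · apply hsep _ hS 1
        simp only [move_apply, if_pos hab, if_neg hac, if_neg hxa, if_neg hxb, if_neg hxc, e, if_true]
        push_cast; ring
      · apply hsep _ hS 1
        simp only [move_apply, if_neg hab, if_pos hac, if_neg hxa, if_neg hxb, if_neg hxc, e, if_true]
        push_cast; ring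
      · apply hsep _ hS 0
        simp only [move_apply, if_neg hab, if_neg hac, if_neg hxa, if_neg hxb, if_neg hxc, e, if_true]
        push_cast; ring

end MoveSystem

section Operators

variable {B : Set (Tableau n)} {W : Type*} [AddCommGroup W] [Module ℂ W]
  (b : Module.Basis B ℂ W)

/-- The sum of the moves in row `k`, with the scalar factor `κ`. -/
def moveOp (κ σ : ℂ) (nb : ℕ → ℕ) (k : ℕ) : Module.End ℂ W :=
  b.constr ℂ fun R => ∑ p ∈ rowSet n k, (κ * moveCoeff nb R.1 p) • tableauVector b (R.1.move σ p)

variable {b} {κ σ : ℂ} {nb : ℕ → ℕ}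

theorem tableauVector_of_mem {R : Tableau n} (h : R ∈ B) : tableauVector b R = b ⟨R, h⟩ :=
  dif_pos h

theorem tableauVector_of_not_mem {R : Tableau n} (h : R ∉ B) : tableauVector b R = 0 :=
  dif_neg h

theorem moveOp_tableauVector {R : Tableau n} (h : R ∈ B) (k : ℕ) :
    moveOp b κ σ nb k (tableauVector b R) =
      ∑ p ∈ rowSet n k, (κ * moveCoeff nb R p) • tableauVector b (R.move σ p) := by
  rw [tableauVector_of_mem h]
  exact b.constr_basis ℂ _ _

namespace MoveSystem

/-- Compositions follow the untruncated formula, intermediate tableaux outside `B` included; only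
the final tableau is truncated. -/
theorem moveOp_moveOp (H : MoveSystem B σ nb) {R : Tableau n} (hR : R ∈ B) {k l : ℕ}
    (hk : k < n) : moveOp b κ σ nb l (moveOp b κ σ nb k (tableauVector b R)) =
      ∑ p ∈ rowSet n k, ∑ q ∈ rowSet n l,
        (κ ^ 2 * (moveCoeff nb R p * moveCoeff nb (R.move σ p) q)) •
          tableauVector b ((R.move σ p).move σ q) := by
  rw [moveOp_tableauVector hR, map_sum]
  refine Finset.sum_congr rfl fun p hp => ?_
  rw [map_smul]
  by_cases h : R.move σ p ∈ B
  · rw [moveOp_tableauVector h, Finset.smul_sum]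
    refine Finset.sum_congr rfl fun q _ => ?_
    rw [smul_smul]
    congr 1
    ring
  · rw [tableauVector_of_not_mem h, map_zero, smul_zero]
    refine (Finset.sum_eq_zero fun q _ => ?_).symm
    by_cases hS : (R.move σ p).move σ q ∈ B
    · rw [H.coeff_mul_eq_zero hR (by rw [mem_rowSet.1 hp]; exact hk) hS h, mul_zero, zero_smul]
    · rw [tableauVector_of_not_mem hS, smul_zero]

theorem moveOp_moveOp_moveOp (H : MoveSystem B σ nb) {R : Tableau n} (hR : R ∈ B) {k l m : ℕ}
    (hk : k < n) (hl : l < n) :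
    moveOp b κ σ nb m (moveOp b κ σ nb l (moveOp b κ σ nb k (tableauVector b R))) =
      ∑ p ∈ rowSet n k, ∑ q ∈ rowSet n l, ∑ r ∈ rowSet n m,
        (κ ^ 3 * (moveCoeff nb R p * moveCoeff nb (R.move σ p) q *
          moveCoeff nb ((R.move σ p).move σ q) r)) •
          tableauVector b (((R.move σ p).move σ q).move σ r) := by
  rw [moveOp_tableauVector hR, map_sum, map_sum]
  refine Finset.sum_congr rfl fun p hp => ?_
  rw [map_smul, map_smul]
  by_cases h : R.move σ p ∈ B
  · rw [H.moveOp_moveOp h hl, Finset.smul_sum]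
    refine Finset.sum_congr rfl fun q _ => ?_
    rw [Finset.smul_sum]
    refine Finset.sum_congr rfl fun r _ => ?_
    rw [smul_smul]
    congr 1
    ring
  · rw [tableauVector_of_not_mem h, map_zero, map_zero, smul_zero]
    refine (Finset.sum_eq_zero fun q _ => Finset.sum_eq_zero fun r _ => ?_).symm
    by_cases hS : ((R.move σ p).move σ q).move σ r ∈ B
    · rw [H.coeff_mul_mul_eq_zero hR (by rw [mem_rowSet.1 hp]; exact hk) hS h, mul_zero, zero_smul]
    · rw [tableauVector_of_not_mem hS, smul_zero]

/-- Moves in rows that do not see each other commute. -/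
theorem moveOp_comm (H : MoveSystem B σ nb) {k l : ℕ} (hk : k < n) (hl : l < n) (hkl : k ≠ l)
    (h1 : nb k ≠ l) (h2 : nb l ≠ k) :
    moveOp b κ σ nb k * moveOp b κ σ nb l = moveOp b κ σ nb l * moveOp b κ σ nb k := by
  refine b.ext fun R => ?_
  rw [Module.End.mul_apply, Module.End.mul_apply, ← tableauVector_of_mem R.2,
    H.moveOp_moveOp R.2 hk, H.moveOp_moveOp R.2 hl, Finset.sum_comm]
  refine Finset.sum_congr rfl fun p hp => Finset.sum_congr rfl fun q hq => ?_
  rw [mem_rowSet] at hp hq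
  rw [move_comm, moveCoeff_move (by rw [hp, hq]; exact hkl.symm) (by rw [hp, hq]; exact h1.symm),
    moveCoeff_move (by rw [hp, hq]; exact hkl) (by rw [hp, hq]; exact h2.symm), mul_comm (moveCoeff nb R.1 p)]

end MoveSystem

end Operators

end Moves

end GelfandTsetlin
end

/-! ### Serre relations for the move operators -/

noncomputable section
namespace GelfandTsetlin

section Moves

variable {n : ℕ} {B : Set (Tableau n)} {σ : ℂ} {nb : ℕ → ℕ}

/-- Neighbouring entries with difference `σ` cannot both be moved without moving both rows next to
them. -/
theorem MoveSystem.add_ne (H : MoveSystem B σ nb) {R S : Tableau n} (hR : R ∈ B) (hS : S ∈ B)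
    {p p' : Pos n}
    (hrow : p.row = p'.row) (hp : p.row < n) (hSp : S p = R p + σ)
    (h : (∀ y : Pos n, y.row = p.row + 1 → S y = R y) ∨
      (p.row + 1 ≠ n ∧ ∀ x : Pos n, x.row + 1 = p.row → S x = R x)) : R p' ≠ R p + σ := by
  intro he
  obtain ⟨⟨y, hy, e⟩, h2⟩ := H.tangent R hR p p' hrow hp he S hS hSp
  rcases h with h | ⟨h3, h4⟩
  · exact e (h y hy)
  · rcases h2 with h2 | ⟨x, hx, e'⟩
    · exact h3 h2
    · exact e' (h4 x hx)

/-- The coefficient of the moves of `p`, `p'` and `q` in the double commutator. -/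
def serreCoeff (σ : ℂ) (nb : ℕ → ℕ) (R : Tableau n) (p p' q : Pos n) : ℂ :=
  moveCoeff nb R q * moveCoeff nb (R.move σ q) p * moveCoeff nb ((R.move σ q).move σ p) p' -
    2 * (moveCoeff nb R p * moveCoeff nb (R.move σ p) q *
      moveCoeff nb ((R.move σ p).move σ q) p') +
    moveCoeff nb R p * moveCoeff nb (R.move σ p) p' * moveCoeff nb ((R.move σ p).move σ p') q

theorem serreCoeff_self_upper {R : Tableau n} {p q : Pos n} (hq : q.row = nb p.row)
    (hpq : q.row ≠ p.row) (hnb : nb q.row ≠ p.row) : serreCoeff σ nb R p p q = 0 := by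
  obtain ⟨g, hg⟩ := exists_moveCoeff_eq (R := R) hq hpq
  obtain ⟨g', hg'⟩ := exists_moveCoeff_eq (R := R.move σ p) hq hpq
  have hne : p ≠ q := by rintro rfl; exact hpq rfl
  have c1 : ∀ R' : Tableau n, moveCoeff nb (R'.move σ p) q = moveCoeff nb R' q := fun R' =>
    moveCoeff_move hpq.symm hnb.symm σ
  have e1 := hg R fun t _ => rfl
  have e2 := hg (R.move σ q) fun t ht => move_of_ne _ _ ht
  have e3 := hg' (R.move σ p) fun t _ => rfl
  have e4 := hg' ((R.move σ p).move σ q) fun t ht => move_of_ne _ _ ht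
  rw [move_comm] at e4
  unfold serreCoeff
  rw [move_comm σ σ R p q]
  simp only [c1, e1, e2, e3, e4]
  simp only [move_self, move_of_ne _ _ hne.symm]
  ring

theorem serreCoeff_self_lower {R : Tableau n} {p q : Pos n} (hq : q.row = nb p.row)
    (hpq : q.row ≠ p.row) (hnb : nb q.row ≠ p.row) : serreCoeff σ nb R q q p = 0 := by
  obtain ⟨g, hg⟩ := exists_moveCoeff_eq (R := R) hq hpq
  have hne : p ≠ q := by rintro rfl; exact hpq rfl
  have c1 : ∀ R' : Tableau n, moveCoeff nb (R'.move σ p) q = moveCoeff nb R' q := fun R' =>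
    moveCoeff_move hpq.symm hnb.symm σ
  have e1 := hg R fun t _ => rfl
  have e2 := hg (R.move σ q) fun t ht => move_of_ne _ _ ht
  have e3 := hg ((R.move σ q).move σ q) fun t ht => by rw [move_of_ne _ _ ht, move_of_ne _ _ ht]
  unfold serreCoeff
  rw [move_comm σ σ R p q, c1, c1, e1, e2, e3]
  simp only [move_self]
  ring

/-- After the dependence on the three moved entries is isolated, this is an identity of rational
functions; `h0`, `h1`, `h2` keep its denominators nonzero. -/
theorem serreCoeff_upper {R : Tableau n} {p p' q : Pos n} (hrow : p.row = p'.row)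
    (hq : q.row = nb p.row) (hpq : q.row ≠ p.row) (hnb : nb q.row ≠ p.row) (hne : p ≠ p')
    (h0 : R p ≠ R p') (h1 : R p' ≠ R p + σ) (h2 : R p ≠ R p' + σ) :
    serreCoeff σ nb R p p' q + serreCoeff σ nb R p' p q = 0 := by
  obtain ⟨g, hg⟩ := exists_moveCoeff_eq_div (R := R) hq hpq hne hrow
  obtain ⟨g', hg'⟩ := exists_moveCoeff_eq_div (R := R) (p := p') (p' := p) (hrow ▸ hq)
    (hrow ▸ hpq) hne.symm hrow.symm
  have n1 : p ≠ q := by rintro rfl; exact hpq rfl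
  have n2 : p' ≠ q := by rintro rfl; exact hpq hrow.symm
  have c1 : ∀ R' : Tableau n, moveCoeff nb (R'.move σ p) q = moveCoeff nb R' q := fun R' =>
    moveCoeff_move hpq.symm hnb.symm σ
  have c2 : ∀ R' : Tableau n, moveCoeff nb (R'.move σ p') q = moveCoeff nb R' q := fun R' =>
    moveCoeff_move (hrow ▸ hpq.symm) (hrow ▸ hnb.symm) σ
  have a1 := hg R fun t _ _ => rfl
  have a2 := hg (R.move σ q) fun t ht _ => move_of_ne _ _ ht
  have a3 := hg (R.move σ p') fun t _ ht => move_of_ne _ _ ht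
  have a4 := hg ((R.move σ p').move σ q) fun t ht ht' => by
    rw [move_of_ne _ _ ht, move_of_ne _ _ ht']
  have b1 := hg' R fun t _ _ => rfl
  have b2 := hg' (R.move σ q) fun t ht _ => move_of_ne _ _ ht
  have b3 := hg' (R.move σ p) fun t _ ht => move_of_ne _ _ ht
  have b4 := hg' ((R.move σ p).move σ q) fun t ht ht' => by
    rw [move_of_ne _ _ ht, move_of_ne _ _ ht']
  unfold serreCoeff
  rw [move_comm σ σ R q p, move_comm σ σ R q p']
  simp only [c1, c2, a1, a2, a3, a4, b1, b2, b3, b4]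
  simp only [move_self, move_of_ne _ _ n1, move_of_ne _ _ n2, move_of_ne _ _ n1.symm,
    move_of_ne _ _ n2.symm]
  have d0 : R p - R p' ≠ 0 := sub_ne_zero.2 h0
  have d1 : R p' - (R p + σ) ≠ 0 := sub_ne_zero.2 h1
  have d2 : R p - (R p' + σ) ≠ 0 := sub_ne_zero.2 h2
  have d3 : R p' - R p ≠ 0 := sub_ne_zero.2 h0.symm
  rw [← neg_sub (R p) (R p')] at d3 ⊢
  field_simp
  ring

theorem serreCoeff_lower {R : Tableau n} {p q q' : Pos n} (hrow : q.row = q'.row)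
    (hq : q.row = nb p.row) (hpq : q.row ≠ p.row) (hnb : nb q.row ≠ p.row) (hnb' : nb q.row ≠ q.row)
    (hne : q ≠ q') (h0 : R q ≠ R q') (h1 : R q' ≠ R q + σ) (h2 : R q ≠ R q' + σ) :
    serreCoeff σ nb R q q' p + serreCoeff σ nb R q' q p = 0 := by
  obtain ⟨g, hg⟩ := exists_moveCoeff_eq_mul (R := R) hq hpq hne hrow
  obtain ⟨h, hh⟩ := exists_moveCoeff_eq_div_sub (R := R) hnb' hne hrow
  obtain ⟨h', hh'⟩ := exists_moveCoeff_eq_div_sub (R := R) (q := q') (q' := q) (hrow ▸ hnb')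
    hne.symm hrow.symm
  have n1 : p ≠ q := by rintro rfl; exact hpq rfl
  have n2 : p ≠ q' := by rintro rfl; exact hpq hrow
  have c1 : ∀ R' : Tableau n, moveCoeff nb (R'.move σ p) q = moveCoeff nb R' q := fun R' =>
    moveCoeff_move hpq.symm hnb.symm σ
  have c2 : ∀ R' : Tableau n, moveCoeff nb (R'.move σ p) q' = moveCoeff nb R' q' := fun R' =>
    moveCoeff_move (hrow ▸ hpq.symm) (hrow ▸ hnb.symm) σ
  have a1 := hg R fun t _ _ => rfl
  have a2 := hg (R.move σ q) fun t ht _ => move_of_ne _ _ ht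
  have a3 := hg (R.move σ q') fun t _ ht => move_of_ne _ _ ht
  have a4 := hg ((R.move σ q').move σ q) fun t ht ht' => by
    rw [move_of_ne _ _ ht, move_of_ne _ _ ht']
  have b1 := hh R fun t _ _ => rfl
  have b2 := hh (R.move σ q') fun t _ ht => move_of_ne _ _ ht
  have b3 := hh' R fun t _ _ => rfl
  have b4 := hh' (R.move σ q) fun t _ ht => move_of_ne _ _ ht
  unfold serreCoeff
  rw [move_comm σ σ R p q, move_comm σ σ R p q', move_comm σ σ R q q', c1, c1, c2, c2]
  rw [a1, a2, a3, a4, b1, b2, b3, b4]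
  simp only [move_self, move_of_ne _ _ hne, move_of_ne _ _ hne.symm]
  have d0 : R q - R q' ≠ 0 := sub_ne_zero.2 h0
  have d1 : R q' - (R q + σ) ≠ 0 := sub_ne_zero.2 h1
  have d2 : R q - (R q' + σ) ≠ 0 := sub_ne_zero.2 h2
  have d3 : R q' - R q ≠ 0 := sub_ne_zero.2 h0.symm
  rw [← neg_sub (R q) (R q')] at d3 ⊢
  field_simp
  ring

section Operators

variable {W : Type*} [AddCommGroup W] [Module ℂ W] {b : Module.Basis B ℂ W} {κ : ℂ}

theorem sum_sum_eq_zero_of_swap {ι W : Type*} [AddCommGroup W] [Module ℂ W] (s : Finset ι)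
    (F : ι → ι → W) (h : ∀ i ∈ s, ∀ j ∈ s, F i j + F j i = 0) : ∑ i ∈ s, ∑ j ∈ s, F i j = 0 := by
  have h1 : ∑ i ∈ s, ∑ j ∈ s, (F i j + F j i) = 0 :=
    Finset.sum_eq_zero fun i hi => Finset.sum_eq_zero fun j hj => h i hi j hj
  simp only [Finset.sum_add_distrib] at h1
  rw [Finset.sum_comm (f := fun i j => F j i), ← two_smul ℂ] at h1
  exact (smul_eq_zero.1 h1).resolve_left two_ne_zero

namespace MoveSystem

theorem serre_sum (H : MoveSystem B σ nb) {k l : ℕ} (hk : k < n) (hl : l < n) {R : Tableau n}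
    (hR : R ∈ B) :
    moveOp b κ σ nb k (moveOp b κ σ nb k (moveOp b κ σ nb l (tableauVector b R))) -
      (2 : ℂ) • moveOp b κ σ nb k (moveOp b κ σ nb l (moveOp b κ σ nb k (tableauVector b R))) +
      moveOp b κ σ nb l (moveOp b κ σ nb k (moveOp b κ σ nb k (tableauVector b R))) =
    ∑ q ∈ rowSet n l, ∑ p ∈ rowSet n k, ∑ p' ∈ rowSet n k, (κ ^ 3 * serreCoeff σ nb R p p' q) •
      tableauVector b (((R.move σ p).move σ p').move σ q) := by
  rw [H.moveOp_moveOp_moveOp hR hl hk, H.moveOp_moveOp_moveOp hR hk hl,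
    H.moveOp_moveOp_moveOp hR hk hk]
  rw [Finset.sum_comm (s := rowSet n k) (t := rowSet n l)]
  have : ∀ F : Pos n → Pos n → Pos n → W, ∑ p ∈ rowSet n k, ∑ p' ∈ rowSet n k, ∑ q ∈ rowSet n l,
      F p p' q = ∑ q ∈ rowSet n l, ∑ p ∈ rowSet n k, ∑ p' ∈ rowSet n k, F p p' q := by
    intro F
    rw [Finset.sum_comm]
    simp only [Finset.sum_comm (s := rowSet n k) (t := rowSet n l)]
    rw [Finset.sum_congr rfl fun q _ => Finset.sum_comm]
  rw [this]
  simp only [Finset.smul_sum, ← Finset.sum_sub_distrib, ← Finset.sum_add_distrib]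
  refine Finset.sum_congr rfl fun q _ => Finset.sum_congr rfl fun p _ =>
    Finset.sum_congr rfl fun p' _ => ?_
  rw [move_comm σ σ (R.move σ p) p' q, move_comm σ σ R q p, smul_smul, ← sub_smul, ← add_smul]
  congr 1
  unfold serreCoeff
  rw [move_comm σ σ R q p]
  ring

/-- The two orders of `p` and `p'` reach the same tableau, so only the symmetrized coefficient has
to vanish, and only if that tableau lies in `B`. -/
theorem serre_eq_zero (H : MoveSystem B σ nb) {k l : ℕ} (hk : k < n) (hl : l < n)
    (h : ∀ R ∈ B, ∀ p p' q : Pos n, p.row = k → p'.row = k → q.row = l →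
      ((R.move σ p).move σ p').move σ q ∈ B →
      serreCoeff σ nb R p p' q + serreCoeff σ nb R p' p q = 0) :
    ⁅moveOp b κ σ nb k, ⁅moveOp b κ σ nb k, moveOp b κ σ nb l⁆⁆ = 0 := by
  refine b.ext fun R => ?_
  have h1 := H.serre_sum (b := b) (κ := κ) hk hl R.2
  rw [Finset.sum_eq_zero, tableauVector_of_mem R.2] at h1
  · simp only [LieRing.of_associative_ring_bracket, LinearMap.sub_apply, Module.End.mul_apply,
      map_sub, LinearMap.zero_apply]
    rw [← h1, two_smul]
    abel
  · intro q hq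
    refine sum_sum_eq_zero_of_swap _ _ fun p hp p' hp' => ?_
    rw [move_comm σ σ R.1 p' p, ← add_smul, ← mul_add]
    by_cases hS : ((R.1.move σ p).move σ p').move σ q ∈ B
    · rw [h R.1 R.2 p p' q (mem_rowSet.1 hp) (mem_rowSet.1 hp') (mem_rowSet.1 hq) hS, mul_zero,
        zero_smul]
    · rw [tableauVector_of_not_mem hS, smul_zero]

/-- Apart from the row of `p`, only the row of `q` is changed, so one of the rows next to `p` stays
fixed and `add_ne` applies. -/
theorem ne_add_of_move (H : MoveSystem B σ nb) {R : Tableau n} (hR : R ∈ B) {p p' q : Pos n}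
    (hrow : p.row = p'.row) (hp : p.row < n) (hne : p ≠ p') (hpq : p.row ≠ q.row)
    (hq : q.row < n) (hadj : q.row = p.row + 1 ∨ p.row = q.row + 1)
    (hS : ((R.move σ p).move σ p').move σ q ∈ B) : R p' ≠ R p + σ := by
  refine H.add_ne hR hS hrow hp ?_ ?_
  · rw [move_of_ne _ _ (by rintro rfl; exact hpq rfl), move_of_ne _ _ hne, move_self]
  · have hmv : ∀ t : Pos n, t.row ≠ p.row → t.row ≠ q.row →
        ((R.move σ p).move σ p').move σ q t = R t := by
      intro t h1 h2
      rw [move_of_ne _ _ (by rintro rfl; exact h2 rfl),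
        move_of_ne _ _ (by rintro rfl; exact h1 hrow.symm),
        move_of_ne _ _ (by rintro rfl; exact h1 rfl)]
    rcases hadj with h | h
    · exact Or.inr ⟨by omega, fun x hx => hmv x (by omega) (by omega)⟩
    · exact Or.inl fun y hy => hmv y (by omega) (by omega)

/-- The Serre relations. -/
theorem serre_upper (H : MoveSystem B σ nb) {k l : ℕ} (hk : k < n) (hl : l < n) (hkl : nb k = l)
    (hlk : nb l ≠ k) (hadj : l = k + 1 ∨ k = l + 1) :
    ⁅moveOp b κ σ nb k, ⁅moveOp b κ σ nb k, moveOp b κ σ nb l⁆⁆ = 0 := by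
  refine H.serre_eq_zero hk hl fun R hR p p' q hp hp' hq hS => ?_
  by_cases hpp : p = p'
  · subst hpp
    rw [serreCoeff_self_upper (by rw [hq, hp, hkl]) (by omega) (by rw [hq, hp]; exact hlk),
      add_zero]
  · refine serreCoeff_upper (by omega) (by rw [hq, hp, hkl]) (by omega)
      (by rw [hq, hp]; exact hlk) hpp ?_ ?_ ?_
    · exact H.noncritical R hR p p' (by omega) (by omega) hpp
    · exact H.ne_add_of_move (q := q) hR (by omega) (by omega) hpp (by omega) (by omega) (by omega) hS
    · exact H.ne_add_of_move (q := q) hR (by omega) (by omega) (Ne.symm hpp) (by omega) (by omega) (by omega)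
        (by rwa [move_comm σ σ R p' p])

theorem serre_lower (H : MoveSystem B σ nb) {k l : ℕ} (hk : k < n) (hl : l < n) (hkl : nb k = l)
    (hlk : nb l ≠ k) (hll : nb l ≠ l) (hadj : l = k + 1 ∨ k = l + 1) :
    ⁅moveOp b κ σ nb l, ⁅moveOp b κ σ nb l, moveOp b κ σ nb k⁆⁆ = 0 := by
  refine H.serre_eq_zero hl hk fun R hR p p' q hp hp' hq hS => ?_
  by_cases hpp : p = p'
  · subst hpp
    rw [serreCoeff_self_lower (by rw [hq, hp, hkl]) (by omega) (by rw [hq, hp]; exact hlk),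
      add_zero]
  · refine serreCoeff_lower (by omega) (by rw [hq, hp, hkl]) (by omega)
      (by rw [hq, hp]; exact hlk) (by rw [hp]; exact hll) hpp ?_ ?_ ?_
    · exact H.noncritical R hR p p' (by omega) (by omega) hpp
    · exact H.ne_add_of_move (q := q) hR (by omega) (by omega) hpp (by omega) (by omega) (by omega) hS
    · exact H.ne_add_of_move (q := q) hR (by omega) (by omega) (Ne.symm hpp) (by omega) (by omega) (by omega)
        (by rwa [move_comm σ σ R p' p])

end MoveSystem

end Operators

end Moves

end GelfandTsetlin
end

noncomputable section
namespace GelfandTsetlin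

/-! ### The commutator of a raising and a lowering operator of the same row -/

section Residues

variable {ι : Type*} [DecidableEq ι]

/-- Residues of a quotient whose double poles are cancelled by double zeros. -/
theorem sum_residues_sdiff (A A₁ : Finset ℂ) (U : Finset ι) (w : ι → ℂ)
    (hcard : U.card = A.card + A₁.card)
    (hZ : ∀ z ∈ A ∩ A₁, ∃ a ∈ U, ∃ b ∈ U, a ≠ b ∧ w a = z ∧ w b = z) :
    ∑ r ∈ A \ A₁, (∏ j ∈ U, (r - w j)) / ((∏ r' ∈ A.erase r, (r - r')) * ∏ r' ∈ A₁, (r - r')) +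
      ∑ r ∈ A₁ \ A, (∏ j ∈ U, (r - w j)) / ((∏ r' ∈ A, (r - r')) * ∏ r' ∈ A₁.erase r, (r - r')) =
    ∑ r ∈ A, r + ∑ r ∈ A₁, r - ∑ j ∈ U, w j := by
  rcases isEmpty_or_nonempty ι with hι | hι
  · obtain rfl := Finset.eq_empty_of_isEmpty U
    have h1 : A.card = 0 := by simp at hcard; omega
    have h2 : A₁.card = 0 := by simp at hcard; omega
    rw [Finset.card_eq_zero] at h1 h2
    simp [h1, h2]
  -- For each double pole these pick two factors of the numerator that cancel it.
  choose! a ha b hb hab hwa hwb using hZ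
  set Z := A ∩ A₁ with hZdef
  set S := (A \ A₁) ∪ (A₁ \ A) with hS
  have hdisj : Disjoint (A \ A₁) (A₁ \ A) := by
    rw [Finset.disjoint_left]
    intro x hx hx'
    exact (Finset.mem_sdiff.1 hx').2 (Finset.mem_sdiff.1 hx).1
  have ia : Set.InjOn a Z := fun x hx y hy h => by rw [← hwa x hx, h, hwa y hy]
  have ib : Set.InjOn b Z := fun x hx y hy h => by rw [← hwb x hx, h, hwb y hy]
  have hdab : Disjoint (Z.image a) (Z.image b) := by
    rw [Finset.disjoint_left]
    intro i hi hi'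
    obtain ⟨x, hx, rfl⟩ := Finset.mem_image.1 hi
    obtain ⟨y, hy, h⟩ := Finset.mem_image.1 hi'
    have : x = y := by rw [← hwa x hx, ← h, hwb y hy]
    subst this
    exact hab x hx h.symm
  have hsub : Z.image a ∪ Z.image b ⊆ U := by
    intro i hi
    rcases Finset.mem_union.1 hi with h | h
    · obtain ⟨x, hx, rfl⟩ := Finset.mem_image.1 h; exact ha x hx
    · obtain ⟨x, hx, rfl⟩ := Finset.mem_image.1 h; exact hb x hx
  set T := U \ (Z.image a ∪ Z.image b) with hT
  have hprod : ∀ r, ∏ j ∈ U, (r - w j) = (∏ j ∈ T, (r - w j)) *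
      ((∏ z ∈ Z, (r - z)) * ∏ z ∈ Z, (r - z)) := by
    intro r
    rw [← Finset.prod_sdiff hsub, Finset.prod_union hdab, Finset.prod_image ia,
      Finset.prod_image ib]
    congr 2
    · exact Finset.prod_congr rfl fun z hz => by rw [hwa z hz]
    · exact Finset.prod_congr rfl fun z hz => by rw [hwb z hz]
  have hsum : ∑ j ∈ U, w j = ∑ j ∈ T, w j + (∑ z ∈ Z, z + ∑ z ∈ Z, z) := by
    rw [← Finset.sum_sdiff hsub, Finset.sum_union hdab, Finset.sum_image ia,
      Finset.sum_image ib, Finset.sum_congr rfl fun z hz => hwa z hz,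
      Finset.sum_congr (s₁ := Z) (f := fun z => w (b z)) rfl fun z hz => hwb z hz]
  have hSsum : ∑ r ∈ S, r = ∑ r ∈ A, r + ∑ r ∈ A₁, r - (∑ z ∈ Z, z + ∑ z ∈ Z, z) := by
    rw [hS, Finset.sum_union hdisj, ← Finset.sum_inter_add_sum_sdiff A A₁,
      ← Finset.sum_inter_add_sum_sdiff A₁ A, Finset.inter_comm A₁ A, ← hZdef]
    ring
  have hTcard : T.card = S.card := by
    have h1 := Finset.card_sdiff_add_card_eq_card hsub
    rw [← hT, Finset.card_union_of_disjoint hdab, Finset.card_image_of_injOn ia,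
      Finset.card_image_of_injOn ib] at h1
    have h2 := Finset.card_inter_add_card_sdiff A A₁
    have h3 := Finset.card_inter_add_card_sdiff A₁ A
    rw [Finset.inter_comm A₁ A, ← hZdef] at h3
    rw [← hZdef] at h2
    rw [hS, Finset.card_union_of_disjoint hdisj]
    omega
  -- After the cancellation the poles are simple and form the symmetric difference of `A` and `A₁`.
  have key := sum_residues_sub S T w hTcard
  rw [hSsum, hS, Finset.sum_union hdisj] at key
  have hZne : ∀ r, r ∉ Z → ∏ z ∈ Z, (r - z) ≠ 0 := fun r hr =>
    Finset.prod_ne_zero_iff.2 fun z hz => sub_ne_zero.2 (by rintro rfl; exact hr hz)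
  have term : ∀ (A A₁ : Finset ℂ) (r : ℂ), A ∩ A₁ = Z → r ∈ A \ A₁ →
      (∏ j ∈ U, (r - w j)) / ((∏ r' ∈ A.erase r, (r - r')) * ∏ r' ∈ A₁, (r - r')) =
      (∏ j ∈ T, (r - w j)) / ∏ r' ∈ ((A \ A₁) ∪ (A₁ \ A)).erase r, (r - r') := by
    intro A A₁ r hAZ hr
    obtain ⟨hrA, hrA₁⟩ := Finset.mem_sdiff.1 hr
    have hd : Disjoint ((A \ A₁).erase r) (A₁ \ A) := by
      rw [Finset.disjoint_left]
      intro x hx hx'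
      exact (Finset.mem_sdiff.1 hx').2 (Finset.mem_sdiff.1 (Finset.mem_of_mem_erase hx)).1
    have e1 : ((A \ A₁) ∪ (A₁ \ A)).erase r = (A \ A₁).erase r ∪ (A₁ \ A) := by
      rw [Finset.erase_union_distrib, Finset.erase_eq_of_notMem (s := A₁ \ A)]
      simp [hrA]
    have e2 : ∏ r' ∈ A.erase r, (r - r') = (∏ z ∈ Z, (r - z)) * ∏ r' ∈ (A \ A₁).erase r, (r - r') := by
      rw [← Finset.prod_inter_mul_prod_sdiff (A.erase r) A₁]
      congr 1
      · refine Finset.prod_congr ?_ fun _ _ => rfl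
        rw [Finset.erase_inter, hAZ, Finset.erase_eq_of_notMem]
        rw [← hAZ]; simp [hrA₁]
      · refine Finset.prod_congr ?_ fun _ _ => rfl
        rw [Finset.erase_sdiff_comm]
    have e3 : ∏ r' ∈ A₁, (r - r') = (∏ z ∈ Z, (r - z)) * ∏ r' ∈ A₁ \ A, (r - r') := by
      rw [← Finset.prod_inter_mul_prod_sdiff A₁ A, Finset.inter_comm, hAZ]
    rw [e1, Finset.prod_union hd, e2, e3, hprod]
    have hz := hZne r (by rw [← hAZ]; simp [hrA₁])
    rw [show (∏ z ∈ Z, (r - z)) * (∏ r' ∈ (A \ A₁).erase r, (r - r')) *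
      ((∏ z ∈ Z, (r - z)) * ∏ r' ∈ A₁ \ A, (r - r')) = (∏ r' ∈ (A \ A₁).erase r, (r - r')) *
        (∏ r' ∈ A₁ \ A, (r - r')) * ((∏ z ∈ Z, (r - z)) * ∏ z ∈ Z, (r - z)) by ring]
    exact mul_div_mul_right _ _ (mul_ne_zero hz hz)
  rw [Finset.sum_congr rfl fun r hr => term A A₁ r rfl hr,
    Finset.sum_congr (s₁ := A₁ \ A) rfl fun r hr => by
      rw [mul_comm (∏ r' ∈ A, (r - r')), term A₁ A r (Finset.inter_comm _ _) hr,
        Finset.union_comm], key, hsum]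
  ring

open Classical in
/-- The diagonal entry of the commutator. -/
theorem sum_truncated_residues (s t₁ t₂ : Finset ι) (L : ι → ℂ) (hL : Set.InjOn L s)
    (hd : Disjoint t₁ t₂) (hcard : t₁.card + t₂.card = s.card + s.card)
    (htan : ∀ p ∈ s, ∀ q ∈ s, L p = L q + 1 →
      (∃ y ∈ t₂, ∃ y' ∈ t₂, y ≠ y' ∧ L y = L q ∧ L y' = L q) ∨
      ∃ y ∈ t₂, ∃ x ∈ t₁, L y = L q ∧ L x = L p) :
    ∑ i ∈ s, ((if ∃ q ∈ s, L i = L q + 1 then 0 else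
      -((∏ x ∈ t₁, (L i - L x)) * ∏ y ∈ t₂, (L i - 1 - L y)) /
        ((∏ j ∈ s.erase i, (L i - L j)) * ∏ j ∈ s.erase i, (L i - 1 - L j))) +
      if ∃ p ∈ s, L p = L i + 1 then 0 else
      ((∏ x ∈ t₁, (L i + 1 - L x)) * ∏ y ∈ t₂, (L i - L y)) /
        ((∏ j ∈ s.erase i, (L i - L j)) * ∏ j ∈ s.erase i, (L i + 1 - L j))) =
    2 * ∑ i ∈ s, L i + s.card - ∑ x ∈ t₁, L x - ∑ y ∈ t₂, L y - t₂.card := by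
  -- With this shift the numerator is $\prod(r-L_x)\prod(r-1-L_y)$: its values at $r=L_i$ and
  -- $r=L_i+1$ give the two contributions of `i`. The double poles are the points $L_p=L_q+1$, and
  -- `htan` supplies their double zeros.
  set w : ι → ℂ := fun j => if j ∈ t₂ then L j + 1 else L j with hw
  have w1 : ∀ x ∈ t₁, w x = L x := fun x hx => if_neg (Finset.disjoint_left.1 hd hx)
  have w2 : ∀ y ∈ t₂, w y = L y + 1 := fun y hy => if_pos hy
  have hL1 : Set.InjOn (fun i => L i + 1) s := injOn_shift hL 1
  set A := s.image L with hA
  set A₁ := s.image fun i => L i + 1 with hA₁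
  have key := sum_residues_sdiff A A₁ (t₁ ∪ t₂) w (by
      rw [Finset.card_union_of_disjoint hd, Finset.card_image_of_injOn hL,
        Finset.card_image_of_injOn hL1, hcard]) (by
      intro z hz
      obtain ⟨h1, h2⟩ := Finset.mem_inter.1 hz
      obtain ⟨p, hp, rfl⟩ := Finset.mem_image.1 h1
      obtain ⟨q, hq, h⟩ := Finset.mem_image.1 h2
      rcases htan p hp q hq h.symm with ⟨y, hy, y', hy', hne, e, e'⟩ | ⟨y, hy, x, hx, e, e'⟩
      · exact ⟨y, Finset.mem_union_right _ hy, y', Finset.mem_union_right _ hy', hne,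
          by rw [w2 y hy, e, h], by rw [w2 y' hy', e', h]⟩
      · exact ⟨y, Finset.mem_union_right _ hy, x, Finset.mem_union_left _ hx,
          fun h => Finset.disjoint_left.1 hd hx (h ▸ hy), by rw [w2 y hy, e, h],
          by rw [w1 x hx, e']⟩)
  rw [Finset.sum_union hd, Finset.sum_congr rfl w1, Finset.sum_congr (s₁ := t₂) rfl w2,
    Finset.sum_image hL, Finset.sum_image hL1, Finset.sum_add_distrib, Finset.sum_add_distrib] at key
  simp only [Finset.sum_const, nsmul_eq_mul, mul_one] at key
  rw [Finset.sum_add_distrib]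
  have hprod : ∀ r, ∏ j ∈ t₁ ∪ t₂, (r - w j) = (∏ x ∈ t₁, (r - L x)) * ∏ y ∈ t₂, (r - 1 - L y) := by
    intro r
    rw [Finset.prod_union hd]
    congr 1
    · exact Finset.prod_congr rfl fun x hx => by rw [w1 x hx]
    · exact Finset.prod_congr rfl fun y hy => by rw [w2 y hy]; ring
  have er : ∀ (M : ι → ℂ), Set.InjOn M s → ∀ i ∈ s, (s.image M).erase (M i) = (s.erase i).image M := by
    intro M hM i hi
    ext r
    simp only [Finset.mem_erase, Finset.mem_image]
    constructor
    · rintro ⟨h1, j, hj, rfl⟩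
      exact ⟨j, ⟨fun h => h1 (by rw [h]), hj⟩, rfl⟩
    · rintro ⟨j, ⟨h1, hj⟩, rfl⟩
      exact ⟨fun h => h1 (hM hj hi h), j, hj, rfl⟩
  have trunc : ∀ (M : ι → ℂ), Set.InjOn M s → ∀ (A' : Finset ℂ) (P : ι → Prop) (g : ℂ → ℂ)
      (g' : ι → ℂ), (∀ i ∈ s, (M i ∈ A' ↔ P i)) → (∀ i ∈ s, g (M i) = g' i) →
      ∑ r ∈ s.image M \ A', g r = ∑ i ∈ s, if P i then 0 else g' i := by
    intro M hM A' P g g' hP hg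
    rw [Finset.sdiff_eq_filter, Finset.sum_filter, Finset.sum_image hM]
    refine Finset.sum_congr rfl fun i hi => ?_
    rw [hg i hi]
    by_cases h : P i
    · rw [if_pos h, if_neg (not_not.2 ((hP i hi).2 h))]
    · rw [if_neg h, if_pos fun h' => h ((hP i hi).1 h')]
  rw [hA, hA₁] at key
  rw [trunc L hL _ (fun i => ∃ q ∈ s, L i = L q + 1) _ (fun i =>
      -((∏ x ∈ t₁, (L i - L x)) * ∏ y ∈ t₂, (L i - 1 - L y)) /
        ((∏ j ∈ s.erase i, (L i - L j)) * ∏ j ∈ s.erase i, (L i - 1 - L j)))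
      (fun i hi => by simp only [Finset.mem_image, eq_comm]) ?_,
    trunc _ hL1 _ (fun i => ∃ p ∈ s, L p = L i + 1) _ (fun i =>
      ((∏ x ∈ t₁, (L i + 1 - L x)) * ∏ y ∈ t₂, (L i - L y)) /
        ((∏ j ∈ s.erase i, (L i - L j)) * ∏ j ∈ s.erase i, (L i + 1 - L j)))
      (fun i hi => by simp only [Finset.mem_image]) ?_] at key
  · refine Eq.trans ?_ (key.trans (by ring))
    congr!
  · intro i hi
    rw [er _ hL1 i hi, hprod, Finset.prod_image hL, Finset.prod_image (hL1.mono (by simp)),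
      ← Finset.mul_prod_erase s _ hi]
    simp only [add_sub_cancel_right, add_sub_cancel_left, one_mul, add_sub_add_right_eq_sub]
    rw [mul_comm (∏ j ∈ s.erase i, (L i - L j))]
  · intro i hi
    rw [er _ hL i hi, hprod, Finset.prod_image (hL.mono (by simp)), Finset.prod_image hL1,
      ← Finset.mul_prod_erase s _ hi]
    rw [show L i - (L i + 1) = -1 by ring, neg_one_mul, mul_neg, div_neg, neg_div]
    simp only [← sub_sub, sub_right_comm _ _ (1:ℂ)]

end Residues

end GelfandTsetlin
end

/-! ### Raising and lowering operators on a realization -/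

noncomputable section
namespace GelfandTsetlin

section Realization

variable {n : ℕ} {C : Set (Relation n)} {B : Set (Tableau n)} {L : Tableau n}

theorem raise_eq_move (R : Tableau n) (p : Pos n) : R.raise p = R.move 1 p := rfl

theorem lower_eq_move (R : Tableau n) (p : Pos n) : R.lower p = R.move (-1) p := by
  funext q
  rw [lower_apply, move_apply]
  split_ifs <;> ring

theorem raiseCoeff_eq (R : Tableau n) (p : Pos n) : raiseCoeff R p = -1 * moveCoeff (· + 1) R p := by
  rw [raiseCoeff, moveCoeff, neg_one_mul]

theorem lowerCoeff_eq (R : Tableau n) (p : Pos n) : lowerCoeff R p = 1 * moveCoeff (· - 1) R p := by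
  rw [lowerCoeff, moveCoeff, one_mul]

theorem GeZ.eq_or_sub {a b : ℂ} (h : GeZ a b) : a = b ∨ GeZ (a + -1) b :=
  h.eq_or.imp_right fun h => by rwa [← GeZ.add_one, neg_add_cancel_right]

theorem GeZ.sub_one (a : ℂ) : GeZ a (a + -1) := by
  simpa using geZ_add_one_self (a + -1)

/-- Raising one entry by one can only break a relation that bounds it from above and is tight. -/
theorem exists_of_raise_not_mem (hC : C ⊆ relR n ∪ relR0 n) {R : Tableau n} (hR : R ∈ basisSet C L)
    {a : Pos n} (ha : a.row < n) (h : R.move 1 a ∉ basisSet C L) :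
    (∃ y, .ge y a ∈ C ∧ R y = R a) ∨ ∃ x, .gt x a ∈ C ∧ R x = R a + 1 := by
  by_contra hno
  push Not at hno
  obtain ⟨h1, h2⟩ := hno
  refine h (basisSet_of_modified hR (fun p => ?_) ?_ fun p hp => move_of_ne _ _ (by
    rintro rfl; omega))
  · rw [move_apply]
    split_ifs
    · exact (geZ_add_one_self _).intDiff
    · rw [add_zero]; exact (GeZ.refl _).intDiff
  · rintro (⟨p, q⟩ | ⟨p, q⟩) hr
    · have hpq : p ≠ q := by
        rintro rfl
        rcases ge_cases hC hr with h | h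
        · omega
        · exact h.2.2 rfl
      have hge := hR.2.ge hr
      rw [satisfiesRel_ge]
      by_cases hq : q = a
      · subst hq
        rw [move_self, move_of_ne _ _ hpq]
        exact hge.eq_or.resolve_left (h1 p hr)
      · rw [move_of_ne _ _ hq, move_apply]
        split_ifs
        · exact (geZ_add_one_self _).trans hge
        · rwa [add_zero]
    · have hpq : p ≠ q := by
        rintro rfl
        have := gt_cases hC hr
        omega
      have hge := hR.2.gt hr
      rw [satisfiesRel_gt]
      by_cases hq : q = a
      · subst hq
        rw [move_self, move_of_ne _ _ hpq]
        exact hge.eq_or.resolve_left (h2 p hr)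
      · rw [move_of_ne _ _ hq, move_apply]
        split_ifs
        · exact (geZ_add_one_self _).trans hge
        · rwa [add_zero]

theorem exists_of_lower_not_mem (hC : C ⊆ relR n ∪ relR0 n) {R : Tableau n} (hR : R ∈ basisSet C L)
    {a : Pos n} (ha : a.row < n) (h : R.move (-1) a ∉ basisSet C L) :
    (∃ x, .ge a x ∈ C ∧ R a = R x) ∨ ∃ y, .gt a y ∈ C ∧ R a = R y + 1 := by
  by_contra hno
  push Not at hno
  obtain ⟨h1, h2⟩ := hno
  refine h (basisSet_of_modified hR (fun p => ?_) ?_ fun p hp => move_of_ne _ _ (by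
    rintro rfl; omega))
  · rw [move_apply]
    split_ifs
    · exact (GeZ.sub_one _).intDiff.symm
    · rw [add_zero]; exact (GeZ.refl _).intDiff
  · rintro (⟨p, q⟩ | ⟨p, q⟩) hr
    · have hpq : p ≠ q := by
        rintro rfl
        rcases ge_cases hC hr with h | h
        · omega
        · exact h.2.2 rfl
      have hge := hR.2.ge hr
      rw [satisfiesRel_ge]
      by_cases hp : p = a
      · subst hp
        rw [move_self, move_of_ne _ _ hpq.symm]
        exact hge.eq_or_sub.resolve_left (h1 q hr)
      · rw [move_of_ne _ _ hp, move_apply]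
        split_ifs
        · exact hge.trans (GeZ.sub_one _)
        · rwa [add_zero]
    · have hpq : p ≠ q := by
        rintro rfl
        have := gt_cases hC hr
        omega
      have hge := hR.2.gt hr
      rw [satisfiesRel_gt]
      by_cases hp : p = a
      · subst hp
        rw [move_self, move_of_ne _ _ hpq.symm]
        exact hge.eq_or_sub.resolve_left (h2 q hr)
      · rw [move_of_ne _ _ hp, move_apply]
        split_ifs
        · exact hge.trans (GeZ.add_one.2 (GeZ.sub_one _))
        · rwa [add_zero]

theorem not_geZ_self_add_one (a : ℂ) : ¬ GeZ a (a + 1) := fun h =>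
  not_geZ_of_geZ_add_one h (GeZ.refl a)

/-- If one entry can be raised while another one is lowered, then they can be moved in any
order. -/
theorem lower_mem_of_lower_raise (hC : C ⊆ relR n ∪ relR0 n) {R : Tableau n}
    (hR : R ∈ basisSet C L) {p q : Pos n} (hpq : p ≠ q) (hq : q.row < n)
    (hS : (R.move (-1) q).move 1 p ∈ basisSet C L) : R.move (-1) q ∈ basisSet C L := by
  by_contra h
  have hval : ∀ t, t ≠ q → GeZ ((R.move (-1) q).move 1 p t) (R t) := by
    intro t ht
    rw [move_apply, move_of_ne _ _ ht]
    split_ifs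
    · exact geZ_add_one_self _
    · rw [add_zero]; exact GeZ.refl _
  have hSq : (R.move (-1) q).move 1 p q + 1 = R q := by
    rw [move_of_ne _ _ hpq.symm, move_self]; ring
  rcases exists_of_lower_not_mem hC hR hq h with ⟨x, hx, e⟩ | ⟨y, hy, e⟩
  · have hne : x ≠ q := by
      rintro rfl
      rcases ge_cases hC hx with h | h
      · omega
      · exact h.2.2 rfl
    have h1 := (hS.2.ge hx).trans (hval x hne)
    rw [← e, ← hSq] at h1
    exact not_geZ_self_add_one _ h1
  · have hne : y ≠ q := by
      rintro rfl
      have := gt_cases hC hy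
      omega
    have h1 := (hS.2.gt hy).trans (GeZ.add_one.2 (hval y hne))
    rw [← e, ← hSq] at h1
    exact not_geZ_self_add_one _ h1

theorem raise_mem_of_lower_raise (hC : C ⊆ relR n ∪ relR0 n) {R : Tableau n}
    (hR : R ∈ basisSet C L) {p q : Pos n} (hpq : p ≠ q) (hp : p.row < n)
    (hS : (R.move (-1) q).move 1 p ∈ basisSet C L) : R.move 1 p ∈ basisSet C L := by
  by_contra h
  have hval : ∀ t, t ≠ p → GeZ (R t) ((R.move (-1) q).move 1 p t) := by
    intro t ht
    rw [move_of_ne _ _ ht, move_apply]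
    split_ifs
    · exact GeZ.sub_one _
    · rw [add_zero]; exact GeZ.refl _
  have hSp : (R.move (-1) q).move 1 p p = R p + 1 := by
    rw [move_self, move_of_ne _ _ hpq]
  rcases exists_of_raise_not_mem hC hR hp h with ⟨y, hy, e⟩ | ⟨x, hx, e⟩
  · have hne : y ≠ p := by
      rintro rfl
      rcases ge_cases hC hy with h | h
      · omega
      · exact h.2.2 rfl
    have h1 := (hval y hne).trans (hS.2.ge hy)
    rw [hSp, e] at h1
    exact not_geZ_self_add_one _ h1
  · have hne : x ≠ p := by
      rintro rfl
      have := gt_cases hC hx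
      omega
    have h1 := (hval x hne).trans (hS.2.gt hx)
    rw [hSp, e] at h1
    exact not_geZ_self_add_one _ h1

namespace TableauxSet

/-- The zeros of raising coefficients come from the row above. A raise stopped by the row below is
stopped by a strict relation, which then holds throughout the set; the tangent condition is
`tangent_realization`. -/
theorem moveSystem_raise (H : TableauxSet C B) (hL : IsRealization C L) :
    MoveSystem (basisSet C L) 1 (· + 1) where
  sigma_ne_zero := one_ne_zero
  noncritical := hL.2
  block R hR a ha h := by
    rcases exists_of_raise_not_mem H.subset hR ha h with ⟨y, hy, e⟩ | ⟨x, hx, e⟩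
    · exact Or.inl ⟨y, (ge_cases H.subset hy).resolve_right fun h => by omega, e.symm⟩
    · refine Or.inr ⟨x, gt_cases H.subset hx, e, fun S hS m hm => ?_⟩
      exact not_geZ_of_geZ_add_one (hS.2.gt hx) ⟨m, by omega, by rw [hm]; push_cast; ring⟩
  tangent R hR p p' hrow hp he S hS hSp := by
    obtain ⟨_, y, -, hy, -, e, -, hyr, h⟩ :=
      H.tangent_realization hL hR (p := p') (q := p) hrow.symm (by omega) he
    refine ⟨⟨y, by omega, fun h' => ?_⟩, ?_⟩
    · have := hS.2.ge hy
      rw [h', e, hSp] at this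
      exact not_geZ_self_add_one _ this
    · rcases h with ⟨h, -⟩ | ⟨x, hxr, -, hx, e'⟩
      · exact Or.inl (by omega)
      · refine Or.inr ⟨x, by omega, fun h' => ?_⟩
        have := hS.2.gt hx
        rw [h', e', hSp, he] at this
        exact not_geZ_self_add_one _ this

theorem moveSystem_lower (H : TableauxSet C B) (hL : IsRealization C L) :
    MoveSystem (basisSet C L) (-1) (· - 1) where
  sigma_ne_zero := by norm_num
  noncritical := hL.2
  block R hR a ha h := by
    rcases exists_of_lower_not_mem H.subset hR ha h with ⟨x, hx, e⟩ | ⟨y, hy, e⟩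
    · refine Or.inl ⟨x, ?_, e⟩
      have := (ge_cases H.subset hx).resolve_right fun h => by omega
      omega
    · have := gt_cases H.subset hy
      refine Or.inr ⟨y, by omega, by rw [e]; ring, fun S hS m hm => ?_⟩
      exact not_geZ_of_geZ_add_one (hS.2.gt hy) ⟨m, by omega, by rw [hm]; push_cast; ring⟩
  tangent R hR p p' hrow hp he S hS hSp := by
    have he' : R p = R p' + 1 := by rw [he]; ring
    obtain ⟨y, _, hy, -, e, -, hyr, -, h⟩ :=
      H.tangent_realization hL hR (p := p) (q := p') hrow (by omega) he'
    rw [he', add_neg_cancel_right] at hSp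
    refine ⟨⟨y, by omega, fun h' => ?_⟩, ?_⟩
    · have := hS.2.gt hy
      rw [h', e, hSp] at this
      exact not_geZ_self_add_one _ this
    · rcases h with ⟨h, -⟩ | ⟨x, hxr, hx, -, e'⟩
      · exact Or.inl (by omega)
      · refine Or.inr ⟨x, by omega, fun h' => ?_⟩
        have := hS.2.ge hx
        rw [h', e', hSp, he'] at this
        exact not_geZ_self_add_one _ this

end TableauxSet

/-- Raising and lowering of different entries commute. -/
theorem moveCoeff_lower_raise {R : Tableau n} {p q : Pos n} (hpq : p ≠ q) :
    moveCoeff (· - 1) R q * moveCoeff (· + 1) (R.move (-1) q) p =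
      moveCoeff (· + 1) R p * moveCoeff (· - 1) (R.move 1 p) q := by
  have hqpos := q.row_pos
  rcases eq_or_ne q.row p.row with hrow | hrow
  · obtain ⟨g, hg⟩ := exists_moveCoeff_eq_div_sub (nb := (· + 1)) (R := R) (q := p) (q' := q)
      (Nat.succ_ne_self _) hpq hrow.symm
    obtain ⟨h, hh⟩ := exists_moveCoeff_eq_div_sub (nb := (· - 1)) (R := R) (q := q) (q' := p)
      (by omega) hpq.symm hrow
    rw [hg R fun t _ _ => rfl, hg (R.move (-1) q) fun t _ ht => move_of_ne _ _ ht,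
      hh R fun t _ _ => rfl, hh (R.move 1 p) fun t _ ht => move_of_ne _ _ ht, move_self, move_self,
      div_mul_div_comm, div_mul_div_comm]
    congr 1 <;> ring
  by_cases hadj : q.row = p.row + 1
  · obtain ⟨g, hg⟩ := exists_moveCoeff_eq (nb := (· + 1)) (R := R) (p := p) (q := q) hadj hrow
    obtain ⟨h, hh⟩ := exists_moveCoeff_eq (nb := (· - 1)) (R := R) (p := q) (q := p)
      (by omega) hrow.symm
    rw [hg R fun t _ => rfl, hg (R.move (-1) q) fun t ht => move_of_ne _ _ ht,
      hh R fun t _ => rfl, hh (R.move 1 p) fun t ht => move_of_ne _ _ ht, move_self, move_self]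
    ring
  · rw [moveCoeff_move hrow hadj, moveCoeff_move hrow.symm (by omega), mul_comm]

open Classical in
/-- The commutator of a raising and a lowering operator. -/
theorem lie_raise_lower {W : Type*} [AddCommGroup W] [Module ℂ W] (hC : C ⊆ relR n ∪ relR0 n)
    {b : Module.Basis (basisSet C L) ℂ W} {k l : ℕ} (hk : k < n) (hl : l < n)
    (R : basisSet C L) :
    ⁅moveOp b (-1) 1 (· + 1) k, moveOp b 1 (-1) (· - 1) l⁆ (b R) =
      ∑ q ∈ rowSet n l, ∑ p ∈ rowSet n k, if p = q then
        (lowerRaise (basisSet C L) R p - raiseLower (basisSet C L) R p) • b R else 0 := by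
  have h1 : moveOp b (-1) 1 (· + 1) k (moveOp b 1 (-1) (· - 1) l (b R)) =
      ∑ q ∈ rowSet n l, ∑ p ∈ rowSet n k,
        (if R.1.move (-1) q ∈ basisSet C L then
          -(moveCoeff (· - 1) R.1 q * moveCoeff (· + 1) (R.1.move (-1) q) p) else 0) •
          tableauVector b ((R.1.move (-1) q).move 1 p) := by
    rw [← tableauVector_of_mem R.2, moveOp_tableauVector R.2, map_sum]
    refine Finset.sum_congr rfl fun q _ => ?_
    rw [map_smul]
    split_ifs with h
    · rw [moveOp_tableauVector h, Finset.smul_sum]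
      refine Finset.sum_congr rfl fun p _ => ?_
      rw [smul_smul]
      congr 1; ring
    · simp [tableauVector_of_not_mem h]
  have h2 : moveOp b 1 (-1) (· - 1) l (moveOp b (-1) 1 (· + 1) k (b R)) =
      ∑ q ∈ rowSet n l, ∑ p ∈ rowSet n k,
        (if R.1.move 1 p ∈ basisSet C L then
          -(moveCoeff (· + 1) R.1 p * moveCoeff (· - 1) (R.1.move 1 p) q) else 0) •
          tableauVector b ((R.1.move (-1) q).move 1 p) := by
    rw [← tableauVector_of_mem R.2, moveOp_tableauVector R.2, map_sum, Finset.sum_comm]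
    refine Finset.sum_congr rfl fun p _ => ?_
    rw [map_smul]
    split_ifs with h
    · rw [moveOp_tableauVector h, Finset.smul_sum]
      refine Finset.sum_congr rfl fun q _ => ?_
      rw [smul_smul, move_comm]
      congr 1; ring
    · simp [tableauVector_of_not_mem h]
  rw [LieRing.of_associative_ring_bracket, LinearMap.sub_apply, Module.End.mul_apply,
    Module.End.mul_apply, h1, h2, ← Finset.sum_sub_distrib]
  refine Finset.sum_congr rfl fun q hq => ?_
  rw [← Finset.sum_sub_distrib]
  refine Finset.sum_congr rfl fun p hp => ?_
  rw [mem_rowSet] at hp hq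
  rw [← sub_smul]
  by_cases hpq : p = q
  · subst hpq
    have : (R.1.move (-1) p).move 1 p = R.1 := by
      funext t
      rw [move_apply, move_apply]
      split_ifs <;> ring
    rw [if_pos rfl, this, tableauVector_of_mem R.2, lowerRaise, raiseLower, lower_eq_move,
      raise_eq_move, raiseCoeff_eq, raiseCoeff_eq, lowerCoeff_eq, lowerCoeff_eq]
    congr 2 <;> · congr 1; ring
  -- If the final tableau is in the set, then so are both intermediate ones, and the two products of
  -- coefficients agree.
  · rw [if_neg hpq]
    by_cases hS : (R.1.move (-1) q).move 1 p ∈ basisSet C L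
    · rw [if_pos (lower_mem_of_lower_raise hC R.2 hpq (by omega) hS),
        if_pos (raise_mem_of_lower_raise hC R.2 hpq (by omega) hS), moveCoeff_lower_raise hpq,
        sub_self, zero_smul]
    · rw [tableauVector_of_not_mem hS, smul_zero]

/-- The value of `E_{ii}`, where `i` starts from `0`. -/
def weightValue (R : Tableau n) (i : ℕ) : ℂ :=
  i + ∑ p ∈ rowSet n (i + 1), R p - ∑ p ∈ rowSet n i, R p

theorem weightValue_move {R : Tableau n} {σ : ℂ} {p : Pos n} (i : ℕ) :
    weightValue (R.move σ p) i - weightValue R i =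
      σ * ((if p.row = i + 1 then 1 else 0) - if p.row = i then 1 else 0) := by
  have : ∀ m, ∑ t ∈ rowSet n m, R.move σ p t =
      ∑ t ∈ rowSet n m, R t + σ * if p.row = m then 1 else 0 := by
    intro m
    simp only [move_apply, Finset.sum_add_distrib, Finset.sum_ite_eq', mem_rowSet, mul_ite, mul_one,
      mul_zero]
  rw [weightValue, weightValue, this, this]
  ring

theorem lie_diagOp_moveOp {W : Type*} [AddCommGroup W] [Module ℂ W]
    {b : Module.Basis B ℂ W} {κ σ c : ℂ} {nb : ℕ → ℕ} {k : ℕ} {g : B → ℂ}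
    (h : ∀ (R S : B) (p : Pos n), p.row = k → S.1 = R.1.move σ p → g S - g R = c) :
    ⁅diagOp b g, moveOp b κ σ nb k⁆ = c • moveOp b κ σ nb k := by
  refine b.ext fun R => ?_
  rw [LieRing.of_associative_ring_bracket, LinearMap.sub_apply, Module.End.mul_apply,
    Module.End.mul_apply, diagOp_basis, map_smul, LinearMap.smul_apply, ← tableauVector_of_mem R.2,
    moveOp_tableauVector R.2, map_sum, Finset.smul_sum, Finset.smul_sum, ← Finset.sum_sub_distrib]
  refine Finset.sum_congr rfl fun p hp => ?_
  rw [map_smul]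
  by_cases hS : R.1.move σ p ∈ B
  · rw [tableauVector_of_mem hS, diagOp_basis, smul_smul, smul_smul, smul_smul, ← sub_smul,
      ← h R ⟨_, hS⟩ p (mem_rowSet.1 hp) rfl]
    congr 1; ring
  · simp [tableauVector_of_not_mem hS]

end Realization

end GelfandTsetlin
end

/-! ### Admissibility of the relations -/

noncomputable section
namespace GelfandTsetlin

section Admissibility

variable {n : ℕ} {C : Set (Relation n)} {B : Set (Tableau n)} {L : Tableau n}

theorem disjoint_rowSet {k l : ℕ} (h : k ≠ l) : Disjoint (rowSet n k) (rowSet n l) :=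
  Finset.disjoint_left.2 fun _ hp hp' => h ((mem_rowSet.1 hp).symm.trans (mem_rowSet.1 hp'))

open Classical in
-- Truncation by membership may be replaced by truncation at the poles: if the lowered tableau is
-- missing because of a tight relation, the rational expression is zero anyway.
theorem lowerRaise_eq (hC : C ⊆ relR n ∪ relR0 n) (hL : IsRealization C L) {R : Tableau n}
    (hR : R ∈ basisSet C L) {k : ℕ} (hk : k + 1 < n) {i : Pos n} (hi : i ∈ rowSet n (k + 1)) :
    lowerRaise (basisSet C L) R i = if ∃ q ∈ rowSet n (k + 1), R i = R q + 1 then 0 else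
      -((∏ x ∈ rowSet n k, (R i - R x)) * ∏ y ∈ rowSet n (k + 2), (R i - 1 - R y)) /
        ((∏ j ∈ (rowSet n (k + 1)).erase i, (R i - R j)) *
          ∏ j ∈ (rowSet n (k + 1)).erase i, (R i - 1 - R j)) := by
  rw [mem_rowSet] at hi
  unfold lowerRaise
  by_cases hq : ∃ q ∈ rowSet n (k + 1), R i = R q + 1
  · rw [if_pos hq, if_neg]
    intro hmem
    obtain ⟨q, hq, e⟩ := hq
    rw [mem_rowSet] at hq
    have hne : q ≠ i := by rintro rfl; simp at e
    refine hL.2 _ hmem i q (by omega) (by omega) hne.symm ?_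
    rw [lower_apply, lower_apply, if_pos rfl, if_neg hne, e]
    ring
  rw [if_neg hq]
  split_ifs with hmem
  · rw [lowerCoeff, raiseCoeff, hi, Nat.add_sub_cancel]
    have e : ∀ j, j ≠ i → R.lower i j = R j := fun j hj => by
      rw [lower_apply, if_neg hj, sub_zero]
    rw [Finset.prod_congr (s₁ := rowSet n (k + 1 + 1)) rfl fun j hj => by
        rw [e j (by rintro rfl; rw [mem_rowSet] at hj; omega)],
      Finset.prod_congr (s₁ := (rowSet n (k + 1)).erase i) (f := fun j => R.lower i i - R.lower i j)
        rfl fun j hj => by rw [e j (Finset.ne_of_mem_erase hj)],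
      lower_apply, if_pos rfl, mul_neg, div_mul_div_comm, neg_div]
  · rw [lower_eq_move] at hmem
    rcases exists_of_lower_not_mem hC hR (by omega) hmem with ⟨x, hx, e⟩ | ⟨y, hy, e⟩
    · have := (ge_cases hC hx).resolve_right fun h => by omega
      rw [Finset.prod_eq_zero (mem_rowSet.2 (by omega : x.row = k)) (sub_eq_zero.2 e), zero_mul,
        neg_zero, zero_div]
    · have := gt_cases hC hy
      rw [Finset.prod_eq_zero (s := rowSet n (k + 2)) (i := y) (mem_rowSet.2 (by omega))
        (by rw [e]; ring), mul_zero, neg_zero, zero_div]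

open Classical in
theorem raiseLower_eq (hC : C ⊆ relR n ∪ relR0 n) (hL : IsRealization C L) {R : Tableau n}
    (hR : R ∈ basisSet C L) {k : ℕ} (hk : k + 1 < n) {i : Pos n} (hi : i ∈ rowSet n (k + 1)) :
    raiseLower (basisSet C L) R i = -if ∃ p ∈ rowSet n (k + 1), R p = R i + 1 then 0 else
      ((∏ x ∈ rowSet n k, (R i + 1 - R x)) * ∏ y ∈ rowSet n (k + 2), (R i - R y)) /
        ((∏ j ∈ (rowSet n (k + 1)).erase i, (R i - R j)) *
          ∏ j ∈ (rowSet n (k + 1)).erase i, (R i + 1 - R j)) := by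
  rw [mem_rowSet] at hi
  unfold raiseLower
  by_cases hq : ∃ p ∈ rowSet n (k + 1), R p = R i + 1
  · rw [if_pos hq, if_neg, neg_zero]
    intro hmem
    obtain ⟨q, hq, e⟩ := hq
    rw [mem_rowSet] at hq
    have hne : q ≠ i := by rintro rfl; simp at e
    refine hL.2 _ hmem i q (by omega) (by omega) hne.symm ?_
    rw [raise_apply, raise_apply, if_pos rfl, if_neg hne, e, add_zero]
  rw [if_neg hq]
  split_ifs with hmem
  · rw [lowerCoeff, raiseCoeff, hi, Nat.add_sub_cancel]
    have e : ∀ j, j ≠ i → R.raise i j = R j := fun j hj => by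
      rw [raise_apply, if_neg hj, add_zero]
    rw [Finset.prod_congr (s₁ := rowSet n k) rfl fun j hj => by
        rw [e j (by rintro rfl; rw [mem_rowSet] at hj; omega)],
      Finset.prod_congr (s₁ := (rowSet n (k + 1)).erase i) (f := fun j => R.raise i i - R.raise i j)
        rfl fun j hj => by rw [e j (Finset.ne_of_mem_erase hj)],
      raise_apply, if_pos rfl, neg_mul, div_mul_div_comm, mul_comm (∏ y ∈ rowSet n (k + 1 + 1), _)]
  · rw [raise_eq_move] at hmem
    rcases exists_of_raise_not_mem hC hR (by omega) hmem with ⟨y, hy, e⟩ | ⟨x, hx, e⟩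
    · have := (ge_cases hC hy).resolve_right fun h => by omega
      rw [Finset.prod_eq_zero (s := rowSet n (k + 2)) (i := y) (mem_rowSet.2 (by omega))
        (sub_eq_zero.2 e.symm), mul_zero, zero_div, neg_zero]
    · have := gt_cases hC hx
      rw [Finset.prod_eq_zero (s := rowSet n k) (i := x) (mem_rowSet.2 (by omega))
        (sub_eq_zero.2 e.symm), zero_mul, zero_div, neg_zero]

namespace TableauxSet

/-- The left side is the residue sum `sum_truncated_residues`; `tangent_realization` supplies the
double zeros. -/
theorem sum_lowerRaise_sub (H : TableauxSet C B) (hL : IsRealization C L) {R : Tableau n}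
    (hR : R ∈ basisSet C L) {k : ℕ} (hk : k + 1 < n) :
    ∑ p ∈ rowSet n (k + 1), (lowerRaise (basisSet C L) R p - raiseLower (basisSet C L) R p) =
      weightValue R k - weightValue R (k + 1) := by
  rw [Finset.sum_congr rfl fun p hp => by
    rw [lowerRaise_eq H.subset hL hR hk hp, raiseLower_eq H.subset hL hR hk hp, sub_neg_eq_add]]
  rw [sum_truncated_residues _ _ _ R ((hL.2 R hR).injOn hk) (disjoint_rowSet (by omega))
    (by rw [card_rowSet (by omega), card_rowSet (by omega), card_rowSet (by omega)]; omega),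
    card_rowSet (by omega), card_rowSet (by omega), weightValue, weightValue]
  · push_cast; ring
  · intro p hp q hq h
    simp only [mem_rowSet] at hp hq ⊢
    obtain ⟨y, y', -, -, e, e', hy, hy', hc⟩ :=
      H.tangent_realization hL hR (by omega : p.row = q.row) (by omega) h
    rcases hc with ⟨-, hne⟩ | ⟨x, hx, -, -, ex⟩
    · exact Or.inl ⟨y, by omega, y', by omega, hne, e, e'⟩
    · exact Or.inr ⟨y, by omega, x, by omega, e, ex⟩

variable {W : Type*} [AddCommGroup W] [Module ℂ W]

/-- The generators with index `k` move row `k + 1`. Raising coefficients see the row above and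
lowering ones the row below, so `serre_upper` and `serre_lower` exchange roles between `e` and `f`.
-/
theorem serreRelations (H : TableauxSet C B) (hL : IsRealization C L)
    (b : Module.Basis (basisSet C L) ℂ W) :
    SerreRelations n
      (fun k => if k + 1 < n then moveOp b (-1) 1 (· + 1) (k + 1) else 0)
      (fun k => if k + 1 < n then moveOp b 1 (-1) (· - 1) (k + 1) else 0)
      (fun i => diagOp b fun R => weightValue R.1 i) := by
  have hu := H.moveSystem_raise hL
  have hd := H.moveSystem_lower hL
  constructor
  · intro k hk; exact if_neg (by omega)
  · intro k hk; exact if_neg (by omega)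
  · intro i j
    rw [LieRing.of_associative_ring_bracket, ← map_mul, ← map_mul, mul_comm, sub_self]
  · intro i k
    by_cases h1 : k + 1 < n
    · simp only [if_pos h1]
      refine lie_diagOp_moveOp fun R S p hp hS => ?_
      simp only [hS, weightValue_move, hp, one_mul, Nat.add_right_cancel_iff, eq_comm]
    · simp only [if_neg h1, lie_zero, smul_zero]
  · intro i k
    by_cases h1 : k + 1 < n
    · simp only [if_pos h1]
      refine lie_diagOp_moveOp fun R S p hp hS => ?_
      simp only [hS, weightValue_move, hp, neg_one_mul, Nat.add_right_cancel_iff, eq_comm]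
    · simp only [if_neg h1, lie_zero, smul_zero]
  · intro k hk
    rw [if_pos hk, if_pos hk]
    refine b.ext fun R => ?_
    rw [lie_raise_lower H.subset hk hk, LinearMap.sub_apply, diagOp_basis, diagOp_basis, ← sub_smul,
      ← H.sum_lowerRaise_sub hL R.2 hk, Finset.sum_smul]
    refine Finset.sum_congr rfl fun q hq => ?_
    rw [Finset.sum_ite_eq' _ _ _, if_pos hq]
  · intro k l hkl
    split_ifs with h1 h2
    · refine b.ext fun R => ?_
      rw [lie_raise_lower H.subset h1 h2, LinearMap.zero_apply]
      refine Finset.sum_eq_zero fun q hq => Finset.sum_eq_zero fun p hp => if_neg ?_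
      rintro rfl
      rw [mem_rowSet] at hq hp
      omega
    all_goals simp
  · intro k l hkl
    split_ifs with h1 h2
    · rw [LieRing.of_associative_ring_bracket, hu.moveOp_comm h1 h2 (by omega) (by omega) (by omega),
        sub_self]
    all_goals simp
  · intro k l hkl
    split_ifs with h1 h2
    · rw [LieRing.of_associative_ring_bracket, hd.moveOp_comm h1 h2 (by omega) (by omega) (by omega),
        sub_self]
    all_goals simp
  · intro k
    split_ifs with h1 h2
    · exact hu.serre_upper h1 h2 rfl (by omega) (by omega)
    all_goals simp
  · intro k
    split_ifs with h1 h2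
    · exact hu.serre_lower h2 h1 rfl (by omega) (by omega) (by omega)
    all_goals simp
  · intro k
    split_ifs with h1 h2
    · exact hd.serre_lower h2 h1 (by omega) (by omega) (by omega) (by omega)
    all_goals simp
  · intro k
    split_ifs with h1 h2
    · exact hd.serre_upper h1 h2 (by omega) (by omega) (by omega)
    all_goals simp

theorem isAdmissible (H : TableauxSet C B) : IsAdmissible C := by
  refine ⟨H.subset, fun L hL => ?_⟩
  obtain ⟨ρ, he, hf, hh⟩ := (H.serreRelations hL (VC.basis C L)).exists_lieHom
  refine ⟨ρ, ⟨fun k hk T => ?_, fun k hk T => ?_, fun i T => ?_⟩⟩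
  · rw [he, if_pos hk, ← tableauVector_of_mem T.2, moveOp_tableauVector T.2]
    exact Finset.sum_congr rfl fun p _ => by rw [raiseCoeff_eq, raise_eq_move]
  · rw [hf, if_pos hk, ← tableauVector_of_mem T.2, moveOp_tableauVector T.2]
    exact Finset.sum_congr rfl fun p _ => by rw [lowerCoeff_eq, lower_eq_move]
  · rw [hh, diagOp_basis, weightValue]

end TableauxSet

end Admissibility

end GelfandTsetlin
end

/-! ### Assembly: irreducible tableaux modules as relation modules -/

noncomputable section
namespace GelfandTsetlin

section TableauxModules

variable {n : ℕ} {V : Type*} [AddCommGroup V] [Module ℂ V] [LieRingModule (Gl n) V]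
  [LieModule ℂ (Gl n) V] {B : Set (Tableau n)} {b : Module.Basis B ℂ V}

/-- The basis of an irreducible tableaux module. -/
theorem tableauxBasis_of_irreducible (hn : n ≤ 4) (hirr : LieModule.IsIrreducible ℂ (Gl n) V)
    (hB : ∀ T ∈ B, T.Noncritical) (hF : FollowsGTFormulas (LieModule.toEnd ℂ (Gl n) V) b)
    (hγ : ∀ (T : B) (m k : ℕ), 1 ≤ k → k ≤ m → m ≤ n →
      actU n V (casimir n m k) (b T) = MvPolynomial.eval T.1 (gammaPoly n m k) • b T) :
    TableauxBasis B := by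
  have hcas : ∀ m r, 1 ≤ r → r ≤ m → m ≤ n →
      Matrix.trace (opMat (LieModule.toEnd ℂ (Gl n) V) m ^ r) = diagOp b (rowGamma B m r) := by
    intro m r hr hrm hm
    rw [← actU_casimir]
    exact eq_diagOp fun T => by rw [hγ T m r hr hrm hm, eval_gammaPoly, rowGamma]
  have : Nontrivial V := (LieSubmodule.nontrivial_iff ℂ (Gl n) V).1 hirr.toNontrivial
  obtain ⟨T⟩ := b.index_nonempty
  exact
    { nonempty := ⟨T.1, T.2⟩
      noncritical := hB
      rowRelation := fun T hT k hk => rowRelation_of_tableaux hF hB hk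
        (trace_opMat_pow_eq hF hB hn hcas (k + 1) hk.le 2 (by omega) (by omega))
        (blockInv_eq hF hB hn hcas) ⟨T, hT⟩
      eq_univ := fun S hne hr hl => eq_univ_of_closed hirr hF hne hr hl }

/-- A module with a basis of tableaux of the form `𝓑_C(T(L))` is `V_C(T(L))`. -/
theorem exists_equiv_VC {C : Set (Relation n)} {L : Tableau n}
    (hF : FollowsGTFormulas (LieModule.toEnd ℂ (Gl n) V) b) (h : B = basisSet C L) :
    ∃ ρ : Gl n →ₗ⁅ℂ⁆ Module.End ℂ (VC C L), FollowsGTFormulas ρ (VC.basis C L) ∧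
      ∃ e : V ≃ₗ[ℂ] VC C L, ∀ (x : Gl n) (v : V), e ⁅x, v⁆ = ρ x (e v) := by
  subst h
  let e : V ≃ₗ[ℂ] VC C L := b.repr
  have he : ∀ T, e (b T) = VC.basis C L T := fun T => b.repr_self T
  have he' : ∀ R, e (tableauVector b R) = tableauVector (VC.basis C L) R := by
    intro R
    unfold tableauVector
    split_ifs
    · exact he _
    · exact map_zero e
  let ρ : Gl n →ₗ⁅ℂ⁆ Module.End ℂ (VC C L) :=
    (LinearEquiv.lieConj e).toLieHom.comp (LieModule.toEnd ℂ (Gl n) V)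
  have hρ : ∀ x v, ρ x (e v) = e (LieModule.toEnd ℂ (Gl n) V x v) := fun x v =>
    congrArg (fun u => e (LieModule.toEnd ℂ (Gl n) V x u)) (e.symm_apply_apply v)
  refine ⟨ρ, ⟨fun k hk T => ?_, fun k hk T => ?_, fun i T => ?_⟩, e, fun x v => (hρ x v).symm⟩
  · rw [← he, hρ, hF.raise, map_sum]
    exact Finset.sum_congr rfl fun p _ => by rw [map_smul, he']
  · rw [← he, hρ, hF.lower, map_sum]
    exact Finset.sum_congr rfl fun p _ => by rw [map_smul, he']
  · rw [← he, hρ, hF.diag, map_smul]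

end TableauxModules

end GelfandTsetlin
end

open GelfandTsetlin in
theorem mainTheorem8 (n : ℕ) (hn2 : 2 ≤ n) (hn4 : n ≤ 4)
    (V : Type*) [AddCommGroup V] [Module ℂ V] [LieRingModule (Gl n) V] [LieModule ℂ (Gl n) V]
    (hirr : LieModule.IsIrreducible ℂ (Gl n) V) (hV : IsTableauxModule n V) :
    ∃ (C : Set (Relation n)) (L : Tableau n),
      IsAdmissible C ∧ IsRealization C L ∧
      ∃ ρ : Gl n →ₗ⁅ℂ⁆ Module.End ℂ (VC C L),
        FollowsGTFormulas ρ (VC.basis C L) ∧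
        ∃ e : V ≃ₗ[ℂ] VC C L, ∀ (x : Gl n) (v : V), e ⁅x, v⁆ = ρ x (e v) := by
  obtain ⟨-, -, B, b, hB, hF, hγ⟩ := hV
  have H := (tableauxBasis_of_irreducible hn4 hirr hB hF hγ).tableauxSet
  obtain ⟨T, hT⟩ := H.nonempty
  exact ⟨commonRelations B, T, H.isAdmissible, H.isRealization hT,
    exists_equiv_VC hF (H.eq_basisSet hT)⟩
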